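/- **Conventions.** All vector spaces are over $\mathbb{Q}$. Let $R$ be a set, and let $S$ be a (partially) ordered set. *Polygons.* An $R$-deco polygon $\pi=[a_1,\dots,a_N]$, $N\ge 2$, is an oriented convex $N$-gon whose sides are decorated by elements of $R$; the last side is the root side, and the first vertex is the common vertex of the root side and the first side. Its weight is $\chi(\pi)=N-1$. A (non-trivial) arrow goes from a vertex to the interior of a non-incident side; it is backward if its end precedes its beginning in the linear order of the sides, otherwise forward. Arrows are taken up to moving the end point on its side. A dissection $D$ of $\pi$ is a finite, possibly empty, set of arrows which have pairwise no point in common except possibly the starting point. Its root region is the one containing the first vertex and part of the root side. The dual tree $\tau(D)$ has the regions as vertices and the arrows as edges, and is rooted at the root region. Contracting the arrows in the boundary of a region gives an $R$-deco polygon: the root region inherits root and orientation from $\pi$; the region right under the arrow $\alpha\in D$ gives a polygon $\pi_{D,\alpha}$ whose root side is the one on which $\alpha$ ends, with the orientation of $\pi$ if $\alpha$ is forward and the opposite one if $\alpha$ is backward. Put $\mathrm{sgn}(D)=\prod_{\alpha\in D\text{ backward}}(-1)^{\chi(\pi_{D,\alpha})}$. The dissection $D$ is admissible if each simple path in $\tau(D)$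 starting at the root contains at most one edge. *Enhanced polygons.* An enhanced polygon $\bar\pi$ has a side $s$ of second type decorated in $S$, followed by $m\ge 0$ sides decorated in $R$, and a root side $r$ decorated in $R\cap S$, with $s\le r$ in $S$. Its dissecting arrows are the non-trivial arrows of this $(m+2)$-gon which do not start at the vertex $s\cap r$ and do not end in $s$. Dissections, dual trees, signs and admissibility are defined as above; the root region gives again an enhanced polygon, the other regions give $R$-deco polygons. *Bar constructions.* Let $V$ and $\overline V$ be the vector spaces freely generated by the $R$-deco polygons and by the enhanced polygons, $\mathcal P=\Lambda^\bullet V$ (polygons have degree $1$), and $\overline{\mathcal P}=\overline V\otimes\mathcal P$ (enhanced polygons have degree $0$). Let $\kappa(\pi)=\sum_\alpha \mathrm{sgn}(\alpha)\,\pi^{\rm root}_\alpha\wedge\pi^{\rm cut}_\alpha$ and $\bar\kappa(\bar\pi)=\sum_\alpha \mathrm{sgn}(\alpha)\,\bar\pi^{\rm root}_\alpha\otimes\pi^{\rm cut}_\alpha$, where $\alpha$ runs over the dissecting arrows and $\mathrm{sgn}(\alpha)=\mathrm{sgn}(\{\alpha\})$. The derivation $\partial$ of $\mathcal P$ extending $\kappa$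 and the map $\bar\partial(\bar\pi\otimes\pi')=\bar\kappa(\bar\pi)\wedge\pi'-\bar\pi\otimes\partial\pi'$ are the differentials. $B(\mathcal P)$ is the tensor coalgebra on the augmentation ideal $\mathcal P_+$, and $B(\overline{\mathcal P},\mathcal P)=\overline{\mathcal P}\otimes B(\mathcal P)$, with elements written $[\bar\pi_1|\pi_2|\cdots|\pi_n]$, is a right $B(\mathcal P)$-comodule by deconcatenation, $[\bar\pi_1|\cdots|\pi_n]\mapsto\sum_{i=1}^n[\bar\pi_1|\cdots|\pi_i]\otimes[\pi_{i+1}|\cdots|\pi_n]$. Its degree is $\deg\bar\pi_1+\sum_{i\ge2}(\deg\pi_i-1)\ge0$. Its differential is $D_1+D_2$. On words of degree $0$ (all the $\pi_i\in V$ and $\bar\pi_1\in\overline V$), $D_1$ is the sum over $1\le j<n$ of $(-1)^j$ times the word in which the $j$-th bar is replaced by a wedge (for $j=1$ by the action of $\mathcal P$ on $\overline{\mathcal P}$), and $D_2$ is the sum over $1\le j\le n$ of $(-1)^{j-1}$ times the word in which the $j$-th factor is replaced by its differential. In general $D_1$ has the sign $(-1)^{j+k}$ in degree $k$, and $D_2$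 has the sign $(-1)^{1+\deg\bar\pi_1+\sum_{2\le i<j}\deg\pi_i}$ for $j\ge2$. Since there is nothing in negative degree, $H^0B(\overline{\mathcal P},\mathcal P)$ is the kernel of $D_1+D_2$ in degree $0$. For a polygon $\pi$ put $$B(\pi)=\sum_{D}\mathrm{sgn}(D)\sum_\lambda\,[\pi_D^{\lambda(1)}|\cdots|\pi_D^{\lambda(|D|+1)}]\in B(\mathcal P),$$ where $D$ runs over all dissections of $\pi$ and $\lambda$ over all linear orders of the $|D|+1$ polygons $\pi_D^i$ of the regions which are compatible with the partial order of $\tau(D)$ (the root comes first). The element $B(\bar\pi)\in B(\overline{\mathcal P},\mathcal P)$ is defined by the same formula. **Theorem.** (1) For every enhanced polygon $\bar\pi$, $B(\bar\pi)$ is a $0$-cocycle, i.e. it lies in $H^0B(\overline{\mathcal P},\mathcal P)$. (2) The image of $B(\bar\pi)$ under the comodule map $B(\overline{\mathcal P},\mathcal P)\to B(\overline{\mathcal P},\mathcal P)\otimes B(\mathcal P)$ is $$\sum_{D}\mathrm{sgn}(D)\;B(\bar\pi^D_R)\otimes \mathop{ш}_{i}B(\pi^D_{P_i}),$$ where $D$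 runs over the admissible dissections of $\bar\pi$ (including the empty one), $\bar\pi^D_R$ is the root polygon of $D$, the $\pi^D_{P_i}$ are the remaining polygons, and ш is the shuffle product (the empty shuffle product is $1$). (3) Accordingly, let $\mathrm S^\bullet V$ be the symmetric algebra with the algebra homomorphism $\Delta:\mathrm S^\bullet V\to\mathrm S^\bullet V\otimes\mathrm S^\bullet V$, $\Delta(\pi)=1\otimes\pi+\sum_{D}\mathrm{sgn}(D)\,\pi^D_R\otimes\prod_i\pi^D_{P_i}$ ($D$ over the admissible dissections of $\pi$), and with the counit $\varepsilon$ which vanishes on $V$. Then $\delta:\overline V\to\overline V\otimes\mathrm S^\bullet V$, $\delta(\bar\pi)=\sum_{D}\mathrm{sgn}(D)\,\bar\pi^D_R\otimes\prod_i\pi^D_{P_i}$ ($D$ over the admissible dissections of $\bar\pi$), is a comodule structure: $(\delta\otimes\mathrm{id})\delta=(\mathrm{id}\otimes\Delta)\delta$ and $(\mathrm{id}\otimes\varepsilon)\delta=\mathrm{id}$. -/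

import Mathlib

open scoped TensorProduct

noncomputable section

namespace PolygonBar

/-! ## Arrows and dissections

The sides of an `N`-gon are numbered `0, …, N - 1` in their linear order, so that the root side is
`N - 1`; the vertex `v` is the starting point of the side `v`, so that the first vertex is `0` and
the side `e` joins the vertices `e` and `e + 1` (modulo `N`). An arrow is a pair `(v, e)`: it starts
at the vertex `v` and ends in the interior of the side `e`. -/

abbrev Arrow := ℕ × ℕ

/-- The non-trivial arrows of an `N`-gon: the vertex does not lie on the side. -/
def arrows (N : ℕ) : Finset Arrow :=
  (Finset.range N ×ˢ Finset.range N).filter (fun α => α.1 ≠ α.2 ∧ α.1 ≠ (α.2 + 1) % N)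

/-- The end of the arrow comes before its beginning. All other arrows are forward. -/
def IsBackward (α : Arrow) : Prop := α.2 < α.1

instance (α : Arrow) : Decidable (IsBackward α) := inferInstanceAs (Decidable (α.2 < α.1))

/-- Along the boundary, starting from the first vertex, the vertex `v` sits at the position `2 v` and
the interior of the side `e` at the position `2 e + 1`. An arrow cuts off (on the side away from the
first vertex and the root) the part of the boundary between the positions `lo` and `hi`. -/
def lo (α : Arrow) : ℕ := min (2 * α.1) (2 * α.2 + 1)

def hi (α : Arrow) : ℕ := max (2 * α.1) (2 * α.2 + 1)

/-- Two arrows must meet (other than in a common starting point) exactly when their end points are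
strictly interleaved. Arrows ending on the same side can be drawn with disjoint end points. -/
def Crosses (α β : Arrow) : Prop := lo α < lo β ∧ lo β < hi α ∧ hi α < hi β

/-- `β` lies in the region cut off by `α`, that is, in the dual tree `β` is further away from the
root than `α`, on the same branch. -/
def Below (β α : Arrow) : Prop := β ≠ α ∧ lo α ≤ lo β ∧ hi β ≤ hi α

instance (α β : Arrow) : Decidable (Crosses α β) :=
  inferInstanceAs (Decidable (lo α < lo β ∧ lo β < hi α ∧ hi α < hi β))

instance (β α : Arrow) : Decidable (Below β α) :=
  inferInstanceAs (Decidable (β ≠ α ∧ lo α ≤ lo β ∧ hi β ≤ hi α))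

/-- A dissection, given by its set of pairwise non-intersecting arrows, taken from a given set `A`
of admitted arrows. -/
def dissections (A : Finset Arrow) : Finset (Finset Arrow) :=
  A.powerset.filter (fun D => ∀ α ∈ D, ∀ β ∈ D, ¬ Crosses α β)

/-- The root region is treated as the region under a fictitious forward arrow, the root arrow, which
starts at the first vertex and ends in the root side. -/
def rootArrow (N : ℕ) : Arrow := (0, N - 1)

/-- The sides which the arrow `α` cuts off entirely. (The side `α.2` is divided by `α` and
contributes to the regions on both sides of `α`.) -/
def removed (α : Arrow) : Finset ℕ :=
  if IsBackward α then Finset.Ioo α.2 α.1 else Finset.Ico α.1 α.2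

/-- The non-root sides of the region right under the arrow `α` in the dissection `D`, after all the
arrows in the boundary are contracted. The root side of this region is `α.2`. -/
def armSet (D : Finset Arrow) (α : Arrow) : Finset ℕ :=
  removed α \ (D.filter (fun β => Below β α)).biUnion removed

/-- The same sides in the linear order of the region: the orientation is reversed when `α` is
backward. -/
def armList (D : Finset Arrow) (α : Arrow) : List ℕ :=
  if IsBackward α then ((armSet D α).sort (· ≤ ·)).reverse else (armSet D α).sort (· ≤ ·)

/-- The sign of a dissection: the product over its backward arrows of `(-1) ^ χ`, where `χ` is the
number of non-root sides of the region right under the arrow. -/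
def sgn (D : Finset Arrow) : ℚ :=
  ∏ α ∈ D, if IsBackward α then (-1) ^ (armSet D α).card else 1

/-- The linear orders on the regions of `D` which are compatible with the partial order of the dual
tree. The root region, which always comes first, is left out, and the other regions are represented
by the arrows right above them. -/
def orders (D : Finset Arrow) : Finset (List Arrow) :=
  D.val.lists.toFinset.filter (fun l => l.Pairwise (fun α β => ¬ Below α β))

/-- The edges of the dual tree of `D` on the simple path from the root to the region under `α`. -/
def path (D : Finset Arrow) (α : Arrow) : Finset Arrow :=
  D.filter (fun β => β = α ∨ Below α β)

/-- A set `C` of edges of the dual tree of `D` is an admissible cut if each simple path which starts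
at the root contains at most one element of `C`. -/
def IsAdmissibleCut (D C : Finset Arrow) : Prop :=
  C ⊆ D ∧ ∀ α ∈ D, (path D α ∩ C).card ≤ 1

instance (D C : Finset Arrow) : Decidable (IsAdmissibleCut D C) :=
  inferInstanceAs (Decidable (C ⊆ D ∧ ∀ α ∈ D, (path D α ∩ C).card ≤ 1))

/-- The admissible dissections: all their arrows together form an admissible cut. -/
def admissible (A : Finset Arrow) : Finset (Finset Arrow) :=
  (dissections A).filter (fun D => IsAdmissibleCut D D)

/-! ### Every region has at least one non-root side -/

theorem mem_arrows {N : ℕ} {α : Arrow} :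
    α ∈ arrows N ↔ (α.1 < N ∧ α.2 < N) ∧ α.1 ≠ α.2 ∧ α.1 ≠ (α.2 + 1) % N := by
  simp [arrows]

theorem mem_removed {α : Arrow} {i : ℕ} :
    i ∈ removed α ↔ (α.2 < i ∧ i < α.1) ∨ (α.1 ≤ i ∧ i < α.2) := by
  by_cases h : IsBackward α
  · rw [removed, if_pos h, Finset.mem_Ioo]
    simp only [IsBackward] at h
    omega
  · rw [removed, if_neg h, Finset.mem_Ico]
    simp only [IsBackward] at h
    omega

theorem removed_nonempty {N : ℕ} {α : Arrow} (h : α ∈ arrows N) : ∃ i, i ∈ removed α := by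
  obtain ⟨⟨h1, h2⟩, h3, h4⟩ := mem_arrows.1 h
  rcases lt_or_gt_of_ne h3 with h5 | h5
  · exact ⟨α.1, mem_removed.2 (Or.inr ⟨le_rfl, h5⟩)⟩
  · rw [Nat.mod_eq_of_lt (by omega)] at h4
    exact ⟨α.2 + 1, mem_removed.2 (Or.inl (by omega))⟩

/-- A region of a dissection has a non-root side, provided that its upper arrow cuts off a side
entirely and is compatible with the dissection. -/
theorem armSet_nonempty {D : Finset Arrow} {α : Arrow} (hα : ∃ i, i ∈ removed α)
    (hD : ∀ β ∈ D, ∀ γ ∈ D, ¬ Crosses β γ) : (armSet D α).Nonempty := by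
  by_contra hne
  have hall : ∀ i ∈ removed α, ∃ β ∈ D, Below β α ∧ i ∈ removed β := by
    intro i hi
    by_contra hcon
    apply hne
    refine ⟨i, ?_⟩
    simp only [armSet, Finset.mem_sdiff, Finset.mem_biUnion, Finset.mem_filter, not_exists, not_and]
    exact ⟨hi, fun β hβ hiβ => hcon ⟨β, hβ.1, hβ.2, hiβ⟩⟩
  obtain ⟨i₀, hi₀⟩ := hα
  rw [mem_removed] at hi₀
  rcases hi₀ with hb | hf
  · have step : ∀ n j, α.2 < j → j < α.1 → j ≤ α.2 + n →
        (j = α.1 - 1 ∨ ∃ β ∈ D, Below β α ∧ β.1 = α.1 ∧ β.2 = j) → False := by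
      intro n
      induction n with
      | zero => intro j h1 _ h3; omega
      | succ n ih =>
        intro j h1 h2 h3 h4
        obtain ⟨γ, hγD, hγα, hγ⟩ := hall j (mem_removed.2 (Or.inl ⟨h1, h2⟩))
        obtain ⟨hne', hl, hh⟩ := hγα
        have hne2 : ¬ (γ.1 = α.1 ∧ γ.2 = α.2) := fun h => hne' (Prod.ext h.1 h.2)
        rw [mem_removed] at hγ
        simp only [lo, hi] at hl hh
        rcases h4 with h4 | ⟨β, hβD, hβα, hβ1, hβ2⟩
        · have hγ1 : γ.1 = α.1 := by omega
          exact ih γ.2 (by omega) (by omega) (by omega)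
            (Or.inr ⟨γ, hγD, ⟨hne', by simp only [lo]; omega, by simp only [hi]; omega⟩, hγ1, rfl⟩)
        · have hc := hD γ hγD β hβD
          simp only [Crosses, lo, hi] at hc
          have hγ1 : γ.1 = α.1 := by omega
          exact ih γ.2 (by omega) (by omega) (by omega)
            (Or.inr ⟨γ, hγD, ⟨hne', by simp only [lo]; omega, by simp only [hi]; omega⟩, hγ1, rfl⟩)
    exact step α.1 (α.1 - 1) (by omega) (by omega) (by omega) (Or.inl rfl)
  · have step : ∀ n j, α.1 ≤ j → j < α.2 → α.2 ≤ j + n →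
        (j = α.1 ∨ ∃ β ∈ D, Below β α ∧ β.1 = α.1 ∧ β.2 = j) → False := by
      intro n
      induction n with
      | zero => intro j h1 _ h3; omega
      | succ n ih =>
        intro j h1 h2 h3 h4
        obtain ⟨γ, hγD, hγα, hγ⟩ := hall j (mem_removed.2 (Or.inr ⟨h1, h2⟩))
        obtain ⟨hne', hl, hh⟩ := hγα
        have hne2 : ¬ (γ.1 = α.1 ∧ γ.2 = α.2) := fun h => hne' (Prod.ext h.1 h.2)
        rw [mem_removed] at hγ
        simp only [lo, hi] at hl hh
        rcases h4 with h4 | ⟨β, hβD, hβα, hβ1, hβ2⟩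
        · have hγ1 : γ.1 = α.1 := by omega
          exact ih γ.2 (by omega) (by omega) (by omega)
            (Or.inr ⟨γ, hγD, ⟨hne', by simp only [lo]; omega, by simp only [hi]; omega⟩, hγ1, rfl⟩)
        · have hc := hD β hβD γ hγD
          simp only [Crosses, lo, hi] at hc
          have hγ1 : γ.1 = α.1 := by omega
          exact ih γ.2 (by omega) (by omega) (by omega)
            (Or.inr ⟨γ, hγD, ⟨hne', by simp only [lo]; omega, by simp only [hi]; omega⟩, hγ1, rfl⟩)
    exact step α.2 α.1 (by omega) (by omega) (by omega) (Or.inl rfl)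

/-! ## Polygons -/

universe u

variable {Λ : Type u}

/-- An `R`-deco polygon `[a₁, …, a_N]`, `N ≥ 2`: the decorations `a₁, …, a_{N-1}` of the non-root
sides in their linear order, and the decoration `a_N` of the root side. -/
structure Polygon (R : Set Λ) where
  arms : List R
  arms_ne : arms ≠ []
  root : R

namespace Polygon

variable {R : Set Λ}

/-- The number of sides. -/
def size (π : Polygon R) : ℕ := π.arms.length + 1

/-- The decoration of the side `i`, for `i < π.size`. -/
def side (π : Polygon R) (i : ℕ) : R := π.arms.getD i π.root

/-- All non-trivial arrows of a polygon are dissecting arrows. -/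
def dissectingArrows (π : Polygon R) : Finset Arrow := arrows π.size

/-- The polygon of the region right under the arrow `α` in the dissection `D`. The second branch
never occurs for the regions of a dissection (`regionArms_ne_nil`). -/
def region (π : Polygon R) (D : Finset Arrow) (α : Arrow) : Polygon R :=
  if h : (armList D α).map π.side ≠ [] then ⟨(armList D α).map π.side, h, π.side α.2⟩ else π

/-- The polygon of the root region. -/
def rootRegion (π : Polygon R) (D : Finset Arrow) : Polygon R := π.region D (rootArrow π.size)

end Polygon

/-- An enhanced polygon: a side of second type, decorated by `second ∈ S`, followed by the sides of
first type, decorated by elements of `R`, and by the root side, whose decoration `root ∈ R ∩ S`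
satisfies `second ≤ root` in the ordered set `S`. The side of second type has the number `0`, the
root side has the number `arms.length + 1`. -/
structure EnhancedPolygon (R S : Set Λ) [PartialOrder S] where
  second : S
  arms : List R
  root : R
  root_mem : root.1 ∈ S
  second_le : second ≤ ⟨root.1, root_mem⟩

namespace EnhancedPolygon

variable {R S : Set Λ} [PartialOrder S]

/-- The number of sides, including the side of second type. -/
def size (π : EnhancedPolygon R S) : ℕ := π.arms.length + 2

/-- The decoration of the side `i` of first type or of the root side, for `0 < i < π.size`. -/
def side (π : EnhancedPolygon R S) (i : ℕ) : R := π.arms.getD (i - 1) π.root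

/-- The dissecting arrows of an enhanced polygon neither start at the common vertex of the side of
second type and the root side, nor end in the side of second type. -/
def dissectingArrows (π : EnhancedPolygon R S) : Finset Arrow :=
  (arrows π.size).filter (fun α => α.1 ≠ 0 ∧ α.2 ≠ 0)

/-- The polygon of the root region: it contains the side `0` of second type, and it is again an
enhanced polygon. -/
def rootRegion (π : EnhancedPolygon R S) (D : Finset Arrow) : EnhancedPolygon R S where
  second := π.second
  arms := ((armList D (rootArrow π.size)).filter (fun i => i ≠ 0)).map π.side
  root := π.root
  root_mem := π.root_mem
  second_le := π.second_le

/-- The (ordinary) polygon of the region right under the arrow `α ∈ D`. The second branch never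
occurs for a dissection `D` (`regionArms_ne_nil`). -/
def region (π : EnhancedPolygon R S) (D : Finset Arrow) (α : Arrow) : Polygon R :=
  if h : (armList D α).map π.side ≠ [] then ⟨(armList D α).map π.side, h, π.side α.2⟩
  else ⟨[π.root], List.cons_ne_nil _ _, π.root⟩

end EnhancedPolygon

theorem regionArms_ne_nil {R : Set Λ} {N : ℕ} {A D : Finset Arrow} {α : Arrow} (hN : 2 ≤ N)
    (hA : A ⊆ arrows N) (hD : D ∈ dissections A) (hα : α ∈ D ∨ α = rootArrow N) (f : ℕ → R) :
    (armList D α).map f ≠ [] := by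
  obtain ⟨hDA, hc⟩ := Finset.mem_filter.1 hD
  have hex : ∃ i, i ∈ removed α := by
    rcases hα with hα | rfl
    · exact removed_nonempty (hA (Finset.mem_powerset.1 hDA hα))
    · exact ⟨0, mem_removed.2 (Or.inr ⟨le_rfl, by simp only [rootArrow]; omega⟩)⟩
  obtain ⟨i, hi⟩ := armSet_nonempty hex hc
  intro h
  have hm : i ∈ armList D α := by
    unfold armList
    split_ifs <;> simpa using hi
  rw [List.map_eq_nil_iff] at h
  simp [h] at hm

/-! ## The polygon algebra -/

section PolygonAlgebra

variable (R : Set Λ)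

/-- The vector space freely generated by the `R`-deco polygons. -/
abbrev Vpg : Type u := Polygon R →₀ ℚ

/-- The polygon algebra: the exterior algebra. Polygons have degree `1`. -/
abbrev PolyAlg : Type u := ExteriorAlgebra ℚ (Vpg R)

variable {R}

/-- A polygon as an element of the polygon algebra. -/
def gen (π : Polygon R) : PolyAlg R := ExteriorAlgebra.ι ℚ (Finsupp.single π 1)

/-- The differential of a polygon: `∑_α sgn(α) π_α^{root} ∧ π_α^{cut-off}`. -/
def kappaPolygon (π : Polygon R) : PolyAlg R :=
  ∑ α ∈ π.dissectingArrows, sgn {α} • (gen (π.rootRegion {α}) * gen (π.region {α} α))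

/-- The cobracket `κ`. -/
def kappa : Vpg R →ₗ[ℚ] PolyAlg R := Finsupp.linearCombination ℚ kappaPolygon

theorem gen_mul_gen_comm (a b : Polygon R) (v : Vpg R) :
    gen a * gen b * ExteriorAlgebra.ι ℚ v = ExteriorAlgebra.ι ℚ v * (gen a * gen b) := by
  have h1 : gen b * ExteriorAlgebra.ι ℚ v = -(ExteriorAlgebra.ι ℚ v * gen b) :=
    eq_neg_of_add_eq_zero_left (ExteriorAlgebra.ι_add_mul_swap _ _)
  have h2 : gen a * ExteriorAlgebra.ι ℚ v = -(ExteriorAlgebra.ι ℚ v * gen a) :=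
    eq_neg_of_add_eq_zero_left (ExteriorAlgebra.ι_add_mul_swap _ _)
  rw [mul_assoc, h1, mul_neg, ← mul_assoc, h2, neg_mul, neg_neg, mul_assoc]

theorem kappa_comm (w v : Vpg R) :
    kappa w * ExteriorAlgebra.ι ℚ v = ExteriorAlgebra.ι ℚ v * kappa w := by
  induction w using Finsupp.induction_linear with
  | zero => simp
  | add x y hx hy => simp only [map_add, add_mul, mul_add, hx, hy]
  | single π c =>
    simp only [kappa, Finsupp.linearCombination_single, kappaPolygon, smul_mul_assoc,
      mul_smul_comm, Finset.sum_mul, Finset.mul_sum, gen_mul_gen_comm]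

def diffAux : Vpg R →ₗ[ℚ] PolyAlg R × PolyAlg R →ₗ[ℚ] PolyAlg R :=
  LinearMap.mk₂ ℚ (fun v p => kappa v * p.1 - ExteriorAlgebra.ι ℚ v * p.2)
    (by intro a b p; simp only [map_add, add_mul]; abel)
    (by intro c a p; simp only [map_smul, smul_mul_assoc, smul_sub])
    (by intro a p q; simp only [Prod.fst_add, Prod.snd_add, mul_add]; abel)
    (by intro c a p; simp only [Prod.smul_fst, Prod.smul_snd, mul_smul_comm, smul_sub])

theorem diffAux_diffAux (v : Vpg R) (x y : PolyAlg R) :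
    diffAux v (CliffordAlgebra.ι 0 v * x, diffAux v (x, y)) =
      (0 : QuadraticForm ℚ (Vpg R)) v • y := by
  have h : (CliffordAlgebra.ι (0 : QuadraticForm ℚ (Vpg R)) v) * CliffordAlgebra.ι 0 v = 0 :=
    ExteriorAlgebra.ι_sq_zero v
  change kappa v * (ExteriorAlgebra.ι ℚ v * x) -
    ExteriorAlgebra.ι ℚ v * (kappa v * x - ExteriorAlgebra.ι ℚ v * y) = _
  rw [mul_sub, ← mul_assoc, ← mul_assoc, ← mul_assoc, kappa_comm]
  change _ - (_ - CliffordAlgebra.ι 0 v * CliffordAlgebra.ι 0 v * y) = _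
  rw [h]
  simp

/-- The differential `∂` of the polygon algebra, determined by `diff_one` and `diff_ι_mul`. -/
def diff : PolyAlg R →ₗ[ℚ] PolyAlg R :=
  CliffordAlgebra.foldr' 0 diffAux diffAux_diffAux 0

theorem diff_algebraMap (r : ℚ) : diff (algebraMap ℚ (PolyAlg R) r) = 0 := by
  simp [diff, CliffordAlgebra.foldr'_algebraMap]

/-- The Leibniz rule. -/
theorem diff_ι_mul (v : Vpg R) (x : PolyAlg R) :
    diff (ExteriorAlgebra.ι ℚ v * x) = kappa v * x - ExteriorAlgebra.ι ℚ v * diff x :=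
  CliffordAlgebra.foldr'_ι_mul 0 diffAux diffAux_diffAux 0 v x

/-- The sign operator: it multiplies the elements of exterior degree `d` by `(-1) ^ d`. -/
def gradeSign : PolyAlg R →ₐ[ℚ] PolyAlg R := CliffordAlgebra.involute

variable (R)

/-- The augmentation ideal: the elements without component in exterior degree `0`. -/
abbrev AugIdeal : Submodule ℚ (PolyAlg R) :=
  LinearMap.ker (ExteriorAlgebra.algebraMapInv (R := ℚ) (M := Vpg R)).toLinearMap

variable {R}

theorem mem_augIdeal {x : PolyAlg R} :
    x ∈ AugIdeal R ↔ ExteriorAlgebra.algebraMapInv x = 0 := Iff.rfl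

theorem algebraMapInv_ι (v : Vpg R) :
    ExteriorAlgebra.algebraMapInv (ExteriorAlgebra.ι ℚ v) = (0 : ℚ) := by
  simp [ExteriorAlgebra.algebraMapInv]

theorem diff_mem (x : PolyAlg R) : diff x ∈ AugIdeal R := by
  rw [mem_augIdeal]
  induction x using CliffordAlgebra.left_induction with
  | algebraMap r =>
    have h := diff_algebraMap (R := R) r
    rw [h, map_zero]
  | add x y hx hy => rw [map_add, map_add, hx, hy, add_zero]
  | ι_mul x v hx =>
    have h := diff_ι_mul v x
    have hk : ExteriorAlgebra.algebraMapInv (kappa v) = (0 : ℚ) := by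
      induction v using Finsupp.induction_linear with
      | zero => simp
      | add x y hx hy => simp_all [diff_ι_mul]
      | single π c =>
        simp [kappa, kappaPolygon, gen, algebraMapInv_ι]
    change ExteriorAlgebra.algebraMapInv (diff (ExteriorAlgebra.ι ℚ v * x)) = 0
    rw [h, map_sub, map_mul, map_mul, hk, hx, zero_mul, mul_zero, sub_zero]

theorem gradeSign_mem {x : PolyAlg R} (hx : x ∈ AugIdeal R) : gradeSign x ∈ AugIdeal R := by
  have h : (ExteriorAlgebra.algebraMapInv (R := ℚ) (M := Vpg R)).comp gradeSign =
      ExteriorAlgebra.algebraMapInv := by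
    apply ExteriorAlgebra.hom_ext
    ext π
    simp only [LinearMap.comp_apply, AlgHom.toLinearMap_apply, AlgHom.comp_apply]
    have : gradeSign (ExteriorAlgebra.ι ℚ (Finsupp.lsingle (R := ℚ) π 1)) =
        -ExteriorAlgebra.ι ℚ (Finsupp.lsingle (R := ℚ) π 1) := CliffordAlgebra.involute_ι _
    rw [this, map_neg, algebraMapInv_ι, neg_zero]
  rw [mem_augIdeal] at hx ⊢
  exact (DFunLike.congr_fun h x).trans hx

theorem mul_mem_aug {x : PolyAlg R} (hx : x ∈ AugIdeal R) (y : PolyAlg R) :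
    y * x ∈ AugIdeal R := by
  rw [mem_augIdeal] at hx ⊢
  rw [map_mul, hx, mul_zero]

/-- A polygon as an element of the augmentation ideal. -/
def augGen (π : Polygon R) : AugIdeal R := ⟨gen π, algebraMapInv_ι _⟩

def augDiff : AugIdeal R →ₗ[ℚ] AugIdeal R :=
  (diff.comp (AugIdeal R).subtype).codRestrict (AugIdeal R) (fun x => diff_mem x.1)

def augSign : AugIdeal R →ₗ[ℚ] AugIdeal R :=
  (gradeSign.toLinearMap.comp (AugIdeal R).subtype).codRestrict (AugIdeal R)
    (fun x => gradeSign_mem x.2)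

def augMul : AugIdeal R →ₗ[ℚ] AugIdeal R →ₗ[ℚ] AugIdeal R :=
  LinearMap.mk₂ ℚ (fun a b => ⟨a.1 * b.1, mul_mem_aug b.2 a.1⟩)
    (fun _ _ _ => Subtype.ext (add_mul _ _ _)) (fun _ _ _ => Subtype.ext (smul_mul_assoc _ _ _))
    (fun _ _ _ => Subtype.ext (mul_add _ _ _)) (fun _ _ _ => Subtype.ext (mul_smul_comm _ _ _))

end PolygonAlgebra

/-! ## Recursion on the first factor of a word -/

section TensorRec

variable {A M : Type*} [AddCommGroup A] [Module ℚ A] [AddCommGroup M] [Module ℚ M]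

def tensorRecAux (g : A →ₗ[ℚ] TensorAlgebra ℚ A × M →ₗ[ℚ] M) :
    A →ₗ[ℚ] Module.End ℚ (TensorAlgebra ℚ A × M) :=
  LinearMap.mk₂ ℚ (fun a p => (TensorAlgebra.ι ℚ a * p.1, g a p))
    (by intro a b p; simp [add_mul])
    (by intro c a p; simp)
    (by intro a p q; simp [mul_add])
    (by intro c a p; simp)

/-- The linear map `f` with `f 1 = m₀` and `f [a | x] = g a (x, f x)`. -/
def tensorRec (m₀ : M) (g : A →ₗ[ℚ] TensorAlgebra ℚ A × M →ₗ[ℚ] M) :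
    TensorAlgebra ℚ A →ₗ[ℚ] M :=
  LinearMap.snd ℚ (TensorAlgebra ℚ A) M ∘ₗ
    LinearMap.applyₗ ((1, m₀) : TensorAlgebra ℚ A × M) ∘ₗ
      (TensorAlgebra.lift ℚ (tensorRecAux g)).toLinearMap

theorem tensorRec_one (m₀ : M) (g : A →ₗ[ℚ] TensorAlgebra ℚ A × M →ₗ[ℚ] M) :
    tensorRec m₀ g 1 = m₀ := by
  simp [tensorRec]

theorem lift_tensorRecAux_fst (g : A →ₗ[ℚ] TensorAlgebra ℚ A × M →ₗ[ℚ] M)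
    (x : TensorAlgebra ℚ A) (p : TensorAlgebra ℚ A × M) :
    (TensorAlgebra.lift ℚ (tensorRecAux g) x p).1 = x * p.1 := by
  induction x using TensorAlgebra.induction generalizing p with
  | algebraMap r => simp [Algebra.smul_def, Module.algebraMap_end_apply]
  | ι a => simp [tensorRecAux]
  | mul x y hx hy => simp [hx, hy, mul_assoc]
  | add x y hx hy => simp [hx, hy, add_mul]

theorem tensorRec_ι_mul (m₀ : M) (g : A →ₗ[ℚ] TensorAlgebra ℚ A × M →ₗ[ℚ] M) (a : A)
    (x : TensorAlgebra ℚ A) :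
    tensorRec m₀ g (TensorAlgebra.ι ℚ a * x) = g a (x, tensorRec m₀ g x) := by
  have h : TensorAlgebra.lift ℚ (tensorRecAux g) x (1, m₀) = (x, tensorRec m₀ g x) :=
    Prod.ext (by rw [lift_tensorRecAux_fst, mul_one]) rfl
  have h2 : tensorRec m₀ g (TensorAlgebra.ι ℚ a * x) =
      (tensorRecAux g a (TensorAlgebra.lift ℚ (tensorRecAux g) x (1, m₀))).2 := by
    simp [tensorRec]
  rw [h2, h]
  rfl

/-- The deconcatenation coproduct:
`[a₁ | … | aₙ] ↦ ∑ᵢ [a₁ | … | aᵢ] ⊗ [aᵢ₊₁ | … | aₙ]`, where `0 ≤ i ≤ n`. -/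
def deconcat : TensorAlgebra ℚ A →ₗ[ℚ] TensorAlgebra ℚ A ⊗[ℚ] TensorAlgebra ℚ A :=
  tensorRec (1 ⊗ₜ 1) (LinearMap.mk₂ ℚ
    (fun a p => 1 ⊗ₜ[ℚ] (TensorAlgebra.ι ℚ a * p.1) + (TensorAlgebra.ι ℚ a ⊗ₜ[ℚ] 1) * p.2)
    (by intro a b p; simp only [map_add, add_mul, TensorProduct.tmul_add, TensorProduct.add_tmul]
        abel)
    (by intro c a p
        simp only [map_smul, smul_mul_assoc, TensorProduct.tmul_smul, smul_add,
          ← TensorProduct.smul_tmul'])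
    (by intro a p q
        simp only [Prod.fst_add, Prod.snd_add, mul_add, TensorProduct.tmul_add]
        abel)
    (by intro c a p
        simp only [Prod.smul_fst, Prod.smul_snd, mul_smul_comm, TensorProduct.tmul_smul,
          smul_add]))

/-! Below, `μ` is the product of `A`, `act` is the right action of `A` on `M`, and `σ` (resp. `τ`) is
the sign operator on `A` (resp. `M`), which multiplies the elements of degree `d` by `(-1) ^ d`. -/

/-- `[a₁ | … | aₙ] ↦ (m ↦ [m a₁ | a₂ | … | aₙ])`, and `1 ↦ 0`. -/
def mergeFirst (act : M →ₗ[ℚ] A →ₗ[ℚ] M) :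
    TensorAlgebra ℚ A →ₗ[ℚ] M →ₗ[ℚ] M ⊗[ℚ] TensorAlgebra ℚ A :=
  tensorRec 0 (LinearMap.mk₂ ℚ
    (fun a p => (TensorProduct.mk ℚ M (TensorAlgebra ℚ A)).flip p.1 ∘ₗ act.flip a)
    (by intro a b p; ext m; simp)
    (by intro r a p; ext m; simp [TensorProduct.smul_tmul'])
    (by intro a p q; ext m; simp)
    (by intro r a p; ext m; simp))

/-- `a ⊗ [a₁ | … | aₙ] ↦ [a | a₁ | … | aₙ]`. -/
def prepend : A ⊗[ℚ] TensorAlgebra ℚ A →ₗ[ℚ] TensorAlgebra ℚ A :=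
  TensorProduct.lift (LinearMap.mul ℚ (TensorAlgebra ℚ A) ∘ₗ TensorAlgebra.ι ℚ)

/-- `[a₁ | … | aₙ] ↦ ∑_{1 ≤ j < n} (-1)^j [a₁ | … | a_j a_{j+1} | … | aₙ]`. -/
def wedgeBars (μ : A →ₗ[ℚ] A →ₗ[ℚ] A) : TensorAlgebra ℚ A →ₗ[ℚ] TensorAlgebra ℚ A :=
  tensorRec 0 (LinearMap.mk₂ ℚ
    (fun a p => -prepend (mergeFirst μ p.1 a) - TensorAlgebra.ι ℚ a * p.2)
    (by intro a b p; simp only [map_add, add_mul]; abel)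
    (by intro r a p; simp only [map_smul, smul_mul_assoc, smul_sub, smul_neg])
    (by intro a p q
        simp only [Prod.fst_add, Prod.snd_add, map_add, LinearMap.add_apply, mul_add]
        abel)
    (by intro r a p
        simp only [Prod.smul_fst, Prod.smul_snd, map_smul, LinearMap.smul_apply, mul_smul_comm,
          smul_sub, smul_neg]))

/-- `[m | a₂ | … | aₙ] ↦
-[m a₂ | … | aₙ] + ∑_{2 ≤ j < n} (-1)^j [m | a₂ | … | a_j a_{j+1} | … | aₙ]`. -/
def wedgeBarsModule (act : M →ₗ[ℚ] A →ₗ[ℚ] M) (μ : A →ₗ[ℚ] A →ₗ[ℚ] A) :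
    M ⊗[ℚ] TensorAlgebra ℚ A →ₗ[ℚ] M ⊗[ℚ] TensorAlgebra ℚ A :=
  -TensorProduct.lift (mergeFirst act).flip - LinearMap.lTensor M (wedgeBars μ)

/-- `[a₁ | … | aₙ] ↦ (-1)^{∑ᵢ (deg aᵢ - 1)} [a₁ | … | aₙ]`. -/
def barSign (σ : A →ₗ[ℚ] A) : TensorAlgebra ℚ A →ₗ[ℚ] TensorAlgebra ℚ A :=
  (TensorAlgebra.lift ℚ (-(TensorAlgebra.ι ℚ ∘ₗ σ))).toLinearMap

/-- `[a₁ | … | aₙ] ↦ ∑_j (-1)^{∑_{i<j} deg aᵢ} [a₁ | … | d a_j | … | aₙ]`. -/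
def innerDiff (d σ : A →ₗ[ℚ] A) : TensorAlgebra ℚ A →ₗ[ℚ] TensorAlgebra ℚ A :=
  tensorRec 0 (LinearMap.mk₂ ℚ
    (fun a p => TensorAlgebra.ι ℚ (d a) * p.1 + TensorAlgebra.ι ℚ (σ a) * p.2)
    (by intro a b p; simp only [map_add, add_mul]; abel)
    (by intro r a p; simp only [map_smul, smul_mul_assoc, smul_add])
    (by intro a p q; simp only [Prod.fst_add, Prod.snd_add, mul_add]; abel)
    (by intro r a p; simp only [Prod.smul_fst, Prod.smul_snd, mul_smul_comm, smul_add]))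

/-- The part `D₁` of the bar differential of a right module: the `j`-th bar of a word is removed, and
its two neighbours are multiplied. In degree `0` the sign in front of this term is `(-1)^j`. In
degree `k`, that is, for `[m | a₂ | … | aₙ]` with `deg m + ∑ᵢ (deg aᵢ - 1) = k`, it is `(-1)^{j + k}`,
as is needed for `D₁` to anticommute with `D₂`. -/
def moduleD₁ (act : M →ₗ[ℚ] A →ₗ[ℚ] M) (μ : A →ₗ[ℚ] A →ₗ[ℚ] A) (σ : A →ₗ[ℚ] A) (τ : M →ₗ[ℚ] M) :
    M ⊗[ℚ] TensorAlgebra ℚ A →ₗ[ℚ] M ⊗[ℚ] TensorAlgebra ℚ A :=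
  wedgeBarsModule act μ ∘ₗ TensorProduct.map τ (barSign σ)

/-- The part `D₂` of the bar differential of a right module: the differential `d'` of `M` on the first
factor, and the differential `d` of `A`, with the sign `(-1)^{1 + deg m + ∑_{i<j} deg aᵢ}`, on the
`j`-th factor of `[m | a₂ | … | aₙ]`. In degree `0`, for factors `aᵢ` of degree `1`, this sign is
`(-1)^{j-1}`. -/
def moduleD₂ (d' : M →ₗ[ℚ] M) (d σ : A →ₗ[ℚ] A) (τ : M →ₗ[ℚ] M) :
    M ⊗[ℚ] TensorAlgebra ℚ A →ₗ[ℚ] M ⊗[ℚ] TensorAlgebra ℚ A :=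
  LinearMap.rTensor (TensorAlgebra ℚ A) d' - TensorProduct.map τ (innerDiff d σ)

/-- `[m | a₂ | … | aₙ] ↦ ∑ᵢ [m | a₂ | … | aᵢ] ⊗ [aᵢ₊₁ | … | aₙ]`, where `1 ≤ i ≤ n`. -/
def moduleDeconcat :
    M ⊗[ℚ] TensorAlgebra ℚ A →ₗ[ℚ] (M ⊗[ℚ] TensorAlgebra ℚ A) ⊗[ℚ] TensorAlgebra ℚ A :=
  (TensorProduct.assoc ℚ M (TensorAlgebra ℚ A) (TensorAlgebra ℚ A)).symm.toLinearMap ∘ₗ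
    LinearMap.lTensor M deconcat

end TensorRec

/-! ## The bar constructions -/

section Bar

variable (R S : Set Λ) [PartialOrder S]

/-- The bar construction `B(𝒫)`: the tensor coalgebra of the augmentation ideal. -/
abbrev BarP : Type u := TensorAlgebra ℚ (AugIdeal R)

/-- The vector space freely generated by the enhanced polygons. -/
abbrev VpgBar : Type u := EnhancedPolygon R S →₀ ℚ

/-- `𝒫̄ = V̄ ⊗ 𝒫`. -/
abbrev EnhAlg : Type u := VpgBar R S ⊗[ℚ] PolyAlg R

/-- The underlying space of `B(𝒫̄, 𝒫)`. -/
abbrev BarE : Type u := EnhAlg R S ⊗[ℚ] BarP R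

variable {R S}

/-- The right module structure of `𝒫̄` over `𝒫`. -/
def rightMul : EnhAlg R S →ₗ[ℚ] PolyAlg R →ₗ[ℚ] EnhAlg R S :=
  (LinearMap.lTensorHom (VpgBar R S) ∘ₗ (LinearMap.mul ℚ (PolyAlg R)).flip).flip

theorem rightMul_tmul (v : VpgBar R S) (x y : PolyAlg R) :
    rightMul (v ⊗ₜ x) y = v ⊗ₜ[ℚ] (x * y) := by
  simp [rightMul]

/-- The comodule map `κ̄(π̄) = ∑_α sgn(α) π̄_α^{root} ⊗ π̄_α^{cut-off}`. -/
def kappaBar : VpgBar R S →ₗ[ℚ] EnhAlg R S :=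
  Finsupp.linearCombination ℚ fun π => ∑ α ∈ π.dissectingArrows,
    sgn {α} • (Finsupp.single (π.rootRegion {α}) (1 : ℚ) ⊗ₜ[ℚ] gen (π.region {α} α))

/-- `∂̄(π̄ ⊗ π') = κ̄(π̄) ∧ π' - π̄ ⊗ ∂π'`. -/
def diffBar : EnhAlg R S →ₗ[ℚ] EnhAlg R S :=
  TensorProduct.lift (LinearMap.mk₂ ℚ (fun v x => rightMul (kappaBar v) x - v ⊗ₜ[ℚ] diff x)
    (by intro a b p; simp only [map_add, LinearMap.add_apply, TensorProduct.add_tmul]; abel)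
    (by intro c a p
        simp only [map_smul, LinearMap.smul_apply, smul_sub, TensorProduct.smul_tmul'])
    (by intro a p q; simp only [map_add, TensorProduct.tmul_add]; abel)
    (by intro c a p; simp only [map_smul, TensorProduct.tmul_smul, smul_sub]))

/-- The sign operator of `𝒫̄`; the enhanced polygons have degree `0`. -/
def signBar : EnhAlg R S →ₗ[ℚ] EnhAlg R S := LinearMap.lTensor (VpgBar R S) gradeSign.toLinearMap

/-- The right action of the augmentation ideal on `𝒫̄`. -/
def augAct : EnhAlg R S →ₗ[ℚ] AugIdeal R →ₗ[ℚ] EnhAlg R S :=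
  rightMul.compl₂ (AugIdeal R).subtype

/-- The differential `D₁ + D₂` of `B(𝒫̄, 𝒫)`. -/
def barDiff : BarE R S →ₗ[ℚ] BarE R S :=
  moduleD₁ augAct augMul augSign signBar + moduleD₂ diffBar augDiff augSign signBar

/-- The word `[π₁ | … | πₙ]` of polygons. -/
def barWord (w : List (Polygon R)) : BarP R :=
  (w.map (fun π => TensorAlgebra.ι ℚ (augGen π))).prod

/-- The word `[π̄ | π₂ | … | πₙ]`, where `π̄` is an enhanced polygon. -/
def enhWord (π : EnhancedPolygon R S) (w : List (Polygon R)) : BarE R S :=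
  (Finsupp.single π (1 : ℚ) ⊗ₜ[ℚ] (1 : PolyAlg R)) ⊗ₜ[ℚ] barWord w

variable (R S)

/-- The part of degree `0` of `B(𝒫̄, 𝒫)`: the words without any wedge. -/
def degreeZero : Submodule ℚ (BarE R S) :=
  Submodule.span ℚ {x | ∃ (π : EnhancedPolygon R S) (w : List (Polygon R)), x = enhWord π w}

/-- `H⁰ B(𝒫̄, 𝒫)`: the `0`-cocycles. (There are no elements of negative degree, so that there are no
coboundaries in degree `0`.) -/
def H0 : Submodule ℚ (BarE R S) := degreeZero R S ⊓ LinearMap.ker (barDiff (R := R) (S := S))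

variable {R S}

/-- The comodule map `B(𝒫̄, 𝒫) → B(𝒫̄, 𝒫) ⊗ B(𝒫)`, given by deconcatenation. -/
def comoduleMap : BarE R S →ₗ[ℚ] BarE R S ⊗[ℚ] BarP R := moduleDeconcat

/-! ### The elements attached to polygons -/

/-- All the ways to shuffle two words. -/
def shuffles {α : Type*} : List α → List α → List (List α)
  | [], m => [m]
  | a :: l, [] => [a :: l]
  | a :: l, b :: m => (shuffles l (b :: m)).map (a :: ·) ++ (shuffles (a :: l) m).map (b :: ·)
termination_by l m => l.length + m.length

variable (R)

/-- The part of degree `0` of `B(𝒫)`: the linear combinations of words of polygons. -/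
abbrev Words : Type u := List (Polygon R) →₀ ℚ

variable {R}

/-- The shuffle product; there are no signs in degree `0`. -/
def shuffle (x y : Words R) : Words R :=
  x.sum fun l c => y.sum fun m d => ((shuffles l m).map (fun w => Finsupp.single w (c * d))).sum

/-- The shuffle product of a family (it does not depend on the order of the factors); the empty
product is the unit, which is the empty word. -/
def shuffleProd (D : Finset Arrow) (f : Arrow → Words R) : Words R :=
  D.toList.foldr (fun α x => shuffle (f α) x) (Finsupp.single [] 1)

def toBar : Words R →ₗ[ℚ] BarP R := Finsupp.linearCombination ℚ barWord

/-- The element `B(π)` of a polygon: the sum over all dissections and all compatible orders. -/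
def polygonB (π : Polygon R) : Words R :=
  ∑ D ∈ dissections π.dissectingArrows, ∑ l ∈ orders D,
    Finsupp.single (π.rootRegion D :: l.map (π.region D)) (sgn D)

/-- The element `B(π̄)` of an enhanced polygon. -/
def enhancedB (π : EnhancedPolygon R S) : BarE R S :=
  ∑ D ∈ dissections π.dissectingArrows, ∑ l ∈ orders D,
    sgn D • enhWord (π.rootRegion D) (l.map (π.region D))

/-! ### The symmetric algebra of polygons -/

variable (R)

/-- The symmetric algebra of `V`, that is, the polynomials in the polygons. -/
abbrev SymV : Type u := MvPolynomial (Polygon R) ℚ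

variable {R}

/-- The coproduct of Connes–Kreimer type on the symmetric algebra: the algebra homomorphism with
`π ↦ 1 ⊗ π + ∑_D sgn(D) π_D^{root} ⊗ ∏_{α ∈ D} π_α`, summed over the admissible dissections. The
extra term `1 ⊗ π` is the one in which the root part is empty. -/
def ckCoproduct : SymV R →ₐ[ℚ] SymV R ⊗[ℚ] SymV R :=
  MvPolynomial.aeval fun π =>
    1 ⊗ₜ[ℚ] MvPolynomial.X π + ∑ D ∈ admissible π.dissectingArrows,
      sgn D • (MvPolynomial.X (π.rootRegion D) ⊗ₜ[ℚ] ∏ α ∈ D, MvPolynomial.X (π.region D α))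

/-- The counit: it is `0` on the polygons. -/
def ckCounit : SymV R →ₐ[ℚ] ℚ := MvPolynomial.aeval fun _ => 0

/-- `π̄ ↦ ∑_D sgn(D) π̄_D^{root} ⊗ ∏_{α ∈ D} π_α`, summed over the admissible dissections. -/
def ckCoaction : VpgBar R S →ₗ[ℚ] VpgBar R S ⊗[ℚ] SymV R :=
  Finsupp.linearCombination ℚ fun π => ∑ D ∈ admissible π.dissectingArrows,
    sgn D • (Finsupp.single (π.rootRegion D) (1 : ℚ) ⊗ₜ[ℚ]
      ∏ α ∈ D, MvPolynomial.X (π.region D α))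

end Bar

end PolygonBar
end

noncomputable section

namespace PolygonBar


/-! ## Arrows as intervals of positions -/

/-! Everything is reduced to intervals. With the vertex `v` at `2 v` and the interior of the side
`e` at `2 e + 1`, an arrow is an interval from `lo` to `hi` whose ends have opposite parity.
Crossing is interleaving, the order of the dual tree is inclusion (`Below`), and a side belongs to
the region of the smallest interval around it.

The geometric core is that contraction commutes with dissection. `exists_isContraction` enumerates
the positions that survive on the boundary of a region. Transport along this enumeration identifies
the dissections of a region of `C` with the refinements of `C` inside that region, together with all
their subregions (`exists_region_equiv`, `exists_rootRegion_equiv`). Under a backward arrow the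
enumeration is decreasing and exchanges forward and backward arrows; the signs still agree
(`armSign_mul_sgn`), because the weight is additive over the regions of a dissection.

A dissection with a compatible order is a list of arrows that is pairwise in the relation
`MayPrecede`, so `enhancedB` is a sum over lists.

Cocycle property: let two neighbours `a`, `b` of a list be multiplied. If `b` is not below `a`,
exchanging them gives another compatible list, and the two terms cancel since polygons anticommute
(`sum_mergeTerm_not_headBelow`). If `b` is below `a`, it lies directly under `a`, and the product is
a term of the differential of the region of `a` in the dissection without `b`; each such term arises
exactly once (`sum_headBelow`, `innerTerm_eq`). The first arrow of a list always bounds the root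
region, so removing the first bar reproduces `kappaBar` (`sum_firstTerm`).

Coaction: split a list as `l₁ ++ l₂` and let `C` be the set of maximal arrows of `l₂`. Then `C` is
admissible, `l₁` is an ordered dissection of the root region of `C`, and `l₂` is a shuffle of lists,
one for each `c ∈ C`, which start with `c` and continue below it. The sum factors accordingly
(`sum_splits_ordLists`, `sgn_smul_shuffleProd`).

Coassociativity: cutting along `C` and then cutting the root region along `D` amounts to cutting
along the maximal arrows of `C ∪ D` first, and then either cutting each of the resulting pieces
further or passing it on whole (`sum_two_step`). The counit kills all terms but the empty
dissection. -/

theorem arrow_cases (α : Arrow) :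
    (¬ IsBackward α ∧ lo α = 2 * α.1 ∧ hi α = 2 * α.2 + 1 ∧ α.1 ≤ α.2) ∨
      (IsBackward α ∧ lo α = 2 * α.2 + 1 ∧ hi α = 2 * α.1 ∧ α.2 < α.1) := by
  simp only [IsBackward, lo, hi]
  omega

theorem lo_lt_hi (α : Arrow) : lo α < hi α := by
  have := arrow_cases α
  omega

/-- The even end is the vertex and the odd end is the side, so the interval also remembers the
direction of the arrow. -/
theorem arrow_ext {α β : Arrow} (h1 : lo α = lo β) (h2 : hi α = hi β) : α = β := by
  have h := arrow_cases α
  have h' := arrow_cases β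
  exact Prod.ext (by omega) (by omega)

theorem mem_removed_iff {α : Arrow} {i : ℕ} :
    i ∈ removed α ↔ lo α < 2 * i + 1 ∧ 2 * i + 1 < hi α := by
  rw [mem_removed]
  have := arrow_cases α
  omega

theorem mem_armSet {D : Finset Arrow} {α : Arrow} {i : ℕ} :
    i ∈ armSet D α ↔ (lo α < 2 * i + 1 ∧ 2 * i + 1 < hi α) ∧
      ∀ β ∈ D, Below β α → ¬ (lo β < 2 * i + 1 ∧ 2 * i + 1 < hi β) := by
  simp only [armSet, Finset.mem_sdiff, Finset.mem_biUnion, Finset.mem_filter, not_exists, not_and,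
    mem_removed_iff, and_imp]

@[simp] theorem lo_rootArrow (N : ℕ) : lo (rootArrow N) = 0 := by simp [lo, rootArrow]

theorem hi_rootArrow {N : ℕ} (hN : 1 ≤ N) : hi (rootArrow N) = 2 * N - 1 := by
  simp only [hi, rootArrow]
  omega

theorem not_isBackward_rootArrow (N : ℕ) : ¬ IsBackward (rootArrow N) := by
  simp [IsBackward, rootArrow]

/-- As the ends have opposite parity, only length `1` is to be excluded, which is the case of a
vertex on the side. The one incidence that wraps around modulo `N`, between the first vertex and the
root side, is the root arrow. -/
theorem mem_arrows_iff {N : ℕ} {α : Arrow} :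
    α ∈ arrows N ↔ hi α < 2 * N ∧ lo α + 3 ≤ hi α ∧ α ≠ rootArrow N := by
  rw [mem_arrows]
  have h1 : α ≠ rootArrow N ↔ ¬ (α.1 = 0 ∧ α.2 = N - 1) := by
    rw [rootArrow, Ne, Prod.ext_iff]
  rw [h1]
  have h := arrow_cases α
  by_cases h2 : α.2 + 1 < N
  · rw [Nat.mod_eq_of_lt h2]
    omega
  · by_cases h3 : α.2 + 1 = N
    · rw [h3, Nat.mod_self]
      omega
    · omega

theorem Below.trans {α β γ : Arrow} (h : Below α β) (h' : Below β γ) : Below α γ := by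
  refine ⟨?_, h'.2.1.trans h.2.1, h.2.2.trans h'.2.2⟩
  rintro rfl
  exact h.1 (arrow_ext (le_antisymm h'.2.1 h.2.1) (le_antisymm h.2.2 h'.2.2))

theorem Below.asymm {α β : Arrow} (h : Below α β) : ¬ Below β α := fun h' => (h.trans h').1 rfl

theorem below_of_mem_arrows {N : ℕ} {α : Arrow} (h : α ∈ arrows N) : Below α (rootArrow N) := by
  obtain ⟨h1, h2, h3⟩ := mem_arrows_iff.1 h
  refine ⟨h3, by simp, ?_⟩
  rw [hi_rootArrow] <;> omega

/-! ## Contraction of the arrows in the boundary of a region -/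

/-- The map `ψ` identifies the positions on the boundary of an `M`-gon with the positions on the
boundary of the region right under the arrow `α` which remain after the arrows of `C` in the boundary
of this region are contracted. -/
structure IsContraction (C : Finset Arrow) (α : Arrow) (M : ℕ) (ψ : ℕ → ℕ) : Prop where
  strictMono : ¬ IsBackward α → ∀ i j, i < j → j < 2 * M → ψ i < ψ j
  strictAnti : IsBackward α → ∀ i j, i < j → j < 2 * M → ψ j < ψ i
  parity : ∀ k < 2 * M, ψ k % 2 = k % 2
  mem : ∀ k < 2 * M, lo α ≤ ψ k ∧ ψ k ≤ hi α ∧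
    ∀ c ∈ C, Below c α → ¬ (lo c < ψ k ∧ ψ k < hi c)
  surj : ∀ p, lo α ≤ p → p ≤ hi α → (∀ c ∈ C, Below c α → ¬ (lo c < p ∧ p < hi c)) →
    ∃ k < 2 * M, ψ k = p
  gap : ∀ k, k + 1 < 2 * M → ψ (k + 1) = ψ k + 1 ∨ ψ k = ψ (k + 1) + 1 ∨
    ∃ c ∈ C, Below c α ∧ ((lo c = ψ k ∧ hi c = ψ (k + 1)) ∨ (hi c = ψ k ∧ lo c = ψ (k + 1)))
  pos : 1 ≤ M
  zero : ψ 0 = 2 * α.1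
  last : ψ (2 * M - 1) = 2 * α.2 + 1

/-- The surviving positions are those under `α`, ends included, that are not strictly inside a
contracted arrow. They are listed in increasing order, and the list is read backwards if `α` is
backward. -/
theorem exists_isContraction (C : Finset Arrow) (α : Arrow)
    (hC : ∀ b ∈ C, ∀ c ∈ C, ¬ Crosses b c) : ∃ M ψ, IsContraction C α M ψ := by
  set P := (Finset.Icc (lo α) (hi α)).filter
    (fun p => ∀ c ∈ C, Below c α → ¬ (lo c < p ∧ p < hi c)) with hP
  have memP : ∀ p, p ∈ P ↔ (lo α ≤ p ∧ p ≤ hi α) ∧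
      ∀ c ∈ C, Below c α → ¬ (lo c < p ∧ p < hi c) := by
    intro p; rw [hP, Finset.mem_filter, Finset.mem_Icc]
  obtain ⟨n, hn⟩ : ∃ n, n = P.card := ⟨_, rfl⟩
  set χ : ℕ → ℕ := Nat.nth (· ∈ P) with hχ
  have hcard : ∀ h : {x | x ∈ P}.Finite, h.toFinset.card = n := by
    intro h
    rw [hn]
    congr 1
    ext x
    exact h.mem_toFinset
  have mono : ∀ i j, i < j → j < n → χ i < χ j := fun i j hij hj =>
    Nat.nth_lt_nth' hij (fun h => by rw [hcard h]; exact hj)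
  have mem : ∀ k < n, χ k ∈ P := fun k hk =>
    Nat.nth_mem (p := (· ∈ P)) k (fun h => by rw [hcard h]; exact hk)
  have surj : ∀ p ∈ P, ∃ k < n, χ k = p := by
    intro p hp
    obtain ⟨k, hk, hkp⟩ := Nat.exists_lt_card_nth_eq (p := (· ∈ P)) hp
    exact ⟨k, by rw [← hcard P.finite_toSet]; exact hk P.finite_toSet, hkp⟩
  have le_of : ∀ i j, i ≤ j → j < n → χ i ≤ χ j := fun i j hij hj => by
    rcases hij.eq_or_lt with rfl | h
    · exact le_rfl
    · exact (mono i j h hj).le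
  have hlh := lo_lt_hi α
  have lomem : lo α ∈ P := (memP _).2 ⟨⟨le_rfl, hlh.le⟩, fun c _ hc => by have := hc.2; omega⟩
  have himem : hi α ∈ P := (memP _).2 ⟨⟨hlh.le, le_rfl⟩, fun c _ hc => by have := hc.2; omega⟩
  have npos : 0 < n := by
    obtain ⟨k, hk, _⟩ := surj _ lomem; omega
  have h0 : χ 0 = lo α := by
    obtain ⟨k, hk, hk'⟩ := surj _ lomem
    have h1 := le_of 0 k (by omega) hk
    have h2 := ((memP _).1 (mem 0 npos)).1
    omega
  have hl : χ (n - 1) = hi α := by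
    obtain ⟨k, hk, hk'⟩ := surj _ himem
    have h1 := le_of k (n - 1) (by omega) (by omega)
    have h2 := ((memP _).1 (mem (n - 1) (by omega))).1
    omega
  have gap : ∀ k, k + 1 < n → χ (k + 1) = χ k + 1 ∨
      ∃ c ∈ C, Below c α ∧ lo c = χ k ∧ hi c = χ (k + 1) := by
    intro k hk
    have hlt := mono k (k + 1) (by omega) hk
    have hm := (memP _).1 (mem k (by omega))
    have hm' := (memP _).1 (mem (k + 1) hk)
    have next : ∀ p ∈ P, χ k < p → χ (k + 1) ≤ p := by
      intro p hp hkp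
      obtain ⟨j, hj, rfl⟩ := surj p hp
      have : ¬ j ≤ k := fun h => by have := le_of j k h (by omega); omega
      exact le_of _ _ (by omega) hj
    by_cases h : χ k + 1 ∈ P
    · left
      have := next _ h (by omega)
      omega
    · right
      have hex : (C.filter (fun c => Below c α ∧ lo c < χ k + 1 ∧ χ k + 1 < hi c)).Nonempty := by
        by_contra hne
        apply h
        rw [memP]
        refine ⟨⟨by omega, by omega⟩, fun c hc hcα hcc => hne ⟨c, ?_⟩⟩
        rw [Finset.mem_filter]
        exact ⟨hc, hcα, hcc⟩
      -- Take the widest contracted arrow over the missing position. It starts at `χ k` because `χ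
      -- k` survives. Its other end survives too: an arrow over that end would cross `c` or be wider
      -- than `c`.
      obtain ⟨c, hc, hmax⟩ := Finset.exists_max_image _ (fun c => hi c - lo c) hex
      rw [Finset.mem_filter] at hc
      obtain ⟨hcC, hcα, hc1, hc2⟩ := hc
      have hlo : lo c = χ k := by
        have := hm.2 c hcC hcα
        omega
      have hhi : hi c ∈ P := by
        rw [memP]
        refine ⟨⟨by omega, hcα.2.2⟩, fun d hd hdα hdd => ?_⟩
        have hx := hC c hcC d hd
        simp only [Crosses] at hx
        have := hmax d (by rw [Finset.mem_filter]; exact ⟨hd, hdα, by omega, by omega⟩)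
        omega
      refine ⟨c, hcC, hcα, hlo, ?_⟩
      have h1 := next _ hhi (by omega)
      have h2 := hm'.2 c hcC hcα
      omega
  -- Consecutive survivors are adjacent or are the two ends of an arrow, so parity alternates. Since
  -- the ends of `α` have opposite parity, the number of survivors is even.
  have par : ∀ k < n, χ k % 2 = (lo α + k) % 2 := by
    intro k
    induction k with
    | zero => intro _; rw [h0]; rfl
    | succ k ih =>
      intro hk
      have := ih (by omega)
      rcases gap k hk with h | ⟨c, _, _, h1, h2⟩
      · omega
      · have := arrow_cases c
        omega
  have hα := arrow_cases α
  have heven : n % 2 = 0 := by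
    have := par (n - 1) (by omega)
    omega
  obtain ⟨M, hM⟩ : ∃ M, n = 2 * M := ⟨n / 2, by omega⟩
  rcases hα with ⟨hb, hα1, hα2, hα3⟩ | ⟨hb, hα1, hα2, hα3⟩
  · refine ⟨M, χ, fun _ i j hij hj => mono i j hij (by omega), fun h => absurd h hb, ?_, ?_, ?_, ?_,
      by omega, by omega, by rw [← hM]; omega⟩
    · intro k hk
      have := par k (by omega)
      omega
    · intro k hk
      have := (memP _).1 (mem k (by omega))
      exact ⟨this.1.1, this.1.2, this.2⟩
    · intro p h1 h2 h3
      obtain ⟨k, hk, hkp⟩ := surj p ((memP _).2 ⟨⟨h1, h2⟩, h3⟩)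
      exact ⟨k, by omega, hkp⟩
    · intro k hk
      rcases gap k (by omega) with h | ⟨c, hc, hcα, h1, h2⟩
      · exact Or.inl h
      · exact Or.inr (Or.inr ⟨c, hc, hcα, Or.inl ⟨h1, h2⟩⟩)
  -- For a backward arrow the vertex is the upper end, so position `0` of the contracted polygon is
  -- `hi α = 2 * α.1`.
  · refine ⟨M, fun k => χ (2 * M - 1 - k), fun h => absurd hb h,
      fun _ i j hij hj => mono _ _ (by omega) (by omega), ?_, ?_, ?_, ?_,
      by omega, by simp only [Nat.sub_zero, ← hM]; omega, by simp only [Nat.sub_self]; omega⟩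
    · intro k hk
      have := par (2 * M - 1 - k) (by omega)
      omega
    · intro k hk
      have := (memP _).1 (mem (2 * M - 1 - k) (by omega))
      exact ⟨this.1.1, this.1.2, this.2⟩
    · intro p h1 h2 h3
      obtain ⟨k, hk, hkp⟩ := surj p ((memP _).2 ⟨⟨h1, h2⟩, h3⟩)
      refine ⟨2 * M - 1 - k, by omega, ?_⟩
      rw [← hkp]
      congr 1
      omega
    · intro k hk
      have e : 2 * M - 1 - k = (2 * M - 1 - (k + 1)) + 1 := by omega
      rw [e]
      rcases gap (2 * M - 1 - (k + 1)) (by omega) with h | ⟨c, hc, hcα, h1, h2⟩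
      · exact Or.inr (Or.inl h)
      · exact Or.inr (Or.inr ⟨c, hc, hcα, Or.inr ⟨h2, h1⟩⟩)

/-! ### The non-root sides of a region as a monotone list -/

theorem mem_armList {D : Finset Arrow} {α : Arrow} {i : ℕ} : i ∈ armList D α ↔ i ∈ armSet D α := by
  unfold armList
  split_ifs <;> simp

theorem length_armList (D : Finset Arrow) (α : Arrow) :
    (armList D α).length = (armSet D α).card := by
  unfold armList
  split_ifs <;> simp

theorem armList_pairwise_of_not_isBackward {D : Finset Arrow} {α : Arrow} (h : ¬ IsBackward α) :
    (armList D α).Pairwise (· < ·) := by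
  rw [armList, if_neg h]
  exact (Finset.sortedLT_sort _).pairwise

theorem armList_pairwise_of_isBackward {D : Finset Arrow} {α : Arrow} (h : IsBackward α) :
    (armList D α).Pairwise (· > ·) := by
  rw [armList, if_pos h, List.pairwise_reverse]
  exact (Finset.sortedLT_sort _).pairwise

/-- A finite set has only one increasing and one decreasing enumeration, so the members and the
direction determine the list. -/
theorem armList_eq {D : Finset Arrow} {α : Arrow} {L : List ℕ} (hL : ∀ i, i ∈ L ↔ i ∈ armSet D α)
    (hf : ¬ IsBackward α → L.Pairwise (· < ·)) (hb : IsBackward α → L.Pairwise (· > ·)) :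
    armList D α = L := by
  have hs : L.toFinset = armSet D α := by ext i; rw [List.mem_toFinset, hL]
  by_cases h : IsBackward α
  · have hp : L.reverse.Pairwise (· < ·) := List.pairwise_reverse.2 (hb h)
    have h1 := (List.toFinset_sort (· ≤ ·) (hp.imp fun h => h.ne)).2 (hp.imp fun h => h.le)
    rw [List.toFinset_reverse, hs] at h1
    rw [armList, if_pos h, h1, List.reverse_reverse]
  · have hp := hf h
    have h1 := (List.toFinset_sort (· ≤ ·) (hp.imp fun h => h.ne)).2 (hp.imp fun h => h.le)
    rw [hs] at h1
    rw [armList, if_neg h, h1]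

/-- The arrow between the images of the end points under a map of positions. -/
def mapArrow (ψ : ℕ → ℕ) (a : Arrow) : Arrow := (ψ (2 * a.1) / 2, ψ (2 * a.2 + 1) / 2)

/-- The arrows can be drawn without meeting, except in a common starting point. -/
def Compatible (a b : Arrow) : Prop := ¬ Crosses a b ∧ ¬ Crosses b a

theorem Compatible.symm {a b : Arrow} (h : Compatible a b) : Compatible b a := ⟨h.2, h.1⟩

/-- The arrow `b` dissects the region right under `α` in the dissection `C`. -/
def Dissects (C : Finset Arrow) (α b : Arrow) : Prop :=
  lo b + 3 ≤ hi b ∧ Below b α ∧ (∀ c ∈ C, Compatible b c) ∧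
    ∀ c ∈ C, Below c α → b ≠ c ∧ ¬ Below b c

/-! ### Transport of arrows along a contraction -/

namespace IsContraction

variable {C : Finset Arrow} {α : Arrow} {M : ℕ} {ψ : ℕ → ℕ}

theorem lt_iff (h : IsContraction C α M ψ) (hb : ¬ IsBackward α) {i j : ℕ} (hi : i < 2 * M)
    (hj : j < 2 * M) : ψ i < ψ j ↔ i < j := by
  have h1 := h.strictMono hb i j
  have h2 := h.strictMono hb j i
  rcases lt_trichotomy i j with h3 | rfl | h3 <;> omega

theorem gt_iff (h : IsContraction C α M ψ) (hb : IsBackward α) {i j : ℕ} (hi : i < 2 * M)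
    (hj : j < 2 * M) : ψ j < ψ i ↔ i < j := by
  have h1 := h.strictAnti hb i j
  have h2 := h.strictAnti hb j i
  rcases lt_trichotomy i j with h3 | rfl | h3 <;> omega

theorem injOn (h : IsContraction C α M ψ) {i j : ℕ} (hi : i < 2 * M) (hj : j < 2 * M)
    (hij : ψ i = ψ j) : i = j := by
  by_cases hb : IsBackward α
  · have h1 := h.gt_iff hb hi hj
    have h2 := h.gt_iff hb hj hi
    omega
  · have h1 := h.lt_iff hb hi hj
    have h2 := h.lt_iff hb hj hi
    omega

theorem two_mul_side (h : IsContraction C α M ψ) {i : ℕ} (hi : i < M) :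
    2 * (ψ (2 * i + 1) / 2) + 1 = ψ (2 * i + 1) := by
  have := h.parity (2 * i + 1) (by omega)
  omega

/-- Since `ψ` preserves parity, the halvings in `mapArrow` are exact. A decreasing `ψ` interchanges
the two ends. -/
theorem lo_hi_map (h : IsContraction C α M ψ) {a : Arrow} (ha : hi a < 2 * M) :
    (¬ IsBackward α ∧ lo (mapArrow ψ a) = ψ (lo a) ∧ hi (mapArrow ψ a) = ψ (hi a)) ∨
      (IsBackward α ∧ lo (mapArrow ψ a) = ψ (hi a) ∧ hi (mapArrow ψ a) = ψ (lo a)) := by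
  have hc := arrow_cases a
  have h1 := h.parity (2 * a.1) (by omega)
  have h2 := h.parity (2 * a.2 + 1) (by omega)
  have e1 : 2 * (mapArrow ψ a).1 = ψ (2 * a.1) := by simp only [mapArrow]; omega
  have e2 : 2 * (mapArrow ψ a).2 + 1 = ψ (2 * a.2 + 1) := by simp only [mapArrow]; omega
  have hc' := arrow_cases (mapArrow ψ a)
  by_cases hb : IsBackward α
  · right
    rcases hc with ⟨_, hl, hh, _⟩ | ⟨_, hl, hh, _⟩
    · have := h.strictAnti hb (2 * a.1) (2 * a.2 + 1) (by omega) (by omega)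
      rw [hl, hh]; exact ⟨hb, by omega, by omega⟩
    · have := h.strictAnti hb (2 * a.2 + 1) (2 * a.1) (by omega) (by omega)
      rw [hl, hh]; exact ⟨hb, by omega, by omega⟩
  · left
    rcases hc with ⟨_, hl, hh, _⟩ | ⟨_, hl, hh, _⟩
    · have := h.strictMono hb (2 * a.1) (2 * a.2 + 1) (by omega) (by omega)
      rw [hl, hh]; exact ⟨hb, by omega, by omega⟩
    · have := h.strictMono hb (2 * a.2 + 1) (2 * a.1) (by omega) (by omega)
      rw [hl, hh]; exact ⟨hb, by omega, by omega⟩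

/-- An arrow is backward exactly when its lower end is odd. Parity is preserved, and the ends are
interchanged exactly when `α` is backward, so directions multiply like signs. -/
theorem isBackward_map (h : IsContraction C α M ψ) {a : Arrow} (ha : hi a < 2 * M) :
    IsBackward (mapArrow ψ a) ↔ (IsBackward a ↔ ¬ IsBackward α) := by
  have hc := arrow_cases a
  have hc' := arrow_cases (mapArrow ψ a)
  have h1 := h.parity (lo a) (by omega)
  have h2 := h.parity (hi a) (by omega)
  rcases h.lo_hi_map ha with ⟨hb, h3, h4⟩ | ⟨hb, h3, h4⟩ <;>
  rcases hc with ⟨hc, _⟩ | ⟨hc, _⟩ <;> rcases hc' with ⟨hc', _⟩ | ⟨hc', _⟩ <;>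
  simp only [hb, hc, hc', not_true, not_false_iff, iff_true, iff_false, iff_self] <;> omega

theorem map_root (h : IsContraction C α M ψ) : mapArrow ψ (rootArrow M) = α := by
  have h1 := h.zero
  have h2 := h.last
  have h3 := h.pos
  have e : 2 * (M - 1) + 1 = 2 * M - 1 := by omega
  simp only [mapArrow, rootArrow, e, h2, mul_zero, h1]
  exact Prod.ext (by simp) (by simp only; omega)

theorem map_injOn (h : IsContraction C α M ψ) {a b : Arrow} (ha : hi a < 2 * M) (hb : hi b < 2 * M)
    (hab : mapArrow ψ a = mapArrow ψ b) : a = b := by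
  have h1 := lo_lt_hi a
  have h2 := lo_lt_hi b
  have h3 := h.lo_hi_map ha
  have h4 := h.lo_hi_map hb
  rw [hab] at h3
  rcases h3 with ⟨h0, h3, h5⟩ | ⟨h0, h3, h5⟩ <;> rcases h4 with ⟨h0', h4, h6⟩ | ⟨h0', h4, h6⟩
  · exact arrow_ext (h.injOn (by omega) (by omega) (by omega))
      (h.injOn (by omega) (by omega) (by omega))
  · exact absurd h0' h0
  · exact absurd h0 h0'
  · exact arrow_ext (h.injOn (by omega) (by omega) (by omega))
      (h.injOn (by omega) (by omega) (by omega))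

theorem below_map (h : IsContraction C α M ψ) {a b : Arrow} (ha : hi a < 2 * M)
    (hb : hi b < 2 * M) : Below (mapArrow ψ a) (mapArrow ψ b) ↔ Below a b := by
  have h1 := lo_lt_hi a
  have h2 := lo_lt_hi b
  have hne : mapArrow ψ a ≠ mapArrow ψ b ↔ a ≠ b :=
    not_congr ⟨h.map_injOn ha hb, fun e => by rw [e]⟩
  unfold Below
  rw [hne]
  rcases h.lo_hi_map ha with ⟨h0, h3, h5⟩ | ⟨h0, h3, h5⟩ <;>
    rcases h.lo_hi_map hb with ⟨h0', h4, h6⟩ | ⟨h0', h4, h6⟩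
  · have e1 := h.lt_iff h0 (i := lo a) (j := lo b) (by omega) (by omega)
    have e2 := h.lt_iff h0 (i := hi b) (j := hi a) (by omega) (by omega)
    rw [h3, h4, h5, h6]
    refine and_congr_right fun _ => ?_
    omega
  · exact absurd h0' h0
  · exact absurd h0 h0'
  · have e1 := h.gt_iff h0 (i := lo a) (j := lo b) (by omega) (by omega)
    have e2 := h.gt_iff h0 (i := hi b) (j := hi a) (by omega) (by omega)
    rw [h3, h4, h5, h6]
    refine and_congr_right fun _ => ?_
    omega

/-- A decreasing `ψ` interchanges `Crosses a b` and `Crosses b a`. Hence it is the symmetric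
relation that is transported. -/
theorem compatible_map (h : IsContraction C α M ψ) {a b : Arrow} (ha : hi a < 2 * M)
    (hb : hi b < 2 * M) : Compatible (mapArrow ψ a) (mapArrow ψ b) ↔ Compatible a b := by
  have h1 := lo_lt_hi a
  have h2 := lo_lt_hi b
  unfold Compatible Crosses
  rcases h.lo_hi_map ha with ⟨h0, h3, h5⟩ | ⟨h0, h3, h5⟩ <;>
    rcases h.lo_hi_map hb with ⟨h0', h4, h6⟩ | ⟨h0', h4, h6⟩
  · rw [h3, h4, h5, h6, h.lt_iff h0 (by omega) (by omega), h.lt_iff h0 (by omega) (by omega),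
      h.lt_iff h0 (by omega) (by omega), h.lt_iff h0 (by omega) (by omega),
      h.lt_iff h0 (by omega) (by omega), h.lt_iff h0 (by omega) (by omega)]
  · exact absurd h0' h0
  · exact absurd h0 h0'
  · rw [h3, h4, h5, h6, h.gt_iff h0 (by omega) (by omega), h.gt_iff h0 (by omega) (by omega),
      h.gt_iff h0 (by omega) (by omega), h.gt_iff h0 (by omega) (by omega),
      h.gt_iff h0 (by omega) (by omega), h.gt_iff h0 (by omega) (by omega)]
    omega

theorem map_below (h : IsContraction C α M ψ) {a : Arrow} (ha : a ∈ arrows M) :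
    Below (mapArrow ψ a) α := by
  have h1 := (mem_arrows_iff.1 ha).1
  have h2 := below_of_mem_arrows ha
  rw [← h.below_map h1 (by rw [hi_rootArrow h.pos]; omega), h.map_root] at h2
  exact h2

theorem lt_of_mem (h : IsContraction C α M ψ) {a : Arrow} (ha : a ∈ arrows M ∨ a = rootArrow M) :
    hi a < 2 * M := by
  rcases ha with ha | rfl
  · exact (mem_arrows_iff.1 ha).1
  · have := h.pos
    rw [hi_rootArrow h.pos]; omega

/-- There is a position on the contracted boundary strictly under a non-trivial arrow. -/
theorem exists_between (h : IsContraction C α M ψ) {a : Arrow} (ha : a ∈ arrows M) :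
    lo (mapArrow ψ a) + 3 ≤ hi (mapArrow ψ a) ∧
      ∃ k < 2 * M, lo (mapArrow ψ a) < ψ k ∧ ψ k < hi (mapArrow ψ a) := by
  obtain ⟨h1, h2, _⟩ := mem_arrows_iff.1 ha
  rcases h.lo_hi_map h1 with ⟨h0, h3, h5⟩ | ⟨h0, h3, h5⟩
  · have e1 := h.strictMono h0 (lo a) (lo a + 1) (by omega) (by omega)
    have e2 := h.strictMono h0 (lo a + 1) (lo a + 2) (by omega) (by omega)
    have e3 := h.strictMono h0 (lo a + 2) (hi a) (by omega) (by omega)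
    exact ⟨by omega, lo a + 1, by omega, by omega, by omega⟩
  · have e1 := h.strictAnti h0 (lo a) (lo a + 1) (by omega) (by omega)
    have e2 := h.strictAnti h0 (lo a + 1) (lo a + 2) (by omega) (by omega)
    have e3 := h.strictAnti h0 (lo a + 2) (hi a) (by omega) (by omega)
    exact ⟨by omega, lo a + 1, by omega, by omega, by omega⟩

/-- The end points of the image of an arrow remain after the contraction. -/
theorem end_mem (h : IsContraction C α M ψ) {a : Arrow} (ha : hi a < 2 * M) {c : Arrow}
    (hc : c ∈ C) (hcα : Below c α) :
    ¬ (lo c < lo (mapArrow ψ a) ∧ lo (mapArrow ψ a) < hi c) ∧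
      ¬ (lo c < hi (mapArrow ψ a) ∧ hi (mapArrow ψ a) < hi c) := by
  have h1 := lo_lt_hi a
  have h2 := (h.mem (lo a) (by omega)).2.2 c hc hcα
  have h3 := (h.mem (hi a) (by omega)).2.2 c hc hcα
  rcases h.lo_hi_map ha with ⟨h0, h4, h5⟩ | ⟨h0, h4, h5⟩ <;> rw [h4, h5]
  · exact ⟨h2, h3⟩
  · exact ⟨h3, h2⟩

/-- A contracted arrow `c` cannot contain the image of `a`: a surviving position lies strictly under
the image of a non-trivial arrow, and the image of the root arrow is `α`, which is above `c`. Since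
the ends of the image are not strictly under `c` either, the two arrows do not cross. -/
theorem not_le_child (h : IsContraction C α M ψ) {a : Arrow}
    (ha : a ∈ arrows M ∨ a = rootArrow M) {c : Arrow} (hc : c ∈ C) (hcα : Below c α) :
    mapArrow ψ a ≠ c ∧ ¬ Below (mapArrow ψ a) c ∧ Compatible (mapArrow ψ a) c := by
  have h1 := h.end_mem (h.lt_of_mem ha) hc hcα
  have hl := lo_lt_hi (mapArrow ψ a)
  have key : ¬ (lo c ≤ lo (mapArrow ψ a) ∧ hi (mapArrow ψ a) ≤ hi c) := by
    rcases ha with ha | rfl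
    · obtain ⟨_, k, hk, hk1, hk2⟩ := h.exists_between ha
      have := (h.mem k hk).2.2 c hc hcα
      omega
    · rw [h.map_root]
      intro hh
      exact hcα.1 (arrow_ext (by have := hcα.2; omega) (by have := hcα.2; omega))
  refine ⟨?_, fun hb => key hb.2, ?_⟩
  · rintro rfl
    exact key ⟨le_rfl, le_rfl⟩
  · unfold Compatible Crosses
    omega

/-- For the arrows of `C` below `α` this is `not_le_child`. Any other arrow of `C` is `α`, contains
`α` or is disjoint from it, so it does not cross an interval inside `α`. -/
theorem map_dissects (h : IsContraction C α M ψ) (hα : ∀ c ∈ C, Compatible α c) {a : Arrow}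
    (ha : a ∈ arrows M) : Dissects C α (mapArrow ψ a) := by
  refine ⟨(h.exists_between ha).1, h.map_below ha, fun c hc => ?_,
    fun c hc hcα => ⟨(h.not_le_child (Or.inl ha) hc hcα).1, (h.not_le_child (Or.inl ha) hc hcα).2.1⟩⟩
  by_cases hcα : Below c α
  · exact (h.not_le_child (Or.inl ha) hc hcα).2.2
  · have h1 := hα c hc
    have h2 := (h.map_below ha).2
    have h3 := lo_lt_hi c
    have h4 : c ≠ α → ¬ (lo α ≤ lo c ∧ hi c ≤ hi α) := fun h5 h6 => hcα ⟨h5, h6⟩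
    by_cases h5 : c = α
    · subst h5
      unfold Compatible Crosses
      omega
    · have h6 := h4 h5
      unfold Compatible Crosses at *
      omega

/-- The ends of `b` survive, since `b` neither crosses a contracted arrow nor lies under one; their
indices are the ends of the preimage. -/
theorem exists_map_eq (h : IsContraction C α M ψ) {b : Arrow} (hb : Dissects C α b) :
    ∃ a ∈ arrows M, mapArrow ψ a = b := by
  obtain ⟨h1, h2, h3, h4⟩ := hb
  have hl := lo_lt_hi b
  obtain ⟨i, hi1, hi2⟩ := h.surj (lo b) h2.2.1 (by have := h2.2; omega) (by
    intro c hc hcα hcc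
    have h5 := h3 c hc
    have h6 := h4 c hc hcα
    unfold Compatible Crosses at h5
    exact h6.2 ⟨h6.1, by omega, by omega⟩)
  obtain ⟨j, hj1, hj2⟩ := h.surj (hi b) (by have := h2.2; omega) h2.2.2 (by
    intro c hc hcα hcc
    have h5 := h3 c hc
    have h6 := h4 c hc hcα
    unfold Compatible Crosses at h5
    exact h6.2 ⟨h6.1, by omega, by omega⟩)
  have hpi := h.parity i hi1
  have hpj := h.parity j hj1
  have hcb := arrow_cases b
  -- The end with the even index is the vertex, whichever of `lo b` and `hi b` it comes from.
  obtain ⟨a, ha1, ha2⟩ : ∃ a : Arrow, 2 * a.1 = (if i % 2 = 0 then i else j) ∧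
      2 * a.2 + 1 = (if i % 2 = 0 then j else i) := by
    split_ifs with hpar
    · exact ⟨(i / 2, j / 2), by simp only; omega, by simp only; omega⟩
    · exact ⟨(j / 2, i / 2), by simp only; omega, by simp only; omega⟩
  have hab : mapArrow ψ a = b := by
    simp only [mapArrow, ha1, ha2]
    apply Prod.ext <;> simp only <;> split_ifs <;> omega
  have hca := arrow_cases a
  have hhi : hi a < 2 * M := by split_ifs at ha1 ha2 <;> omega
  have hmin : lo a = min i j ∧ hi a = max i j := by split_ifs at ha1 ha2 <;> omega
  refine ⟨a, mem_arrows_iff.2 ⟨hhi, ?_, ?_⟩, hab⟩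
  -- If the indices were adjacent, `gap` would make `b` an arrow of length `1` or one of the
  -- contracted arrows.
  · by_contra hlt
    have hj' : j = i + 1 ∨ i = j + 1 := by split_ifs at ha1 ha2 <;> omega
    rcases hj' with rfl | rfl
    · rcases h.gap i hj1 with h5 | h5 | ⟨c, hc, hcα, h5⟩
      · omega
      · omega
      · have h6 := h4 c hc hcα
        have h7 := lo_lt_hi c
        exact h6.1 (arrow_ext (by omega) (by omega))
    · rcases h.gap j hi1 with h5 | h5 | ⟨c, hc, hcα, h5⟩
      · omega
      · omega
      · have h6 := h4 c hc hcα
        have h7 := lo_lt_hi c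
        exact h6.1 (arrow_ext (by omega) (by omega))
  · rintro rfl
    rw [h.map_root] at hab
    exact h2.1 hab.symm

/-- The regions of a refinement, in terms of the polygon of the region which is refined. -/
theorem mem_armSet_map (h : IsContraction C α M ψ)
    {D : Finset Arrow} (hD : ∀ a ∈ D, a ∈ arrows M) {b : Arrow} (hb : b ∈ arrows M ∨ b = rootArrow M)
    {q : ℕ} : q ∈ armSet (C ∪ D.image (mapArrow ψ)) (mapArrow ψ b) ↔
      ∃ i ∈ armSet D b, ψ (2 * i + 1) / 2 = q := by
  have hbM := h.lt_of_mem hb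
  have hlb := lo_lt_hi b
  have hbα : mapArrow ψ b = α ∨ Below (mapArrow ψ b) α := by
    rcases hb with hb | rfl
    · exact Or.inr (h.map_below hb)
    · exact Or.inl h.map_root
  have hle : lo α ≤ lo (mapArrow ψ b) ∧ hi (mapArrow ψ b) ≤ hi α := by
    rcases hbα with e | e
    · rw [e]; exact ⟨le_rfl, le_rfl⟩
    · exact e.2
  have hchild : ∀ c, Below c (mapArrow ψ b) → Below c α := by
    intro c hc
    rcases hbα with e | e
    · rwa [e] at hc
    · exact hc.trans e
  have inside : ∀ a : Arrow, hi a < 2 * M → ∀ k < 2 * M,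
      (lo (mapArrow ψ a) < ψ k ∧ ψ k < hi (mapArrow ψ a) ↔ lo a < k ∧ k < hi a) := by
    intro a ha k hk
    have := lo_lt_hi a
    rcases h.lo_hi_map ha with ⟨h0, h1, h2⟩ | ⟨h0, h1, h2⟩ <;> rw [h1, h2]
    · rw [h.lt_iff h0 (by omega) hk, h.lt_iff h0 hk (by omega)]
    · rw [h.gt_iff h0 hk (by omega), h.gt_iff h0 (by omega) hk, and_comm]
  rw [mem_armSet]
  constructor
  · rintro ⟨hq1, hq2⟩
    -- The side survives the contraction: a contracted arrow over it would not contain the image of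
    -- `b` and would not cross it, so it would lie below that image and remove the side from its
    -- region.
    obtain ⟨k, hk, hkq⟩ := h.surj (2 * q + 1) (by omega) (by omega) (by
      intro c hc hcα hcc
      have h1 := h.not_le_child hb hc hcα
      have h2 := hq2 c (Finset.mem_union_left _ hc)
      apply h2 _ hcc
      have h3 := h1.2.2
      have h4 : ¬ (lo c ≤ lo (mapArrow ψ b) ∧ hi (mapArrow ψ b) ≤ hi c) :=
        fun h5 => h1.2.1 ⟨h1.1, h5⟩
      unfold Compatible Crosses at h3
      exact ⟨h1.1.symm, by omega, by omega⟩)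
    have hpk := h.parity k hk
    obtain ⟨i, rfl⟩ : ∃ i, k = 2 * i + 1 := ⟨k / 2, by omega⟩
    refine ⟨i, mem_armSet.2 ⟨(inside b hbM _ hk).1 (by rw [hkq]; exact hq1), ?_⟩, by omega⟩
    intro a ha hab hin
    have haM := (mem_arrows_iff.1 (hD a ha)).1
    apply hq2 (mapArrow ψ a) (Finset.mem_union_right _ (Finset.mem_image_of_mem _ ha))
      ((h.below_map haM hbM).2 hab)
    rw [← hkq]
    exact (inside a haM _ hk).2 hin
  · rintro ⟨i, hi1, rfl⟩
    obtain ⟨hi2, hi3⟩ := mem_armSet.1 hi1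
    rw [h.two_mul_side (by omega)]
    refine ⟨(inside b hbM _ (by omega)).2 hi2, fun c hc hcb => ?_⟩
    rcases Finset.mem_union.1 hc with hc | hc
    · exact (h.mem _ (by omega)).2.2 c hc (hchild c hcb)
    · obtain ⟨a, ha, rfl⟩ := Finset.mem_image.1 hc
      have haM := (mem_arrows_iff.1 (hD a ha)).1
      rw [inside a haM _ (by omega)]
      exact hi3 a ha ((h.below_map haM hbM).1 hcb)

/-- The order matters as well: the mapped list runs in the direction obtained by composing the
directions of `b` and `α`, which by `isBackward_map` is the direction of the image of `b`. -/
theorem armList_map (h : IsContraction C α M ψ)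
    {D : Finset Arrow} (hD : ∀ a ∈ D, a ∈ arrows M) {b : Arrow} (hb : b ∈ arrows M ∨ b = rootArrow M) :
    armList (C ∪ D.image (mapArrow ψ)) (mapArrow ψ b) =
      (armList D b).map (fun i => ψ (2 * i + 1) / 2) := by
  have hbM := h.lt_of_mem hb
  have hlt : ∀ i ∈ armList D b, 2 * i + 1 < 2 * M := by
    intro i hi
    have := (mem_armSet.1 (mem_armList.1 hi)).1
    omega
  have hmono : ∀ i j, 2 * i + 1 < 2 * M → 2 * j + 1 < 2 * M → i < j →
      (¬ IsBackward α ∧ ψ (2 * i + 1) / 2 < ψ (2 * j + 1) / 2) ∨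
        (IsBackward α ∧ ψ (2 * j + 1) / 2 < ψ (2 * i + 1) / 2) := by
    intro i j hi hj hij
    have h1 := h.two_mul_side (i := i) (by omega)
    have h2 := h.two_mul_side (i := j) (by omega)
    by_cases h0 : IsBackward α
    · have := h.strictAnti h0 (2 * i + 1) (2 * j + 1) (by omega) hj
      exact Or.inr ⟨h0, by omega⟩
    · have := h.strictMono h0 (2 * i + 1) (2 * j + 1) (by omega) hj
      exact Or.inl ⟨h0, by omega⟩
  apply armList_eq
  · intro i
    rw [h.mem_armSet_map hD hb, List.mem_map]
    simp only [mem_armList]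
  · intro hn
    rw [h.isBackward_map hbM] at hn
    rw [List.pairwise_map]
    by_cases hbb : IsBackward b
    · refine (armList_pairwise_of_isBackward hbb).imp_of_mem fun {i j} hi hj hij => ?_
      rcases hmono j i (hlt j hj) (hlt i hi) hij with ⟨h0, h1⟩ | ⟨h0, h1⟩
      · exact absurd ⟨fun _ => h0, fun _ => hbb⟩ hn
      · exact h1
    · refine (armList_pairwise_of_not_isBackward hbb).imp_of_mem fun {i j} hi hj hij => ?_
      rcases hmono i j (hlt i hi) (hlt j hj) hij with ⟨h0, h1⟩ | ⟨h0, h1⟩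
      · exact h1
      · exact absurd ⟨fun h2 => absurd h2 hbb, fun h2 => absurd h0 h2⟩ hn
  · intro hn
    rw [h.isBackward_map hbM] at hn
    rw [List.pairwise_map]
    by_cases hbb : IsBackward b
    · refine (armList_pairwise_of_isBackward hbb).imp_of_mem fun {i j} hi hj hij => ?_
      rcases hmono j i (hlt j hj) (hlt i hi) hij with ⟨h0, h1⟩ | ⟨h0, h1⟩
      · exact h1
      · exact absurd h0 (hn.1 hbb)
    · refine (armList_pairwise_of_not_isBackward hbb).imp_of_mem fun {i j} hi hj hij => ?_
      rcases hmono i j (hlt i hi) (hlt j hj) hij with ⟨h0, h1⟩ | ⟨h0, h1⟩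
      · exact absurd (hn.2 h0) hbb
      · exact h1

end IsContraction

theorem armList_empty_rootArrow {M : ℕ} (hM : 1 ≤ M) :
    armList ∅ (rootArrow M) = List.range (M - 1) := by
  apply armList_eq
  · intro i
    rw [mem_armSet, hi_rootArrow hM, List.mem_range, lo_rootArrow]
    simp
    omega
  · intro _
    exact List.pairwise_lt_range
  · intro h
    exact absurd h (not_isBackward_rootArrow M)

namespace IsContraction

variable {C : Finset Arrow} {α : Arrow} {M : ℕ} {ψ : ℕ → ℕ}

theorem armList_eq_map_range (h : IsContraction C α M ψ) :
    armList C α = (List.range (M - 1)).map (fun i => ψ (2 * i + 1) / 2) := by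
  have h1 := h.armList_map (D := ∅) (by simp) (Or.inr rfl)
  rwa [h.map_root, Finset.image_empty, Finset.union_empty, armList_empty_rootArrow h.pos] at h1

theorem card_armSet (h : IsContraction C α M ψ) :
    (armSet C α).card = M - 1 := by
  rw [← length_armList, h.armList_eq_map_range]
  simp

theorem card_armSet_map (h : IsContraction C α M ψ)
    {D : Finset Arrow} (hD : ∀ a ∈ D, a ∈ arrows M) {b : Arrow}
    (hb : b ∈ arrows M ∨ b = rootArrow M) :
    (armSet (C ∪ D.image (mapArrow ψ)) (mapArrow ψ b)).card = (armSet D b).card := by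
  rw [← length_armList, h.armList_map hD hb, List.length_map, length_armList]

end IsContraction

/-! ## Signs of regions -/

/-- The contribution of the region right under the arrow `α` to the sign of the dissection `D`. -/
def armSign (D : Finset Arrow) (α : Arrow) : ℚ :=
  if IsBackward α then (-1) ^ (armSet D α).card else 1

theorem sgn_eq_prod (D : Finset Arrow) : sgn D = ∏ α ∈ D, armSign D α := rfl

theorem mem_dissections {A D : Finset Arrow} :
    D ∈ dissections A ↔ D ⊆ A ∧ ∀ α ∈ D, ∀ β ∈ D, ¬ Crosses α β := by
  rw [dissections, Finset.mem_filter, Finset.mem_powerset]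

theorem compatible_of_mem_dissections {A D : Finset Arrow} (hD : D ∈ dissections A) {a b : Arrow}
    (ha : a ∈ D) (hb : b ∈ D) : Compatible a b :=
  ⟨(mem_dissections.1 hD).2 a ha b hb, (mem_dissections.1 hD).2 b hb a ha⟩

/-- Two non-crossing arrows which both cut off a position are nested. -/
theorem nested_of_compatible {a b : Arrow} (h : Compatible a b) {p : ℕ} (ha : lo a < p ∧ p < hi a)
    (hb : lo b < p ∧ p < hi b) : a = b ∨ Below a b ∨ Below b a := by
  by_cases hab : a = b
  · exact Or.inl hab
  · have hba : b ≠ a := fun e => hab e.symm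
    unfold Compatible Crosses at h
    by_cases h1 : lo b ≤ lo a ∧ hi a ≤ hi b
    · exact Or.inr (Or.inl ⟨hab, h1⟩)
    · exact Or.inr (Or.inr ⟨hba, by omega, by omega⟩)

theorem Below.length_lt {a b : Arrow} (h : Below a b) : hi a - lo a < hi b - lo b := by
  have h1 := lo_lt_hi a
  have h2 := h.2
  have h3 : ¬ (lo a = lo b ∧ hi a = hi b) := fun e => h.1 (arrow_ext e.1 e.2)
  omega

/-- Every non-root side belongs to exactly one region. -/
theorem sum_card_armSet {M : ℕ} (hM : 1 ≤ M) {D : Finset Arrow} (hD : D ∈ dissections (arrows M)) :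
    (armSet D (rootArrow M)).card + ∑ b ∈ D, (armSet D b).card = M - 1 := by
  obtain ⟨hDA, hDC⟩ := mem_dissections.1 hD
  have hroot : rootArrow M ∉ D := fun h => (mem_arrows_iff.1 (hDA h)).2.2 rfl
  -- The root arrow is adjoined to `D`, so that all regions are treated alike and the sum counts a
  -- disjoint union.
  rw [← Finset.sum_insert (f := fun b => (armSet D b).card) hroot, ← Finset.card_biUnion]
  · rw [← Finset.card_range (M - 1)]
    congr 1
    ext i
    rw [Finset.mem_biUnion, Finset.mem_range]
    constructor
    · rintro ⟨b, hb, hib⟩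
      have h1 := (mem_armSet.1 hib).1
      rcases Finset.mem_insert.1 hb with rfl | hb
      · rw [hi_rootArrow hM] at h1
        omega
      · have := mem_arrows_iff.1 (hDA hb)
        omega
    · intro hi'
      have hne : ((insert (rootArrow M) D).filter
          (fun b => lo b < 2 * i + 1 ∧ 2 * i + 1 < hi b)).Nonempty :=
        ⟨rootArrow M, Finset.mem_filter.2 ⟨Finset.mem_insert_self _ _, by
          rw [hi_rootArrow hM, lo_rootArrow]; omega⟩⟩
      -- The side belongs to the region of the smallest arrow over it.
      obtain ⟨b, hb, hmin⟩ := Finset.exists_min_image _ (fun b => hi b - lo b) hne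
      rw [Finset.mem_filter] at hb
      refine ⟨b, hb.1, mem_armSet.2 ⟨hb.2, fun c hc hcb hic => ?_⟩⟩
      have h1 := hmin c (Finset.mem_filter.2 ⟨Finset.mem_insert_of_mem hc, hic⟩)
      have h2 := hcb.length_lt
      omega
  · have key : ∀ b ∈ D, ∀ c ∈ insert (rootArrow M) D, Below b c →
        Disjoint (armSet D b) (armSet D c) := by
      intro b hb c hc hbc
      rw [Finset.disjoint_left]
      intro i hi1 hi2
      exact (mem_armSet.1 hi2).2 b hb hbc (mem_armSet.1 hi1).1
    intro b hb c hc hbc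
    have hb' : b ∈ insert (rootArrow M) D := by simpa using hb
    have hc' : c ∈ insert (rootArrow M) D := by simpa using hc
    change Disjoint (armSet D b) (armSet D c)
    rcases Finset.mem_insert.1 hb' with rfl | hbD <;> rcases Finset.mem_insert.1 hc' with rfl | hcD
    · exact absurd rfl hbc
    · exact (key c hcD _ hb' (below_of_mem_arrows (hDA hcD))).symm
    · exact key b hbD _ hc' (below_of_mem_arrows (hDA hbD))
    · rw [Finset.disjoint_left]
      intro i hi1 hi2
      rcases nested_of_compatible (compatible_of_mem_dissections hD hbD hcD)
        (mem_armSet.1 hi1).1 (mem_armSet.1 hi2).1 with h | h | h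
      · exact hbc h
      · exact (mem_armSet.1 hi2).2 b hbD h (mem_armSet.1 hi1).1
      · exact (mem_armSet.1 hi1).2 c hcD h (mem_armSet.1 hi2).1

/-- If `α` is forward, the factors agree one by one. If `α` is backward, the weight `M - 1` of the
region is the sum of the weights of the pieces, so `armSign C α` spreads a factor `(-1) ^ χ` over
every piece. For a backward `b` this factor cancels the one in `sgn D`, for a forward `b` it creates
one; this matches the reversal of all directions. -/
theorem IsContraction.armSign_mul_sgn {C : Finset Arrow} {α : Arrow} {M : ℕ} {ψ : ℕ → ℕ}
    (h : IsContraction C α M ψ) {D : Finset Arrow} (hD : D ∈ dissections (arrows M)) :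
    armSign C α * sgn D = armSign (C ∪ D.image (mapArrow ψ)) α *
      ∏ b ∈ D, armSign (C ∪ D.image (mapArrow ψ)) (mapArrow ψ b) := by
  obtain ⟨hDA, hDC⟩ := mem_dissections.1 hD
  have hr := h.card_armSet_map hDA (Or.inr rfl)
  rw [h.map_root] at hr
  rw [sgn_eq_prod]
  by_cases hb : IsBackward α
  · have e : (-1 : ℚ) ^ (M - 1) =
        (-1) ^ (armSet D (rootArrow M)).card * ∏ b ∈ D, (-1) ^ (armSet D b).card := by
      rw [Finset.prod_pow_eq_pow_sum, ← pow_add, sum_card_armSet h.pos hD]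
    rw [armSign, if_pos hb, h.card_armSet, armSign, if_pos hb, hr, e, mul_assoc,
      ← Finset.prod_mul_distrib]
    congr 1
    refine Finset.prod_congr rfl fun b hbD => ?_
    have h1 := h.isBackward_map (a := b) (mem_arrows_iff.1 (hDA hbD)).1
    rw [armSign, armSign, h.card_armSet_map hDA (Or.inl (hDA hbD))]
    by_cases hbb : IsBackward b
    · rw [if_pos hbb, if_neg (fun h2 => (h1.1 h2).1 hbb hb), ← mul_pow]
      norm_num
    · rw [if_neg hbb, if_pos (h1.2 ⟨fun h2 => absurd h2 hbb, fun h2 => absurd hb h2⟩), mul_one]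
  · rw [armSign, if_neg hb, armSign, if_neg hb]
    congr 1
    refine Finset.prod_congr rfl fun b hbD => ?_
    have h1 := h.isBackward_map (a := b) (mem_arrows_iff.1 (hDA hbD)).1
    rw [armSign, armSign, h.card_armSet_map hDA (Or.inl (hDA hbD))]
    by_cases hbb : IsBackward b
    · rw [if_pos hbb, if_pos (h1.2 ⟨fun _ => hb, fun _ => hbb⟩)]
    · rw [if_neg hbb, if_neg (fun h2 => hbb ((h1.1 h2).2 hb))]

/-- The non-root sides of a region only depend on the arrows in its boundary. -/
theorem armSet_congr {D E : Finset Arrow} {α : Arrow}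
    (h1 : ∀ b ∈ D, Below b α → ∃ c ∈ E, Below c α ∧ lo c ≤ lo b ∧ hi b ≤ hi c)
    (h2 : ∀ b ∈ E, Below b α → ∃ c ∈ D, Below c α ∧ lo c ≤ lo b ∧ hi b ≤ hi c) :
    armSet D α = armSet E α := by
  ext i
  rw [mem_armSet, mem_armSet]
  refine and_congr_right fun _ => ⟨fun h b hb hbα hi => ?_, fun h b hb hbα hi => ?_⟩
  · obtain ⟨c, hc, hcα, h3⟩ := h2 b hb hbα
    exact h c hc hcα ⟨by omega, by omega⟩
  · obtain ⟨c, hc, hcα, h3⟩ := h1 b hb hbα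
    exact h c hc hcα ⟨by omega, by omega⟩

theorem armSign_congr {D E : Finset Arrow} {α : Arrow} (h : armSet D α = armSet E α) :
    armSign D α = armSign E α := by
  rw [armSign, armSign, h]

theorem armList_congr {D E : Finset Arrow} {α : Arrow} (h : armSet D α = armSet E α) :
    armList D α = armList E α := by
  rw [armList, armList, h]

universe u

variable {Λ : Type u} {R S : Set Λ} [PartialOrder S]

theorem EnhancedPolygon.region_congr (π : EnhancedPolygon R S) {D E : Finset Arrow} {α : Arrow}
    (h : armSet D α = armSet E α) : π.region D α = π.region E α := by
  rw [EnhancedPolygon.region, EnhancedPolygon.region, armList_congr h]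

theorem EnhancedPolygon.rootRegion_congr (π : EnhancedPolygon R S) {D E : Finset Arrow}
    (h : armSet D (rootArrow π.size) = armSet E (rootArrow π.size)) :
    π.rootRegion D = π.rootRegion E := by
  rw [EnhancedPolygon.rootRegion, EnhancedPolygon.rootRegion, armList_congr h]

/-! ## Refinements of dissections -/

instance (a b : Arrow) : Decidable (Compatible a b) :=
  inferInstanceAs (Decidable (¬ Crosses a b ∧ ¬ Crosses b a))

instance (C : Finset Arrow) (α b : Arrow) : Decidable (Dissects C α b) :=
  inferInstanceAs (Decidable (lo b + 3 ≤ hi b ∧ Below b α ∧ (∀ c ∈ C, Compatible b c) ∧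
    ∀ c ∈ C, Below c α → b ≠ c ∧ ¬ Below b c))

/-- A bijection between two sets of arrows which preserves the relative position of the arrows. -/
structure ArrowEquiv (A B : Finset Arrow) (φ : Arrow → Arrow) : Prop where
  maps : ∀ a ∈ A, φ a ∈ B
  inj : ∀ a ∈ A, ∀ b ∈ A, φ a = φ b → a = b
  surj : ∀ b ∈ B, ∃ a ∈ A, φ a = b
  compatible : ∀ a ∈ A, ∀ b ∈ A, (Compatible (φ a) (φ b) ↔ Compatible a b)
  below : ∀ a ∈ A, ∀ b ∈ A, (Below (φ a) (φ b) ↔ Below a b)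

/-- The arrows which dissect the region right under `α` in the dissection `C`. -/
def innerArrows (A C : Finset Arrow) (α : Arrow) : Finset Arrow := A.filter (Dissects C α)

namespace EnhancedPolygon

theorem two_le_size (π : EnhancedPolygon R S) : 2 ≤ π.size := by
  simp [size]

theorem mem_dissectingArrows {π : EnhancedPolygon R S} {α : Arrow} :
    α ∈ π.dissectingArrows ↔ α ∈ arrows π.size ∧ 2 ≤ lo α := by
  rw [dissectingArrows, Finset.mem_filter]
  refine and_congr_right fun _ => ?_
  have := arrow_cases α
  omega

theorem dissectingArrows_subset (π : EnhancedPolygon R S) :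
    π.dissectingArrows ⊆ arrows π.size := fun _ h => (mem_dissectingArrows.1 h).1

theorem region_ne {π : EnhancedPolygon R S} {D : Finset Arrow}
    (hD : D ∈ dissections π.dissectingArrows) {α : Arrow} (hα : α ∈ D) :
    (armList D α).map π.side ≠ [] :=
  regionArms_ne_nil π.two_le_size π.dissectingArrows_subset hD (Or.inl hα) _

theorem region_arms {π : EnhancedPolygon R S} {D : Finset Arrow} {α : Arrow}
    (h : (armList D α).map π.side ≠ []) : (π.region D α).arms = (armList D α).map π.side := by
  rw [region, dif_pos h]

theorem region_root {π : EnhancedPolygon R S} {D : Finset Arrow} {α : Arrow}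
    (h : (armList D α).map π.side ≠ []) : (π.region D α).root = π.side α.2 := by
  rw [region, dif_pos h]

end EnhancedPolygon

theorem Polygon.ext' {π π' : Polygon R} (h1 : π.arms = π'.arms) (h2 : π.root = π'.root) :
    π = π' := by
  cases π; cases π'; simp_all

/-- The dissections of the region right under `α`. -/
theorem exists_region_equiv (π : EnhancedPolygon R S) {C : Finset Arrow} {α : Arrow}
    (hC : C ∈ dissections π.dissectingArrows) (hα : α ∈ C) :
    ∃ φ, ArrowEquiv (π.region C α).dissectingArrows (innerArrows π.dissectingArrows C α) φ ∧
      ∀ D ∈ dissections (π.region C α).dissectingArrows,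
        (π.region C α).rootRegion D = π.region (C ∪ D.image φ) α ∧
        (∀ b ∈ D, (π.region C α).region D b = π.region (C ∪ D.image φ) (φ b)) ∧
        armSign C α * sgn D = armSign (C ∪ D.image φ) α *
          ∏ b ∈ D, armSign (C ∪ D.image φ) (φ b) := by
  obtain ⟨M, ψ, h⟩ := exists_isContraction C α (mem_dissections.1 hC).2
  have hαA := EnhancedPolygon.mem_dissectingArrows.1 ((mem_dissections.1 hC).1 hα)
  have hne := EnhancedPolygon.region_ne hC hα
  have harms := EnhancedPolygon.region_arms hne
  have hroot := EnhancedPolygon.region_root hne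
  have hcomp : ∀ c ∈ C, Compatible α c := fun c hc => compatible_of_mem_dissections hC hα hc
  have hpos := h.pos
  have hsize : (π.region C α).size = M := by
    rw [Polygon.size, harms, h.armList_eq_map_range]
    simp
    omega
  have hM : 2 ≤ M := by
    rw [h.armList_eq_map_range] at hne
    by_contra hlt
    apply hne
    have : M - 1 = 0 := by omega
    simp [this]
  have hside : ∀ i < M, (π.region C α).side i = π.side (ψ (2 * i + 1) / 2) := by
    intro i hi
    rw [Polygon.side, harms, hroot, h.armList_eq_map_range, List.map_map, List.getD_eq_getElem?_getD]
    by_cases h1 : i < M - 1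
    · rw [List.getElem?_eq_getElem (by simpa using h1)]
      simp
    -- Index `M - 1` is the root side: beyond the arms `getD` returns the decoration of the root,
    -- and `ψ` sends the last position to the side `α.2`.
    · rw [List.getElem?_eq_none (by simp; omega)]
      have e : 2 * i + 1 = 2 * M - 1 := by omega
      rw [e, h.last]
      simp only [Option.getD_none]
      congr 1
      omega
  have hreg : ∀ D ∈ dissections (arrows M), ∀ b, b ∈ D ∨ b = rootArrow M →
      (π.region C α).region D b = π.region (C ∪ D.image (mapArrow ψ)) (mapArrow ψ b) := by
    intro D hD b hb
    have hDA := (mem_dissections.1 hD).1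
    have hb' : b ∈ arrows M ∨ b = rootArrow M := hb.imp_left fun h => hDA h
    have hbM := h.lt_of_mem hb'
    have hlist : (armList D b).map (π.region C α).side =
        (armList (C ∪ D.image (mapArrow ψ)) (mapArrow ψ b)).map π.side := by
      rw [h.armList_map hDA hb', List.map_map]
      refine List.map_congr_left fun i hi => ?_
      have := (mem_armSet.1 (mem_armList.1 hi)).1
      exact hside i (by omega)
    have hn := regionArms_ne_nil hM subset_rfl hD hb (π.region C α).side
    have hn' := hn
    rw [hlist] at hn'
    apply Polygon.ext'
    · rw [EnhancedPolygon.region_arms hn', ← hlist, Polygon.region, dif_pos hn]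
    · rw [EnhancedPolygon.region_root hn', Polygon.region, dif_pos hn]
      have := arrow_cases b
      exact hside b.2 (by omega)
  have hdA : (π.region C α).dissectingArrows = arrows M := by
    rw [Polygon.dissectingArrows, hsize]
  rw [hdA]
  refine ⟨mapArrow ψ, ⟨?_, ?_, ?_, ?_, ?_⟩, ?_⟩
  · intro a ha
    have h1 := h.map_dissects hcomp ha
    refine Finset.mem_filter.2 ⟨EnhancedPolygon.mem_dissectingArrows.2 ⟨mem_arrows_iff.2
      ⟨?_, h1.1, ?_⟩, ?_⟩, h1⟩
    · have := (mem_arrows_iff.1 hαA.1).1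
      have := h1.2.1.2
      omega
    · intro e
      have h2 := h1.2.1
      rw [e] at h2
      exact h2.asymm (below_of_mem_arrows hαA.1)
    · have := h1.2.1.2
      have := hαA.2
      omega
  · intro a ha b hb
    exact h.map_injOn (mem_arrows_iff.1 ha).1 (mem_arrows_iff.1 hb).1
  · intro b hb
    exact h.exists_map_eq (Finset.mem_filter.1 hb).2
  · intro a ha b hb
    exact h.compatible_map (mem_arrows_iff.1 ha).1 (mem_arrows_iff.1 hb).1
  · intro a ha b hb
    exact h.below_map (mem_arrows_iff.1 ha).1 (mem_arrows_iff.1 hb).1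
  · intro D hD
    refine ⟨?_, fun b hb => hreg D hD b (Or.inl hb), h.armSign_mul_sgn hD⟩
    rw [Polygon.rootRegion, hsize, hreg D hD _ (Or.inr rfl), h.map_root]

/-- The dissections of the root region. -/
theorem exists_rootRegion_equiv (π : EnhancedPolygon R S) {C : Finset Arrow}
    (hC : C ∈ dissections π.dissectingArrows) :
    ∃ φ, ArrowEquiv (π.rootRegion C).dissectingArrows
        (innerArrows π.dissectingArrows C (rootArrow π.size)) φ ∧
      ∀ D ∈ dissections (π.rootRegion C).dissectingArrows,
        (π.rootRegion C).rootRegion D = π.rootRegion (C ∪ D.image φ) ∧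
        (∀ b ∈ D, (π.rootRegion C).region D b = π.region (C ∪ D.image φ) (φ b)) ∧
        sgn D = ∏ b ∈ D, armSign (C ∪ D.image φ) (φ b) := by
  set N := π.size with hN
  have hN2 : 2 ≤ N := π.two_le_size
  have hCA : ∀ c ∈ C, c ∈ arrows N ∧ 2 ≤ lo c := fun c hc =>
    EnhancedPolygon.mem_dissectingArrows.1 ((mem_dissections.1 hC).1 hc)
  obtain ⟨M, ψ, h⟩ := exists_isContraction C (rootArrow N) (mem_dissections.1 hC).2
  have hnb := not_isBackward_rootArrow N
  have hcomp : ∀ c ∈ C, Compatible (rootArrow N) c := by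
    intro c hc
    have h1 := below_of_mem_arrows (hCA c hc).1
    have h2 := h1.2
    unfold Compatible Crosses
    omega
  have hpos := h.pos
  have h0 : ψ 0 = 0 := h.zero
  -- The dissecting arrows have `lo ≥ 2`, so none of them contracts anything at the side of second
  -- type.
  have h1 : ψ 1 = 1 := by
    rcases h.gap 0 (by omega) with h1 | h1 | ⟨c, hc, _, h1⟩
    · simpa [h0] using h1
    · omega
    · have := (hCA c hc).2
      have := lo_lt_hi c
      omega
  have hlast : ψ (2 * M - 1) = 2 * (N - 1) + 1 := h.last
  have hM : 2 ≤ M := by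
    by_contra hlt
    have e : 2 * M - 1 = 1 := by omega
    rw [e] at hlast
    omega
  -- Side `0` is the only one sent to side `0`. Hence filtering out the side of second type commutes
  -- with the contraction.
  have hs0 : ∀ i < M, (ψ (2 * i + 1) / 2 = 0 ↔ i = 0) := by
    intro i hi
    constructor
    · intro e
      by_contra hne
      have := h.strictMono hnb 1 (2 * i + 1) (by omega) (by omega)
      have := h.parity (2 * i + 1) (by omega)
      omega
    · rintro rfl
      simp [h1]
  have hlist := h.armList_eq_map_range
  have harms : (π.rootRegion C).arms =
      (List.range (M - 2)).map (fun i => π.side (ψ (2 * (i + 1) + 1) / 2)) := by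
    have e : M - 1 = (M - 2) + 1 := by omega
    have hf : ∀ l : List ℕ, (∀ i ∈ l, i < M - 2) →
        (l.map fun i => ψ (2 * (i + 1) + 1) / 2).filter (fun i => i ≠ 0) =
          l.map fun i => ψ (2 * (i + 1) + 1) / 2 := by
      intro l hl
      rw [List.filter_eq_self]
      intro j hj
      obtain ⟨i, hi, rfl⟩ := List.mem_map.1 hj
      have := hl i hi
      have := hs0 (i + 1) (by omega)
      rw [decide_eq_true_iff]
      omega
    change ((armList C (rootArrow N)).filter (fun i => i ≠ 0)).map π.side = _
    rw [hlist, e, List.range_succ_eq_map, List.map_cons, List.map_map, List.filter_cons_of_neg]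
    · have := hf (List.range (M - 2)) (fun i hi => List.mem_range.1 hi)
      simp only [Function.comp_def, Nat.succ_eq_add_one]
      rw [this, List.map_map]
      rfl
    · simp [h1]
  have hsize : (π.rootRegion C).size = M := by
    rw [EnhancedPolygon.size, harms]
    simp
    omega
  have hside : ∀ i, 0 < i → i < M → (π.rootRegion C).side i = π.side (ψ (2 * i + 1) / 2) := by
    intro i hi0 hi
    rw [EnhancedPolygon.side, harms, List.getD_eq_getElem?_getD]
    by_cases hi1 : i < M - 1
    · rw [List.getElem?_eq_getElem (by simp; omega)]
      have e : i - 1 + 1 = i := by omega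
      simp [e]
    · rw [List.getElem?_eq_none (by simp; omega)]
      have e : 2 * i + 1 = 2 * M - 1 := by omega
      rw [e, hlast]
      have e2 : (2 * (N - 1) + 1) / 2 = N - 1 := by omega
      rw [e2, EnhancedPolygon.side, List.getD_eq_getElem?_getD, List.getElem?_eq_none]
      · rfl
      · rw [hN, EnhancedPolygon.size]
        omega
  have hdA : ∀ a, a ∈ (π.rootRegion C).dissectingArrows ↔ a ∈ arrows M ∧ 2 ≤ lo a := by
    intro a
    rw [EnhancedPolygon.mem_dissectingArrows, hsize]
  have hlo : ∀ a ∈ arrows M, (2 ≤ lo (mapArrow ψ a) ↔ 2 ≤ lo a) := by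
    intro a ha
    have h2 := (mem_arrows_iff.1 ha).1
    have h3 := lo_lt_hi a
    rcases h.lo_hi_map h2 with ⟨_, h4, _⟩ | ⟨h4, _⟩
    · have h5 := h.lt_iff hnb (i := 1) (j := lo a) (by omega) (by omega)
      omega
    · exact absurd h4 hnb
  refine ⟨mapArrow ψ, ⟨?_, ?_, ?_, ?_, ?_⟩, ?_⟩
  · intro a ha
    rw [hdA] at ha
    have h2 := h.map_dissects hcomp ha.1
    refine Finset.mem_filter.2 ⟨EnhancedPolygon.mem_dissectingArrows.2 ⟨mem_arrows_iff.2
      ⟨?_, h2.1, h2.2.1.1⟩, (hlo a ha.1).2 ha.2⟩, h2⟩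
    have h3 := h2.2.1.2
    rw [hi_rootArrow (by omega)] at h3
    omega
  · intro a ha b hb
    exact h.map_injOn (mem_arrows_iff.1 ((hdA a).1 ha).1).1 (mem_arrows_iff.1 ((hdA b).1 hb).1).1
  · intro b hb
    obtain ⟨hbA, hb⟩ := Finset.mem_filter.1 hb
    obtain ⟨a, ha, rfl⟩ := h.exists_map_eq hb
    exact ⟨a, (hdA a).2 ⟨ha, (hlo a ha).1 (EnhancedPolygon.mem_dissectingArrows.1 hbA).2⟩, rfl⟩
  · intro a ha b hb
    exact h.compatible_map (mem_arrows_iff.1 ((hdA a).1 ha).1).1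
      (mem_arrows_iff.1 ((hdA b).1 hb).1).1
  · intro a ha b hb
    exact h.below_map (mem_arrows_iff.1 ((hdA a).1 ha).1).1 (mem_arrows_iff.1 ((hdA b).1 hb).1).1
  · intro D hD
    have hDA : ∀ a ∈ D, a ∈ arrows M := fun a ha => ((hdA a).1 ((mem_dissections.1 hD).1 ha)).1
    have hD' : D ∈ dissections (arrows M) := mem_dissections.2 ⟨hDA, (mem_dissections.1 hD).2⟩
    refine ⟨?_, ?_, ?_⟩
    · have e : (π.rootRegion C).rootRegion D =
          ⟨π.second, ((armList D (rootArrow M)).filter (fun i => i ≠ 0)).map (π.rootRegion C).side,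
            π.root, π.root_mem, π.second_le⟩ := by
        rw [EnhancedPolygon.rootRegion, hsize]
        rfl
      rw [e]
      have h2 := h.armList_map hDA (Or.inr rfl)
      rw [h.map_root] at h2
      have e' : π.rootRegion (C ∪ D.image (mapArrow ψ)) =
          ⟨π.second, ((armList (C ∪ D.image (mapArrow ψ)) (rootArrow N)).filter
            (fun i => i ≠ 0)).map π.side, π.root, π.root_mem, π.second_le⟩ := rfl
      rw [e', h2]
      congr 1
      rw [List.filter_map, List.map_map]
      have hlt : ∀ i ∈ armList D (rootArrow M), i < M := by
        intro i hi
        have := (mem_armSet.1 (mem_armList.1 hi)).1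
        rw [hi_rootArrow hpos] at this
        omega
      have h3 : (armList D (rootArrow M)).filter
          ((fun i => decide (i ≠ 0)) ∘ fun i => ψ (2 * i + 1) / 2) =
          (armList D (rootArrow M)).filter (fun i => decide (i ≠ 0)) := by
        refine List.filter_congr fun i hi => ?_
        simp only [Function.comp, ne_eq, decide_eq_decide]
        rw [hs0 i (hlt i hi)]
      rw [h3]
      refine List.map_congr_left fun i hi => ?_
      obtain ⟨hi1, hi2⟩ := List.mem_filter.1 hi
      exact hside i (by simpa [Nat.pos_iff_ne_zero] using hi2) (hlt i hi1)
    · intro b hb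
      have hbA := (hdA b).1 ((mem_dissections.1 hD).1 hb)
      have hbM := (mem_arrows_iff.1 hbA.1).1
      have hl : (armList D b).map (π.rootRegion C).side =
          (armList (C ∪ D.image (mapArrow ψ)) (mapArrow ψ b)).map π.side := by
        rw [h.armList_map hDA (Or.inl hbA.1), List.map_map]
        refine List.map_congr_left fun i hi => ?_
        have := (mem_armSet.1 (mem_armList.1 hi)).1
        exact hside i (by omega) (by omega)
      have hn := EnhancedPolygon.region_ne hD hb
      have hn' := hn
      rw [hl] at hn'
      apply Polygon.ext'
      · rw [EnhancedPolygon.region_arms hn', ← hl, EnhancedPolygon.region_arms hn]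
      · rw [EnhancedPolygon.region_root hn', EnhancedPolygon.region_root hn]
        have := arrow_cases b
        exact hside b.2 (by omega) (by omega)
    -- The root arrow is forward, so the root region contributes the factor `1` on both sides.
    · have h2 := h.armSign_mul_sgn hD'
      simpa only [armSign, if_neg hnb, one_mul] using h2

/-! ## Compatible linear orders as lists of arrows -/

/-- In a dissection, the region under `a` may come before the region under `b`. -/
def MayPrecede (a b : Arrow) : Prop := a ≠ b ∧ Compatible a b ∧ ¬ Below a b

/-- The dissections with arrows in `A`, together with a compatible linear order of the arrows. -/
def ordLists (A : Finset Arrow) : Finset (List Arrow) := (dissections A).biUnion orders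

theorem mem_orders {D : Finset Arrow} {l : List Arrow} :
    l ∈ orders D ↔ (l.Nodup ∧ l.toFinset = D) ∧ l.Pairwise (fun α β => ¬ Below α β) := by
  rw [orders, Finset.mem_filter, Multiset.mem_toFinset, Multiset.mem_lists_iff]
  refine and_congr_left fun _ => ⟨fun h => ?_, fun h => ?_⟩
  · have hn : l.Nodup := by
      have := D.nodup
      rw [h] at this
      exact this
    refine ⟨hn, ?_⟩
    ext a
    rw [List.mem_toFinset, ← Finset.mem_val, h]
    rfl
  · rw [← h.2, List.toFinset_val, h.1.dedup]
    rfl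

/-- Non-crossing, distinctness and compatibility with the dual tree are all conditions on pairs. A
list therefore carries its dissection with it, and sums over dissections and orders become sums over
lists. -/
theorem mem_ordLists {A : Finset Arrow} {l : List Arrow} :
    l ∈ ordLists A ↔ (∀ a ∈ l, a ∈ A) ∧ l.Pairwise MayPrecede := by
  simp only [ordLists, Finset.mem_biUnion, mem_orders, mem_dissections]
  constructor
  · rintro ⟨D, ⟨h1, h2⟩, ⟨h3, rfl⟩, h4⟩
    refine ⟨fun a ha => h1 (List.mem_toFinset.2 ha), ?_⟩
    refine (h3.and h4).imp_of_mem fun {a b} ha hb hab => ⟨hab.1, ?_, hab.2⟩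
    rw [← List.mem_toFinset] at ha hb
    exact ⟨h2 a ha b hb, h2 b hb a ha⟩
  · rintro ⟨h1, h2⟩
    refine ⟨l.toFinset, ⟨fun a ha => h1 a (List.mem_toFinset.1 ha), ?_⟩,
      ⟨h2.imp fun h => h.1, rfl⟩, h2.imp fun h => h.2.2⟩
    intro a ha b hb
    rw [List.mem_toFinset] at ha hb
    by_cases hab : a = b
    · subst hab
      exact fun h => lt_irrefl _ h.1
    · have h3 : l.Pairwise Compatible := h2.imp fun h => h.2.1
      have : Std.Symm Compatible := ⟨fun _ _ h => h.symm⟩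
      exact (h3.forall ha hb hab).1

theorem nodup_of_mem_ordLists {A : Finset Arrow} {l : List Arrow} (h : l ∈ ordLists A) : l.Nodup :=
  (mem_ordLists.1 h).2.imp fun h => h.1

theorem toFinset_mem_dissections {A : Finset Arrow} {l : List Arrow} (h : l ∈ ordLists A) :
    l.toFinset ∈ dissections A := by
  obtain ⟨D, hD, hl⟩ := Finset.mem_biUnion.1 h
  rwa [(mem_orders.1 hl).1.2]

theorem sum_dissections_orders {E : Type*} [AddCommMonoid E] (A : Finset Arrow)
    (F : Finset Arrow → List Arrow → E) :
    ∑ D ∈ dissections A, ∑ l ∈ orders D, F D l = ∑ l ∈ ordLists A, F l.toFinset l := by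
  rw [ordLists, Finset.sum_biUnion]
  · refine Finset.sum_congr rfl fun D _ => Finset.sum_congr rfl fun l hl => ?_
    rw [(mem_orders.1 hl).1.2]
  · intro D _ E _ hDE
    change Disjoint (orders D) (orders E)
    rw [Finset.disjoint_left]
    intro l hl hl'
    exact hDE ((mem_orders.1 hl).1.2.symm.trans (mem_orders.1 hl').1.2)

/-- The path to the region under `a` consists of `a` and the arrows above it, so two arrows of `D`
share a path exactly when they are comparable. -/
theorem mem_admissible {A D : Finset Arrow} :
    D ∈ admissible A ↔ D ∈ dissections A ∧ ∀ a ∈ D, ∀ b ∈ D, ¬ Below a b := by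
  rw [admissible, Finset.mem_filter]
  refine and_congr_right fun _ => ⟨fun h a ha b hb hab => ?_, fun h => ⟨subset_rfl, fun a ha => ?_⟩⟩
  · have h1 : ({a, b} : Finset Arrow) ⊆ path D a ∩ D := by
      intro x hx
      rw [Finset.mem_insert, Finset.mem_singleton] at hx
      rw [Finset.mem_inter, path, Finset.mem_filter]
      rcases hx with rfl | rfl
      · exact ⟨⟨ha, Or.inl rfl⟩, ha⟩
      · exact ⟨⟨hb, Or.inr hab⟩, hb⟩
    have h2 := (Finset.card_le_card h1).trans (h.2 a ha)
    rw [Finset.card_pair hab.1] at h2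
    omega
  · rw [Finset.card_le_one]
    have key : ∀ x ∈ path D a ∩ D, x = a := by
      intro x hx
      rw [Finset.mem_inter, path, Finset.mem_filter] at hx
      rcases hx.1.2 with e | e
      · exact e
      · exact absurd e (h a ha x hx.2)
    intro x hx y hy
    rw [key x hx, key y hy]

/-! ### Reindexing sums along a bijection of arrows -/

namespace ArrowEquiv

variable {A B : Finset Arrow} {φ : Arrow → Arrow} {E : Type*} [AddCommMonoid E]

theorem mayPrecede (h : ArrowEquiv A B φ) {a b : Arrow} (ha : a ∈ A) (hb : b ∈ A) :
    MayPrecede (φ a) (φ b) ↔ MayPrecede a b := by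
  unfold MayPrecede
  rw [h.compatible a ha b hb, h.below a ha b hb]
  have : φ a ≠ φ b ↔ a ≠ b := not_congr ⟨h.inj a ha b hb, fun e => by rw [e]⟩
  rw [this]

theorem sum_arrows (h : ArrowEquiv A B φ) (F : Arrow → E) : ∑ a ∈ A, F (φ a) = ∑ b ∈ B, F b :=
  Finset.sum_bij (fun a _ => φ a) h.maps (fun a ha b hb => h.inj a ha b hb)
    (fun b hb => by obtain ⟨a, ha, e⟩ := h.surj b hb; exact ⟨a, ha, e⟩) (fun _ _ => rfl)

theorem map_inj (h : ArrowEquiv A B φ) : ∀ {l m : List Arrow}, (∀ a ∈ l, a ∈ A) →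
    (∀ a ∈ m, a ∈ A) → l.map φ = m.map φ → l = m
  | [], [], _, _, _ => rfl
  | [], _ :: _, _, _, e => by simp at e
  | _ :: _, [], _, _, e => by simp at e
  | a :: l, b :: m, hl, hm, e => by
    rw [List.map_cons, List.map_cons, List.cons.injEq] at e
    rw [h.inj a (hl a (by simp)) b (hm b (by simp)) e.1,
      h.map_inj (fun x hx => hl x (by simp [hx])) (fun x hx => hm x (by simp [hx])) e.2]

theorem exists_map (h : ArrowEquiv A B φ) : ∀ {l : List Arrow}, (∀ b ∈ l, b ∈ B) →
    ∃ m : List Arrow, (∀ a ∈ m, a ∈ A) ∧ m.map φ = l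
  | [], _ => ⟨[], by simp, rfl⟩
  | b :: l, hl => by
    obtain ⟨m, hm, rfl⟩ := h.exists_map (l := l) (fun x hx => hl x (by simp [hx]))
    obtain ⟨a, ha, rfl⟩ := h.surj b (hl b (by simp))
    refine ⟨a :: m, ?_, rfl⟩
    intro x hx
    rcases List.mem_cons.1 hx with rfl | hx
    · exact ha
    · exact hm x hx

theorem map_mem_ordLists (h : ArrowEquiv A B φ) {l : List Arrow} (hl : ∀ a ∈ l, a ∈ A) :
    l.map φ ∈ ordLists B ↔ l ∈ ordLists A := by
  rw [mem_ordLists, mem_ordLists]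
  refine and_congr ⟨fun _ => hl, fun _ b hb => ?_⟩ ?_
  · obtain ⟨a, ha, rfl⟩ := List.mem_map.1 hb
    exact h.maps a (hl a ha)
  · rw [List.pairwise_map]
    exact List.Pairwise.iff_of_mem fun {a b} ha hb => h.mayPrecede (hl a ha) (hl b hb)

theorem sum_ordLists (h : ArrowEquiv A B φ) (F : List Arrow → E) :
    ∑ l ∈ ordLists A, F (l.map φ) = ∑ l ∈ ordLists B, F l := by
  refine Finset.sum_bij (fun l _ => l.map φ) ?_ ?_ ?_ (fun _ _ => rfl)
  · intro l hl
    exact (h.map_mem_ordLists (mem_ordLists.1 hl).1).2 hl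
  · intro l hl m hm
    exact h.map_inj (mem_ordLists.1 hl).1 (mem_ordLists.1 hm).1
  · intro l hl
    obtain ⟨m, hm, rfl⟩ := h.exists_map (mem_ordLists.1 hl).1
    exact ⟨m, (h.map_mem_ordLists hm).1 hl, rfl⟩

theorem image_mem_admissible (h : ArrowEquiv A B φ) {D : Finset Arrow} (hD : D ⊆ A) :
    D.image φ ∈ admissible B ↔ D ∈ admissible A := by
  rw [mem_admissible, mem_admissible, mem_dissections, mem_dissections]
  simp only [Finset.forall_mem_image]
  have h1 : (D.image φ ⊆ B) ↔ D ⊆ A := by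
    refine ⟨fun _ => hD, fun _ b hb => ?_⟩
    obtain ⟨a, ha, rfl⟩ := Finset.mem_image.1 hb
    exact h.maps a (hD ha)
  rw [h1, and_assoc, and_assoc]
  refine and_congr_right fun _ => and_congr ?_ ?_
  · constructor
    · intro h2 a ha b hb
      exact ((h.compatible a (hD ha) b (hD hb)).1 ⟨h2 ha hb, h2 hb ha⟩).1
    · intro h2 a ha b hb
      exact ((h.compatible a (hD ha) b (hD hb)).2 ⟨h2 a ha b hb, h2 b hb a ha⟩).1
  · constructor
    · intro h2 a ha b hb
      rw [← h.below a (hD ha) b (hD hb)]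
      exact h2 ha hb
    · intro h2 a ha b hb
      rw [h.below a (hD ha) b (hD hb)]
      exact h2 a ha b hb

theorem sum_admissible (h : ArrowEquiv A B φ) (F : Finset Arrow → E) :
    ∑ D ∈ admissible A, F (D.image φ) = ∑ D ∈ admissible B, F D := by
  have hsub : ∀ {A D : Finset Arrow}, D ∈ admissible A → D ⊆ A := fun hD =>
    (mem_dissections.1 (mem_admissible.1 hD).1).1
  refine Finset.sum_bij (fun D _ => D.image φ) ?_ ?_ ?_ (fun _ _ => rfl)
  · intro D hD
    exact (h.image_mem_admissible (hsub hD)).2 hD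
  · intro D hD D' hD' e
    have key : ∀ {D D'}, D ∈ admissible A → D' ∈ admissible A → D.image φ = D'.image φ →
        D ⊆ D' := by
      intro D D' hD hD' e a ha
      have h1 : φ a ∈ D'.image φ := e ▸ Finset.mem_image_of_mem φ ha
      obtain ⟨b, hb, hba⟩ := Finset.mem_image.1 h1
      rwa [← h.inj b (hsub hD' hb) a (hsub hD ha) hba]
    exact (key hD hD' e).antisymm (key hD' hD e.symm)
  · intro D hD
    -- The preimage is taken inside `A`, since nothing is known about `φ` elsewhere.
    have e : (A.filter (fun a => φ a ∈ D)).image φ = D := by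
      ext b
      rw [Finset.mem_image]
      constructor
      · rintro ⟨a, ha, rfl⟩
        exact (Finset.mem_filter.1 ha).2
      · intro hb
        obtain ⟨a, ha, rfl⟩ := h.surj b (hsub hD hb)
        exact ⟨a, Finset.mem_filter.2 ⟨ha, hb⟩, rfl⟩
    refine ⟨A.filter (fun a => φ a ∈ D), ?_, e⟩
    rw [← h.image_mem_admissible (Finset.filter_subset _ _), e]
    exact hD

end ArrowEquiv

/-! ## Splittings of lists -/

/-- All ways to write a list of the family `O` as a concatenation. -/
def splits {α : Type*} [DecidableEq α] (O : Finset (List α)) : Finset (List α × List α) :=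
  O.biUnion fun l => (Finset.range (l.length + 1)).image fun i => (l.take i, l.drop i)

theorem mem_splits {α : Type*} [DecidableEq α] {O : Finset (List α)} {p : List α × List α} :
    p ∈ splits O ↔ p.1 ++ p.2 ∈ O := by
  simp only [splits, Finset.mem_biUnion, Finset.mem_image, Finset.mem_range]
  constructor
  · rintro ⟨l, hl, i, _, rfl⟩
    simpa using hl
  · intro h
    exact ⟨_, h, p.1.length, by simp, by simp⟩

theorem sum_splits {α E : Type*} [DecidableEq α] [AddCommMonoid E] (O : Finset (List α))
    (F : List α → List α → E) :
    ∑ p ∈ splits O, F p.1 p.2 =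
      ∑ l ∈ O, ∑ i ∈ Finset.range (l.length + 1), F (l.take i) (l.drop i) := by
  rw [splits, Finset.sum_biUnion]
  · refine Finset.sum_congr rfl fun l _ => ?_
    rw [Finset.sum_image]
    intro i hi j hj e
    have h1 : (l.take i).length = (l.take j).length := congrArg List.length (Prod.ext_iff.1 e).1
    rw [List.length_take, List.length_take] at h1
    have := Finset.mem_range.1 (Finset.mem_coe.1 hi)
    have := Finset.mem_range.1 (Finset.mem_coe.1 hj)
    omega
  · intro l _ m _ hlm
    change Disjoint (Finset.image _ _) (Finset.image _ _)
    rw [Finset.disjoint_left]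
    intro p hp hp'
    obtain ⟨i, _, rfl⟩ := Finset.mem_image.1 hp
    obtain ⟨j, _, e⟩ := Finset.mem_image.1 hp'
    apply hlm
    rw [Prod.ext_iff] at e
    rw [← List.take_append_drop i l, ← List.take_append_drop j m]
    exact congrArg₂ (· ++ ·) e.1.symm e.2.symm

/-! ## Shuffles -/

theorem shuffles_nil_left {α : Type*} (m : List α) : shuffles [] m = [m] := by rw [shuffles]

theorem shuffles_nil_right {α : Type*} (l : List α) : shuffles l [] = [l] := by
  cases l <;> rw [shuffles]

theorem shuffles_cons_cons {α : Type*} (a b : α) (l m : List α) :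
    shuffles (a :: l) (b :: m) =
      (shuffles l (b :: m)).map (a :: ·) ++ (shuffles (a :: l) m).map (b :: ·) := by
  rw [shuffles]

theorem shuffles_map {α β : Type*} (f : α → β) (l m : List α) :
    shuffles (l.map f) (m.map f) = (shuffles l m).map (List.map f) := by
  induction l, m using shuffles.induct with
  | case1 m => simp [shuffles_nil_left]
  | case2 a l => simp [shuffles_nil_right]
  | case3 a l b m ih1 ih2 =>
    rw [List.map_cons] at ih1 ih2
    simp only [List.map_cons, shuffles_cons_cons, ih1, ih2, List.map_append, List.map_map]
    rfl

/-- A predicate that separates the letters of the two words recovers both of them from a shuffle by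
filtering. -/
theorem mem_shuffles_iff {α : Type*} (p : α → Bool) (l m : List α) (hl : ∀ a ∈ l, p a = true)
    (hm : ∀ a ∈ m, p a = false) (w : List α) :
    w ∈ shuffles l m ↔ w.filter p = l ∧ w.filter (fun a => !p a) = m := by
  induction l, m using shuffles.induct generalizing w with
  | case1 m =>
    rw [shuffles_nil_left, List.mem_singleton]
    constructor
    · rintro rfl
      exact ⟨List.filter_eq_nil_iff.2 fun a ha => by simp [hm a ha],
        List.filter_eq_self.2 fun a ha => by simp [hm a ha]⟩
    · rintro ⟨h1, h2⟩
      rw [List.filter_eq_nil_iff] at h1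
      rw [← h2, List.filter_eq_self.2 fun a ha => by simpa using h1 a ha]
  | case2 a l =>
    rw [shuffles_nil_right, List.mem_singleton]
    constructor
    · rintro rfl
      exact ⟨List.filter_eq_self.2 hl, List.filter_eq_nil_iff.2 fun b hb => by simp [hl b hb]⟩
    · rintro ⟨h1, h2⟩
      rw [List.filter_eq_nil_iff] at h2
      rw [← h1, List.filter_eq_self.2 fun b hb => by simpa using h2 b hb]
  | case3 a l b m ih1 ih2 =>
    have ha := hl a (by simp)
    have hb := hm b (by simp)
    rw [shuffles_cons_cons, List.mem_append, List.mem_map, List.mem_map]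
    cases w with
    | nil => simp
    | cons x w =>
      have h1 := ih1 (fun c hc => hl c (by simp [hc])) hm w
      have h2 := ih2 hl (fun c hc => hm c (by simp [hc])) w
      cases hx : p x with
      | true =>
        rw [List.filter_cons_of_pos hx, List.filter_cons_of_neg (by simp [hx]), List.cons.injEq]
        constructor
        · rintro (⟨v, hv, e⟩ | ⟨v, hv, e⟩)
          · rw [List.cons.injEq] at e
            obtain ⟨rfl, rfl⟩ := e
            exact ⟨⟨rfl, (h1.1 hv).1⟩, (h1.1 hv).2⟩
          · rw [List.cons.injEq] at e
            rw [← e.1, hb] at hx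
            exact absurd hx (by simp)
        · rintro ⟨⟨rfl, h3⟩, h4⟩
          exact Or.inl ⟨w, h1.2 ⟨h3, h4⟩, rfl⟩
      | false =>
        rw [List.filter_cons_of_neg (by simp [hx]), List.filter_cons_of_pos (by simp [hx]),
          List.cons.injEq]
        constructor
        · rintro (⟨v, hv, e⟩ | ⟨v, hv, e⟩)
          · rw [List.cons.injEq] at e
            rw [← e.1, ha] at hx
            exact absurd hx (by simp)
          · rw [List.cons.injEq] at e
            obtain ⟨rfl, rfl⟩ := e
            exact ⟨(h2.1 hv).1, rfl, (h2.1 hv).2⟩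
        · rintro ⟨h3, rfl, h4⟩
          exact Or.inr ⟨w, h2.2 ⟨h3, h4⟩, rfl⟩

theorem nodup_shuffles {α : Type*} (p : α → Bool) (l m : List α) (hl : ∀ a ∈ l, p a = true)
    (hm : ∀ a ∈ m, p a = false) : (shuffles l m).Nodup := by
  induction l, m using shuffles.induct with
  | case1 m => simp [shuffles_nil_left]
  | case2 a l => simp [shuffles_nil_right]
  | case3 a l b m ih1 ih2 =>
    have ha := hl a (by simp)
    have hb := hm b (by simp)
    rw [shuffles_cons_cons]
    refine ((ih1 (fun c hc => hl c (by simp [hc])) hm).map (List.cons_injective)).append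
      ((ih2 hl (fun c hc => hm c (by simp [hc]))).map (List.cons_injective)) ?_
    intro w hw hw'
    obtain ⟨v, _, rfl⟩ := List.mem_map.1 hw
    obtain ⟨v', _, e⟩ := List.mem_map.1 hw'
    rw [List.cons.injEq] at e
    rw [e.1, ha] at hb
    exact absurd hb (by simp)

/-- Group the lists of `O` by their two filtered parts. Each group is the set of shuffles of the
parts, and by `nodup_shuffles` no shuffle is repeated. -/
theorem sum_shuffles {α E : Type*} [DecidableEq α] [AddCommMonoid E] {O O₁ O₂ : Finset (List α)}
    (p : α → Bool) (h₁ : ∀ l ∈ O₁, ∀ a ∈ l, p a = true) (h₂ : ∀ l ∈ O₂, ∀ a ∈ l, p a = false)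
    (hO : ∀ l, l ∈ O ↔ l.filter p ∈ O₁ ∧ l.filter (fun a => !p a) ∈ O₂) (F : List α → E) :
    ∑ l ∈ O, F l = ∑ l₁ ∈ O₁, ∑ l₂ ∈ O₂, ((shuffles l₁ l₂).map F).sum := by
  rw [← Finset.sum_product', ← Finset.sum_fiberwise_of_maps_to
    (g := fun l => (l.filter p, l.filter (fun a => !p a))) (t := O₁ ×ˢ O₂)
    (fun l hl => Finset.mem_product.2 ((hO l).1 hl))]
  refine Finset.sum_congr rfl fun q hq => ?_
  obtain ⟨hq1, hq2⟩ := Finset.mem_product.1 hq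
  rw [← List.sum_toFinset F (nodup_shuffles p q.1 q.2 (h₁ _ hq1) (h₂ _ hq2))]
  refine Finset.sum_congr ?_ fun _ _ => rfl
  ext l
  rw [Finset.mem_filter, List.mem_toFinset, mem_shuffles_iff p q.1 q.2 (h₁ _ hq1) (h₂ _ hq2), hO]
  constructor
  · rintro ⟨_, rfl⟩
    exact ⟨rfl, rfl⟩
  · rintro ⟨e1, e2⟩
    rw [e1, e2]
    exact ⟨⟨hq1, hq2⟩, rfl⟩

theorem toFinset_of_mem_shuffles {α : Type*} [DecidableEq α] {l m w : List α}
    (h : w ∈ shuffles l m) : w.toFinset = l.toFinset ∪ m.toFinset := by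
  induction l, m using shuffles.induct generalizing w with
  | case1 m =>
    rw [shuffles_nil_left, List.mem_singleton] at h
    simp [h]
  | case2 a l =>
    rw [shuffles_nil_right, List.mem_singleton] at h
    simp [h]
  | case3 a l b m ih1 ih2 =>
    rw [shuffles_cons_cons, List.mem_append, List.mem_map, List.mem_map] at h
    rcases h with ⟨v, hv, rfl⟩ | ⟨v, hv, rfl⟩
    · rw [List.toFinset_cons, ih1 hv, List.toFinset_cons (a := a), Finset.insert_union]
    · rw [List.toFinset_cons, ih2 hv, List.toFinset_cons (a := b), Finset.union_insert]

/-- The shuffle product as a bilinear map. -/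
def shuffleBilin : Words R →ₗ[ℚ] Words R →ₗ[ℚ] Words R :=
  Finsupp.linearCombination ℚ fun l => Finsupp.linearCombination ℚ fun m =>
    ((shuffles l m).map fun w => Finsupp.single w (1 : ℚ)).sum

theorem shuffle_eq (x y : Words R) : shuffle x y = shuffleBilin x y := by
  rw [shuffle, shuffleBilin, Finsupp.linearCombination_apply, Finsupp.sum, Finsupp.sum,
    LinearMap.sum_apply]
  refine Finset.sum_congr rfl fun l _ => ?_
  rw [LinearMap.smul_apply, Finsupp.linearCombination_apply, Finsupp.smul_sum]
  refine Finsupp.sum_congr fun m _ => ?_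
  rw [smul_smul, List.smul_sum, List.map_map]
  congr 2
  funext w
  simp

theorem shuffleBilin_single (l m : List (Polygon R)) (c d : ℚ) :
    shuffleBilin (Finsupp.single l c) (Finsupp.single m d) =
      ((shuffles l m).map fun w => Finsupp.single w (c * d)).sum := by
  rw [← shuffle_eq, shuffle, Finsupp.sum_single_index, Finsupp.sum_single_index]
  · simp
  · simp

/-! ## Relative position of arrows -/

theorem disjoint_of_incomparable {c d : Arrow} (h1 : c ≠ d) (h2 : Compatible c d)
    (h3 : ¬ Below c d) (h4 : ¬ Below d c) : hi c ≤ lo d ∨ hi d ≤ lo c := by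
  have h5 : ¬ (lo d ≤ lo c ∧ hi c ≤ hi d) := fun h => h3 ⟨h1, h⟩
  have h6 : ¬ (lo c ≤ lo d ∧ hi d ≤ hi c) := fun h => h4 ⟨h1.symm, h⟩
  unfold Compatible Crosses at h2
  omega

theorem mayPrecede_of_disjoint {a b : Arrow} (h : hi a ≤ lo b ∨ hi b ≤ lo a) : MayPrecede a b := by
  have h1 := lo_lt_hi a
  have h2 := lo_lt_hi b
  refine ⟨?_, ?_, ?_⟩
  · rintro rfl
    omega
  · unfold Compatible Crosses
    omega
  · rintro ⟨_, h3⟩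
    omega

/-- An arrow `a` that may precede `c` contains `c` or is disjoint from it, and so stands in the same
relation to everything inside `c`. Conditions on a dissection thus only need to be checked on its
maximal arrows. -/
theorem MayPrecede.of_le {a b c : Arrow} (h : MayPrecede a c) (hbc : b = c ∨ Below b c) :
    MayPrecede a b := by
  rcases hbc with rfl | hbc
  · exact h
  · obtain ⟨h1, h2, h3⟩ := h
    refine ⟨?_, ?_, fun h4 => h3 (h4.trans hbc)⟩
    · rintro rfl
      exact h3 hbc
    · have h5 : ¬ (lo c ≤ lo a ∧ hi a ≤ hi c) := fun h => h3 ⟨h1, h⟩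
      have h6 := hbc.2
      have h7 := lo_lt_hi b
      unfold Compatible Crosses at *
      omega

theorem le_bounds {a c : Arrow} (h : a = c ∨ Below a c) : lo c ≤ lo a ∧ hi a ≤ hi c := by
  rcases h with rfl | h
  · exact ⟨le_rfl, le_rfl⟩
  · exact h.2

theorem armSet_union_left {D E : Finset Arrow} {a : Arrow} (h : ∀ b ∈ E, ¬ Below b a) :
    armSet (D ∪ E) a = armSet D a := by
  apply armSet_congr
  · intro b hb hba
    rcases Finset.mem_union.1 hb with hb | hb
    · exact ⟨b, hb, hba, le_rfl, le_rfl⟩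
    · exact absurd hba (h b hb)
  · intro b hb hba
    exact ⟨b, Finset.mem_union_left _ hb, hba, le_rfl, le_rfl⟩

/-- The maximal arrows, that is, those closest to the root. -/
def maxima (D : Finset Arrow) : Finset Arrow := D.filter fun a => ∀ b ∈ D, ¬ Below a b

theorem exists_le_maxima {D : Finset Arrow} {a : Arrow} (ha : a ∈ D) :
    ∃ c ∈ maxima D, a = c ∨ Below a c := by
  obtain ⟨c, hc, hmax⟩ := Finset.exists_max_image (D.filter fun b => a = b ∨ Below a b)
    (fun b => hi b - lo b) ⟨a, Finset.mem_filter.2 ⟨ha, Or.inl rfl⟩⟩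
  rw [Finset.mem_filter] at hc
  refine ⟨c, Finset.mem_filter.2 ⟨hc.1, fun b hb hcb => ?_⟩, hc.2⟩
  have h1 : Below a b := by
    rcases hc.2 with rfl | h
    · exact hcb
    · exact h.trans hcb
  have h2 := hmax b (Finset.mem_filter.2 ⟨hb, Or.inr h1⟩)
  have h3 := hcb.length_lt
  omega

theorem maxima_mem_admissible {A D : Finset Arrow} (hD : D ∈ dissections A) :
    maxima D ∈ admissible A := by
  obtain ⟨h1, h2⟩ := mem_dissections.1 hD
  have hs : maxima D ⊆ D := Finset.filter_subset _ _
  refine mem_admissible.2 ⟨mem_dissections.2 ⟨hs.trans h1, fun a ha b hb =>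
    h2 a (hs ha) b (hs hb)⟩, fun a ha b hb => (Finset.mem_filter.1 ha).2 b (hs hb)⟩

/-- The members of an admissible dissection are disjoint. -/
theorem disjoint_of_mem_admissible {A C : Finset Arrow} (hC : C ∈ admissible A) {c d : Arrow}
    (hc : c ∈ C) (hd : d ∈ C) (hcd : c ≠ d) : hi c ≤ lo d ∨ hi d ≤ lo c :=
  have h := mem_admissible.1 hC
  disjoint_of_incomparable hcd (compatible_of_mem_dissections h.1 hc hd) (h.2 c hc d hd)
    (h.2 d hd c hc)

theorem subset_mem_admissible {A C D : Finset Arrow} (hC : C ∈ admissible A) (hD : D ⊆ C) :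
    D ∈ admissible A := by
  obtain ⟨h1, h2⟩ := mem_admissible.1 hC
  obtain ⟨h3, h4⟩ := mem_dissections.1 h1
  exact mem_admissible.2 ⟨mem_dissections.2 ⟨hD.trans h3, fun a ha b hb => h4 a (hD ha) b (hD hb)⟩,
    fun a ha b hb => h2 a (hD ha) b (hD hb)⟩

/-! ## Lists of arrows with given maximal elements -/

/-- The compatible lists whose maximal arrows are the elements of the admissible dissection `C`. -/
def lowerLists (A C : Finset Arrow) : Finset (List Arrow) :=
  (ordLists A).filter fun l => C ⊆ l.toFinset ∧ ∀ a ∈ l, ∃ c ∈ C, a = c ∨ Below a c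

theorem mem_lowerLists {A C : Finset Arrow} {l : List Arrow} : l ∈ lowerLists A C ↔
    l ∈ ordLists A ∧ C ⊆ l.toFinset ∧ ∀ a ∈ l, ∃ c ∈ C, a = c ∨ Below a c := by
  rw [lowerLists, Finset.mem_filter]

theorem lowerLists_empty (A : Finset Arrow) : lowerLists A ∅ = {[]} := by
  ext l
  rw [mem_lowerLists, Finset.mem_singleton]
  constructor
  · rintro ⟨_, _, h⟩
    rw [List.eq_nil_iff_forall_not_mem]
    intro a ha
    obtain ⟨c, hc, _⟩ := h a ha
    simp at hc
  · rintro rfl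
    exact ⟨mem_ordLists.2 ⟨by simp, List.Pairwise.nil⟩, by simp, by simp⟩

/-- All other arrows are below `c`, so `c` has to come first and imposes no further condition. -/
theorem lowerLists_singleton {A : Finset Arrow} {c : Arrow} (hc : c ∈ A) :
    lowerLists A {c} = (ordLists (A.filter fun a => Below a c)).image (c :: ·) := by
  ext l
  rw [mem_lowerLists, Finset.mem_image, mem_ordLists]
  constructor
  · rintro ⟨⟨h1, h2⟩, h3, h4⟩
    have hcl : c ∈ l := List.mem_toFinset.1 (h3 (by simp))
    cases l with
    | nil => simp at hcl
    | cons x l =>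
      rw [List.pairwise_cons] at h2
      have hx : x = c := by
        by_contra hne
        obtain ⟨d, hd, h5⟩ := h4 x (by simp)
        rw [Finset.mem_singleton] at hd
        subst hd
        rcases List.mem_cons.1 hcl with e | e
        · exact hne e.symm
        · exact (h2.1 d e).2.2 (h5.resolve_left hne)
      subst hx
      refine ⟨l, mem_ordLists.2 ⟨fun a ha => ?_, h2.2⟩, rfl⟩
      obtain ⟨d, hd, h5⟩ := h4 a (by simp [ha])
      rw [Finset.mem_singleton] at hd
      subst hd
      exact Finset.mem_filter.2 ⟨h1 a (by simp [ha]), h5.resolve_left (h2.1 a ha).1.symm⟩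
  · rintro ⟨m, hm, rfl⟩
    obtain ⟨h1, h2⟩ := mem_ordLists.1 hm
    have h3 : ∀ a ∈ m, a ∈ A ∧ Below a c := fun a ha => Finset.mem_filter.1 (h1 a ha)
    refine ⟨⟨?_, List.pairwise_cons.2 ⟨fun a ha => ?_, h2⟩⟩, by simp, ?_⟩
    · intro a ha
      rcases List.mem_cons.1 ha with rfl | ha
      · exact hc
      · exact (h3 a ha).1
    · have h4 := (h3 a ha).2
      have h5 := h4.2
      refine ⟨h4.1.symm, ?_, h4.asymm⟩
      unfold Compatible Crosses
      omega
    · intro a ha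
      refine ⟨c, by simp, ?_⟩
      rcases List.mem_cons.1 ha with rfl | ha
      · exact Or.inl rfl
      · exact Or.inr (h3 a ha).2

/-- The arrows under `c` and those under `C` are disjoint intervals. There is no order constraint
between them, so any interleaving of two compatible lists is compatible. -/
theorem mem_lowerLists_insert {A C : Finset Arrow} {c : Arrow} (hc : c ∉ C)
    (hC : insert c C ∈ admissible A) (l : List Arrow) : l ∈ lowerLists A (insert c C) ↔
      l.filter (fun a => decide (a = c ∨ Below a c)) ∈ lowerLists A {c} ∧
      l.filter (fun a => !decide (a = c ∨ Below a c)) ∈ lowerLists A C := by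
  have hdisj : ∀ a b, a = c ∨ Below a c → (∃ d ∈ C, b = d ∨ Below b d) →
      hi a ≤ lo b ∨ hi b ≤ lo a := by
    rintro a b ha ⟨d, hd, hb⟩
    have h1 := disjoint_of_mem_admissible hC (Finset.mem_insert_self c C)
      (Finset.mem_insert_of_mem hd) (by rintro rfl; exact hc hd)
    have h2 := le_bounds ha
    have h3 := le_bounds hb
    have := lo_lt_hi a
    have := lo_lt_hi b
    omega
  simp only [mem_lowerLists, mem_ordLists, List.mem_filter, Bool.not_eq_true', decide_eq_true_iff,
    decide_eq_false_iff_not, and_imp]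
  constructor
  · rintro ⟨⟨h1, h2⟩, h3, h4⟩
    refine ⟨⟨⟨fun a ha _ => h1 a ha, h2.filter _⟩, ?_, fun a _ hac => ⟨c, by simp, hac⟩⟩,
      ⟨fun a ha _ => h1 a ha, h2.filter _⟩, ?_, ?_⟩
    · intro a ha
      rw [Finset.mem_singleton] at ha
      subst ha
      rw [List.mem_toFinset, List.mem_filter]
      exact ⟨List.mem_toFinset.1 (h3 (Finset.mem_insert_self _ _)), by simp⟩
    · intro d hd
      rw [List.mem_toFinset, List.mem_filter]
      refine ⟨List.mem_toFinset.1 (h3 (Finset.mem_insert_of_mem hd)), ?_⟩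
      rw [Bool.not_eq_true', decide_eq_false_iff_not]
      intro h5
      have h6 := hdisj d d h5 ⟨d, hd, Or.inl rfl⟩
      have := lo_lt_hi d
      omega
    · intro a ha hac
      obtain ⟨d, hd, had⟩ := h4 a ha
      rcases Finset.mem_insert.1 hd with rfl | hd
      · exact absurd had hac
      · exact ⟨d, hd, had⟩
  · rintro ⟨⟨⟨h1, h2⟩, h3, h4⟩, ⟨h5, h6⟩, h7, h8⟩
    refine ⟨⟨fun a ha => ?_, ?_⟩, ?_, fun a ha => ?_⟩
    · by_cases hac : a = c ∨ Below a c
      · exact h1 a ha hac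
      · exact h5 a ha hac
    · rw [List.pairwise_iff_forall_sublist]
      intro a b hab
      have ha : a ∈ l := hab.subset (by simp)
      have hb : b ∈ l := hab.subset (by simp)
      by_cases hac : a = c ∨ Below a c <;> by_cases hbc : b = c ∨ Below b c
      · have h9 := hab.filter (fun a => decide (a = c ∨ Below a c))
        rw [List.filter_eq_self.2 (by simp [hac, hbc])] at h9
        exact List.pairwise_iff_forall_sublist.1 h2 h9
      · exact mayPrecede_of_disjoint (hdisj a b hac (h8 b hb hbc))
      · exact mayPrecede_of_disjoint (hdisj b a hbc (h8 a ha hac)).symm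
      · have h9 := hab.filter (fun a => !decide (a = c ∨ Below a c))
        rw [List.filter_eq_self.2 (by simpa using ⟨not_or.1 hac, not_or.1 hbc⟩)] at h9
        exact List.pairwise_iff_forall_sublist.1 h6 h9
    · intro d hd
      rcases Finset.mem_insert.1 hd with rfl | hd
      · have := h3 (Finset.mem_singleton_self _)
        rw [List.mem_toFinset, List.mem_filter] at this
        exact List.mem_toFinset.2 this.1
      · have := h7 hd
        rw [List.mem_toFinset, List.mem_filter] at this
        exact List.mem_toFinset.2 this.1
    · by_cases hac : a = c ∨ Below a c
      · exact ⟨c, by simp, hac⟩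
      · obtain ⟨d, hd, had⟩ := h8 a ha hac
        exact ⟨d, Finset.mem_insert_of_mem hd, had⟩

/-! ## Splitting a compatible list along an admissible dissection -/

/-- By `MayPrecede.of_le`, the arrows of `l₁` may precede all of `l₂` as soon as they may precede
its maximal arrows. For those it is precisely the condition to dissect the root region of `C`. -/
theorem append_mem_ordLists_iff {A C : Finset Arrow} {N : ℕ} (hA : A ⊆ arrows N)
    (hC : C ∈ admissible A) (l₁ l₂ : List Arrow) :
    (l₁ ++ l₂ ∈ ordLists A ∧ maxima l₂.toFinset = C) ↔
      l₁ ∈ ordLists (innerArrows A C (rootArrow N)) ∧ l₂ ∈ lowerLists A C := by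
  obtain ⟨hCD, hCB⟩ := mem_admissible.1 hC
  have hCA := (mem_dissections.1 hCD).1
  rw [mem_lowerLists, mem_ordLists, mem_ordLists, mem_ordLists, List.pairwise_append]
  constructor
  · rintro ⟨⟨h1, h2, h3, h4⟩, rfl⟩
    have hs : ∀ c ∈ maxima l₂.toFinset, c ∈ l₂ := fun c hc =>
      List.mem_toFinset.1 (Finset.mem_filter.1 hc).1
    refine ⟨⟨fun a ha => ?_, h2⟩, ⟨fun a ha => h1 a (by simp [ha]), h3⟩,
      Finset.filter_subset _ _, fun a ha => exists_le_maxima (List.mem_toFinset.2 ha)⟩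
    have haA := h1 a (by simp [ha])
    exact Finset.mem_filter.2 ⟨haA, (mem_arrows_iff.1 (hA haA)).2.1, below_of_mem_arrows (hA haA),
      fun c hc => (h4 a ha c (hs c hc)).2.1,
      fun c hc _ => ⟨(h4 a ha c (hs c hc)).1, (h4 a ha c (hs c hc)).2.2⟩⟩
  · rintro ⟨⟨h1, h2⟩, ⟨h3, h4⟩, h5, h6⟩
    refine ⟨⟨fun a ha => ?_, h2, h4, fun a ha b hb => ?_⟩, ?_⟩
    · rcases List.mem_append.1 ha with ha | ha
      · exact (Finset.mem_filter.1 (h1 a ha)).1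
      · exact h3 a ha
    · obtain ⟨c, hc, hbc⟩ := h6 b hb
      obtain ⟨_, _, _, h7, h8⟩ := Finset.mem_filter.1 (h1 a ha)
      have h9 := h8 c hc (below_of_mem_arrows (hA (hCA hc)))
      exact MayPrecede.of_le ⟨h9.1, h7 c hc, h9.2⟩ hbc
    · ext x
      rw [maxima, Finset.mem_filter, List.mem_toFinset]
      constructor
      · rintro ⟨hx, hmax⟩
        obtain ⟨c, hc, hxc⟩ := h6 x hx
        rcases hxc with rfl | hxc
        · exact hc
        · exact absurd hxc (hmax c (h5 hc))
      · intro hx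
        refine ⟨List.mem_toFinset.1 (h5 hx), fun b hb hxb => ?_⟩
        obtain ⟨c, hc, hbc⟩ := h6 b (List.mem_toFinset.1 hb)
        rcases hbc with rfl | hbc
        · exact hCB x hx b hc hxb
        · exact hCB x hx c hc (hxb.trans hbc)

/-- Splittings are sorted by the maximal arrows of the second half. These form an admissible
dissection, after which the two halves vary independently. -/
theorem sum_splits_ordLists {E : Type*} [AddCommMonoid E] {A : Finset Arrow} {N : ℕ}
    (hA : A ⊆ arrows N) (F : List Arrow → List Arrow → E) :
    ∑ p ∈ splits (ordLists A), F p.1 p.2 =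
      ∑ C ∈ admissible A, ∑ l₁ ∈ ordLists (innerArrows A C (rootArrow N)),
        ∑ l₂ ∈ lowerLists A C, F l₁ l₂ := by
  rw [← Finset.sum_fiberwise_of_maps_to (g := fun p => maxima p.2.toFinset) (t := admissible A)]
  · refine Finset.sum_congr rfl fun C hC => ?_
    rw [← Finset.sum_product']
    refine Finset.sum_congr ?_ fun _ _ => rfl
    ext p
    rw [Finset.mem_filter, mem_splits, Finset.mem_product, append_mem_ordLists_iff hA hC]
  · intro p hp
    rw [mem_splits, mem_ordLists, List.pairwise_append] at hp
    exact maxima_mem_admissible (toFinset_mem_dissections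
      (mem_ordLists.2 ⟨fun a ha => hp.1 a (by simp [ha]), hp.2.2.1⟩))

/-! ## The elements `B(π)` as sums over lists of arrows -/

theorem enhancedB_eq (π : EnhancedPolygon R S) : enhancedB π =
    ∑ l ∈ ordLists π.dissectingArrows, sgn l.toFinset •
      enhWord (π.rootRegion l.toFinset) (l.map (π.region l.toFinset)) := by
  rw [enhancedB, sum_dissections_orders _ fun D l =>
    sgn D • enhWord (π.rootRegion D) (l.map (π.region D))]

theorem polygonB_eq (π : Polygon R) : polygonB π =
    ∑ l ∈ ordLists π.dissectingArrows,
      Finsupp.single (π.rootRegion l.toFinset :: l.map (π.region l.toFinset)) (sgn l.toFinset) := by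
  rw [polygonB, sum_dissections_orders _ fun D l =>
    Finsupp.single (π.rootRegion D :: l.map (π.region D)) (sgn D)]

/-- The signed word of the regions under the arrows of a list. -/
def regionWord (π : EnhancedPolygon R S) (l : List Arrow) : Words R :=
  Finsupp.single (l.map (π.region l.toFinset)) (sgn l.toFinset)

theorem toFinset_map_eq_image (φ : Arrow → Arrow) (l : List Arrow) :
    (l.map φ).toFinset = l.toFinset.image φ := by
  ext x
  simp

theorem prod_image_of_arrowEquiv {A B D : Finset Arrow} {φ : Arrow → Arrow}
    (h : ArrowEquiv A B φ) (hD : D ⊆ A) (f : Arrow → ℚ) :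
    ∏ b ∈ D.image φ, f b = ∏ a ∈ D, f (φ a) :=
  Finset.prod_image fun a ha b hb => h.inj a (hD ha) b (hD hb)

theorem singleton_mem_dissections {A : Finset Arrow} {c : Arrow} (hc : c ∈ A) :
    {c} ∈ dissections A := by
  rw [mem_dissections]
  refine ⟨by simpa using hc, ?_⟩
  intro a ha b hb
  rw [Finset.mem_singleton] at ha hb
  subst ha hb
  exact fun h => lt_irrefl _ h.1

theorem innerArrows_singleton {A : Finset Arrow} {N : ℕ} (hA : A ⊆ arrows N) (c : Arrow) :
    innerArrows A {c} c = A.filter fun a => Below a c := by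
  refine Finset.filter_congr fun a ha => ⟨fun h => h.2.1, fun h =>
    ⟨(mem_arrows_iff.1 (hA ha)).2.1, h, fun d hd => ?_, fun d hd hdc => ?_⟩⟩
  · rw [Finset.mem_singleton] at hd
    subst hd
    have := h.2
    unfold Compatible Crosses
    omega
  · rw [Finset.mem_singleton] at hd
    exact absurd hd hdc.1

/-- A list under `c` is `c` followed by an ordered dissection of the region of `c`. The leading
letter `c` stands for the root region of that dissection, and `sgn {c}` turns the sign inside the
region into the sign in `π`. -/
theorem sgn_smul_polygonB (π : EnhancedPolygon R S) {c : Arrow} (hc : c ∈ π.dissectingArrows) :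
    sgn {c} • polygonB (π.region {c} c) =
      ∑ l ∈ lowerLists π.dissectingArrows {c}, regionWord π l := by
  obtain ⟨φ, hφ, h⟩ := exists_region_equiv π (singleton_mem_dissections hc)
    (Finset.mem_singleton_self c)
  rw [lowerLists_singleton hc, Finset.sum_image fun _ _ _ _ e => List.cons_injective e,
    ← innerArrows_singleton π.dissectingArrows_subset, ← hφ.sum_ordLists, polygonB_eq,
    Finset.smul_sum]
  refine Finset.sum_congr rfl fun l hl => ?_
  have hD := toFinset_mem_dissections hl
  obtain ⟨h1, h2, h3⟩ := h _ hD
  have hDA := (mem_dissections.1 hD).1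
  have e : (c :: l.map φ).toFinset = {c} ∪ l.toFinset.image φ := by
    rw [List.toFinset_cons, toFinset_map_eq_image]
    rfl
  have hnot : c ∉ l.toFinset.image φ := by
    intro hm
    obtain ⟨a, ha, hac⟩ := Finset.mem_image.1 hm
    have := hφ.maps a (hDA ha)
    rw [hac] at this
    exact (Finset.mem_filter.1 this).2.2.1.1 rfl
  rw [regionWord, e, Finsupp.smul_single, smul_eq_mul]
  congr 1
  · rw [List.map_cons, h1, List.map_map]
    congr 1
    exact List.map_congr_left fun a ha => h2 a (List.mem_toFinset.2 ha)
  · rw [sgn_eq_prod {c}, Finset.prod_singleton, h3, sgn_eq_prod ({c} ∪ _),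
      Finset.prod_union (Finset.disjoint_singleton_left.2 hnot), Finset.prod_singleton,
      prod_image_of_arrowEquiv hφ hDA]

/-- Arrows under `c` and under `C` do not affect each other's regions, so the words of regions
shuffle as the lists of arrows do, and the signs multiply. -/
theorem sum_regionWord_insert (π : EnhancedPolygon R S) {C : Finset Arrow} {c : Arrow}
    (hc : c ∉ C) (hC : insert c C ∈ admissible π.dissectingArrows) :
    ∑ l ∈ lowerLists π.dissectingArrows (insert c C), regionWord π l =
      shuffleBilin (∑ l ∈ lowerLists π.dissectingArrows {c}, regionWord π l)
        (∑ l ∈ lowerLists π.dissectingArrows C, regionWord π l) := by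
  have hdisj : ∀ l₁ ∈ lowerLists π.dissectingArrows {c}, ∀ l₂ ∈ lowerLists π.dissectingArrows C,
      ∀ a ∈ l₁, ∀ b ∈ l₂, hi a ≤ lo b ∨ hi b ≤ lo a := by
    intro l₁ hl₁ l₂ hl₂ a ha b hb
    obtain ⟨e, he, hac⟩ := (mem_lowerLists.1 hl₁).2.2 a ha
    obtain ⟨d, hd, hbd⟩ := (mem_lowerLists.1 hl₂).2.2 b hb
    rw [Finset.mem_singleton] at he
    subst he
    have h1 := disjoint_of_mem_admissible hC (Finset.mem_insert_self e C)
      (Finset.mem_insert_of_mem hd) (by rintro rfl; exact hc hd)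
    have h2 := le_bounds hac
    have h3 := le_bounds hbd
    have := lo_lt_hi a
    have := lo_lt_hi b
    omega
  rw [sum_shuffles (fun a => decide (a = c ∨ Below a c)) _ _ (mem_lowerLists_insert hc hC)]
  · simp only [map_sum, LinearMap.sum_apply]
    rw [Finset.sum_comm]
    refine Finset.sum_congr rfl fun l₂ hl₂ => Finset.sum_congr rfl fun l₁ hl₁ => ?_
    have hd := hdisj l₁ hl₁ l₂ hl₂
    have hD : Disjoint l₁.toFinset l₂.toFinset := by
      rw [Finset.disjoint_left]
      intro a ha hb
      have := hd a (List.mem_toFinset.1 ha) a (List.mem_toFinset.1 hb)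
      have := lo_lt_hi a
      omega
    have h1 : ∀ a ∈ l₁, armSet (l₁.toFinset ∪ l₂.toFinset) a = armSet l₁.toFinset a := by
      intro a ha
      refine armSet_union_left fun b hb hba => ?_
      have h2 := hd a ha b (List.mem_toFinset.1 hb)
      have := hba.2
      have := lo_lt_hi b
      omega
    have h2 : ∀ a ∈ l₂, armSet (l₁.toFinset ∪ l₂.toFinset) a = armSet l₂.toFinset a := by
      intro a ha
      rw [Finset.union_comm]
      refine armSet_union_left fun b hb hba => ?_
      have h2 := hd b (List.mem_toFinset.1 hb) a ha
      have := hba.2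
      have := lo_lt_hi b
      omega
    have hs : sgn (l₁.toFinset ∪ l₂.toFinset) = sgn l₁.toFinset * sgn l₂.toFinset := by
      rw [sgn_eq_prod, Finset.prod_union hD]
      congr 1
      · exact Finset.prod_congr rfl fun a ha => armSign_congr (h1 a (List.mem_toFinset.1 ha))
      · exact Finset.prod_congr rfl fun a ha => armSign_congr (h2 a (List.mem_toFinset.1 ha))
    have e1 : l₁.map (π.region l₁.toFinset) = l₁.map (π.region (l₁.toFinset ∪ l₂.toFinset)) :=
      List.map_congr_left fun a ha => (π.region_congr (h1 a ha)).symm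
    have e2 : l₂.map (π.region l₂.toFinset) = l₂.map (π.region (l₁.toFinset ∪ l₂.toFinset)) :=
      List.map_congr_left fun a ha => (π.region_congr (h2 a ha)).symm
    rw [regionWord, regionWord, shuffleBilin_single, e1, e2, shuffles_map, List.map_map]
    congr 1
    refine List.map_congr_left fun w hw => ?_
    rw [regionWord, toFinset_of_mem_shuffles hw, hs]
    rfl
  · intro l hl a ha
    obtain ⟨d, hd, hac⟩ := (mem_lowerLists.1 hl).2.2 a ha
    rw [Finset.mem_singleton] at hd
    subst hd
    exact decide_eq_true hac
  · intro l hl a ha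
    obtain ⟨d, hd, had⟩ := (mem_lowerLists.1 hl).2.2 a ha
    refine decide_eq_false fun hac => ?_
    have h1 := disjoint_of_mem_admissible hC (Finset.mem_insert_self c C)
      (Finset.mem_insert_of_mem hd) (by rintro rfl; exact hc hd)
    have h2 := le_bounds hac
    have h3 := le_bounds had
    have := lo_lt_hi a
    omega

theorem sgn_of_mem_admissible {A C : Finset Arrow} (hC : C ∈ admissible A) :
    sgn C = ∏ c ∈ C, sgn {c} := by
  rw [sgn_eq_prod]
  refine Finset.prod_congr rfl fun c hc => ?_
  rw [sgn_eq_prod, Finset.prod_singleton]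
  refine armSign_congr (armSet_congr (fun b hb hbc => ?_) (fun b hb hbc => ?_))
  · exact absurd hbc ((mem_admissible.1 hC).2 b hb c hc)
  · rw [Finset.mem_singleton] at hb
    exact absurd hb hbc.1

theorem region_of_mem_admissible (π : EnhancedPolygon R S) {A C : Finset Arrow}
    (hC : C ∈ admissible A) {c : Arrow} (hc : c ∈ C) : π.region C c = π.region {c} c := by
  refine π.region_congr (armSet_congr (fun b hb hbc => ?_) (fun b hb hbc => ?_))
  · exact absurd hbc ((mem_admissible.1 hC).2 b hb c hc)
  · rw [Finset.mem_singleton] at hb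
    exact absurd hb hbc.1

/-- This is the form of `sgn_smul_shuffleProd` suited to induction. The factors `f` are kept
abstract because the regions are taken in the full dissection while the list of arrows shrinks. -/
theorem prod_smul_foldr_shuffle (π : EnhancedPolygon R S) : ∀ cs : List Arrow, cs.Nodup →
    cs.toFinset ∈ admissible π.dissectingArrows → ∀ f : Arrow → Words R,
    (∀ c ∈ cs, f c = polygonB (π.region {c} c)) →
    (cs.map fun c => sgn {c}).prod •
        cs.foldr (fun α x => shuffle (f α) x) (Finsupp.single [] 1) =
      ∑ l ∈ lowerLists π.dissectingArrows cs.toFinset, regionWord π l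
  | [], _, _, _, _ => by
    rw [List.toFinset_nil, lowerLists_empty, Finset.sum_singleton]
    simp [regionWord, sgn]
  | c :: cs, hn, hC, f, hf => by
    obtain ⟨hc, hn⟩ := List.nodup_cons.1 hn
    rw [List.toFinset_cons] at hC ⊢
    have hcA := (mem_dissections.1 (mem_admissible.1 hC).1).1 (Finset.mem_insert_self _ _)
    rw [sum_regionWord_insert π (by simpa using hc) hC, ← sgn_smul_polygonB π hcA,
      ← prod_smul_foldr_shuffle π cs hn (subset_mem_admissible hC (Finset.subset_insert _ _)) f
        (fun d hd => hf d (by simp [hd])), List.foldr_cons, List.map_cons, List.prod_cons,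
      shuffle_eq, hf c (by simp), map_smul, map_smul, LinearMap.smul_apply, smul_smul, mul_comm]

theorem sgn_smul_shuffleProd (π : EnhancedPolygon R S) {C : Finset Arrow}
    (hC : C ∈ admissible π.dissectingArrows) :
    sgn C • shuffleProd C (fun α => polygonB (π.region C α)) =
      ∑ l ∈ lowerLists π.dissectingArrows C, regionWord π l := by
  have h := prod_smul_foldr_shuffle π C.toList C.nodup_toList (by rwa [Finset.toList_toFinset])
    (fun α => polygonB (π.region C α))
    (fun c hc => by rw [region_of_mem_admissible π hC (Finset.mem_toList.1 hc)])
  rw [Finset.toList_toFinset, Finset.prod_map_toList, ← sgn_of_mem_admissible hC] at h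
  exact h

/-! ## The coaction on `B(π̄)` -/

theorem deconcat_barWord (w : List (Polygon R)) : deconcat (barWord w) =
    ∑ i ∈ Finset.range (w.length + 1), barWord (w.take i) ⊗ₜ[ℚ] barWord (w.drop i) := by
  induction w with
  | nil =>
    rw [List.length_nil, zero_add, Finset.sum_range_one]
    simp only [barWord, List.map_nil, List.prod_nil, List.take_nil, List.drop_nil, deconcat]
    rw [tensorRec_one]
  | cons a w ih =>
    have e : ∀ v : List (Polygon R),
        barWord (a :: v) = TensorAlgebra.ι ℚ (augGen a) * barWord v := fun v => by
      simp [barWord]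
    have h : ∀ x : BarP R, deconcat (TensorAlgebra.ι ℚ (augGen a) * x) =
        1 ⊗ₜ[ℚ] (TensorAlgebra.ι ℚ (augGen a) * x) +
          (TensorAlgebra.ι ℚ (augGen a) ⊗ₜ[ℚ] 1) * deconcat x := fun x => by
      rw [deconcat, tensorRec_ι_mul]
      rfl
    rw [e, h, ih, List.length_cons, Finset.sum_range_succ' _ (w.length + 1), add_comm, Finset.mul_sum]
    congr 1
    · refine Finset.sum_congr rfl fun i _ => ?_
      rw [Algebra.TensorProduct.tmul_mul_tmul, one_mul, List.take_succ_cons, List.drop_succ_cons, e]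

theorem comoduleMap_enhWord (π : EnhancedPolygon R S) (w : List (Polygon R)) :
    comoduleMap (enhWord π w) = ∑ i ∈ Finset.range (w.length + 1),
      enhWord π (w.take i) ⊗ₜ[ℚ] barWord (w.drop i) := by
  rw [comoduleMap, enhWord, moduleDeconcat, LinearMap.comp_apply, LinearMap.lTensor_tmul,
    deconcat_barWord, TensorProduct.tmul_sum, map_sum]
  rfl

/-- The sign is a product over `l` alone, since the arrows of `C` contribute to the cut-off factors.
-/
theorem enhancedB_rootRegion (π : EnhancedPolygon R S) {C : Finset Arrow}
    (hC : C ∈ dissections π.dissectingArrows) : enhancedB (π.rootRegion C) =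
    ∑ l ∈ ordLists (innerArrows π.dissectingArrows C (rootArrow π.size)),
      (∏ a ∈ l.toFinset, armSign (C ∪ l.toFinset) a) •
        enhWord (π.rootRegion (C ∪ l.toFinset)) (l.map (π.region (C ∪ l.toFinset))) := by
  obtain ⟨φ, hφ, h⟩ := exists_rootRegion_equiv π hC
  rw [← hφ.sum_ordLists, enhancedB_eq]
  refine Finset.sum_congr rfl fun l hl => ?_
  have hD := toFinset_mem_dissections hl
  obtain ⟨h1, h2, h3⟩ := h _ hD
  rw [toFinset_map_eq_image, prod_image_of_arrowEquiv hφ (mem_dissections.1 hD).1, h1, h3,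
    List.map_map]
  congr 2
  exact List.map_congr_left fun a ha => h2 a (List.mem_toFinset.2 ha)

/-- Deconcatenation sums over all splittings of all lists, which are sorted by
`sum_splits_ordLists`. It remains to compare regions and signs for fixed halves: `l₁` sees only the
maximal arrows `C` of `l₂`, and `l₂` does not see `l₁` at all. -/
theorem comoduleMap_enhancedB (π : EnhancedPolygon R S) : comoduleMap (enhancedB π) =
    ∑ C ∈ admissible π.dissectingArrows, sgn C • (enhancedB (π.rootRegion C) ⊗ₜ[ℚ]
      toBar (shuffleProd C fun α => polygonB (π.region C α))) := by
  have h1 : comoduleMap (enhancedB π) = ∑ p ∈ splits (ordLists π.dissectingArrows),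
      sgn (p.1 ++ p.2).toFinset •
        (enhWord (π.rootRegion (p.1 ++ p.2).toFinset) (p.1.map (π.region (p.1 ++ p.2).toFinset)) ⊗ₜ[ℚ]
          barWord (p.2.map (π.region (p.1 ++ p.2).toFinset))) := by
    rw [sum_splits (ordLists π.dissectingArrows) fun l₁ l₂ => sgn (l₁ ++ l₂).toFinset •
        (enhWord (π.rootRegion (l₁ ++ l₂).toFinset) (l₁.map (π.region (l₁ ++ l₂).toFinset)) ⊗ₜ[ℚ]
          barWord (l₂.map (π.region (l₁ ++ l₂).toFinset))), enhancedB_eq, map_sum]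
    refine Finset.sum_congr rfl fun l _ => ?_
    rw [map_smul, comoduleMap_enhWord, Finset.smul_sum, List.length_map]
    refine Finset.sum_congr rfl fun i _ => ?_
    rw [List.take_append_drop, List.map_take, List.map_drop]
  rw [h1, sum_splits_ordLists π.dissectingArrows_subset fun l₁ l₂ => sgn (l₁ ++ l₂).toFinset •
        (enhWord (π.rootRegion (l₁ ++ l₂).toFinset) (l₁.map (π.region (l₁ ++ l₂).toFinset)) ⊗ₜ[ℚ]
          barWord (l₂.map (π.region (l₁ ++ l₂).toFinset)))]
  refine Finset.sum_congr rfl fun C hC => ?_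
  have hCD := (mem_admissible.1 hC).1
  have hCA := (mem_dissections.1 hCD).1
  rw [← TensorProduct.tmul_smul, ← map_smul, sgn_smul_shuffleProd π hC,
    enhancedB_rootRegion π hCD, map_sum, TensorProduct.sum_tmul]
  refine Finset.sum_congr rfl fun l₁ hl₁ => ?_
  rw [TensorProduct.tmul_sum]
  refine Finset.sum_congr rfl fun l₂ hl₂ => ?_
  have hin : ∀ a ∈ l₁, ∀ c ∈ C, MayPrecede a c := fun a ha c hc => by
    obtain ⟨_, _, _, h7, h8⟩ := Finset.mem_filter.1 ((mem_ordLists.1 hl₁).1 a ha)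
    have h9 := h8 c hc (below_of_mem_arrows (π.dissectingArrows_subset (hCA hc)))
    exact ⟨h9.1, h7 c hc, h9.2⟩
  obtain ⟨hl₂1, hl₂2, hl₂3⟩ := mem_lowerLists.1 hl₂
  have hlow : ∀ a ∈ l₁, ∀ b ∈ l₂, MayPrecede a b := fun a ha b hb => by
    obtain ⟨c, hc, hbc⟩ := hl₂3 b hb
    exact (hin a ha c hc).of_le hbc
  have hE : (l₁ ++ l₂).toFinset = l₁.toFinset ∪ l₂.toFinset := List.toFinset_append
  have hD : Disjoint l₁.toFinset l₂.toFinset := by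
    rw [Finset.disjoint_left]
    intro a ha hb
    exact (hlow a (List.mem_toFinset.1 ha) a (List.mem_toFinset.1 hb)).1 rfl
  -- Replacing `l₂` by its maximal arrows leaves the region of `α` unchanged, provided that `α`
  -- contains an arrow of `C` whenever it contains something under it.
  have hup : ∀ α : Arrow, (∀ c ∈ C, ∀ b, (b = c ∨ Below b c) → Below b α → Below c α) →
      armSet (l₁.toFinset ∪ l₂.toFinset) α = armSet (C ∪ l₁.toFinset) α := by
    intro α hα
    apply armSet_congr
    · intro b hb hbα
      rcases Finset.mem_union.1 hb with hb | hb
      · exact ⟨b, Finset.mem_union_right _ hb, hbα, le_rfl, le_rfl⟩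
      · obtain ⟨c, hc, hbc⟩ := hl₂3 b (List.mem_toFinset.1 hb)
        exact ⟨c, Finset.mem_union_left _ hc, hα c hc b hbc hbα, le_bounds hbc⟩
    · intro b hb hbα
      refine ⟨b, ?_, hbα, le_rfl, le_rfl⟩
      rcases Finset.mem_union.1 hb with hb | hb
      · exact Finset.mem_union_right _ (hl₂2 hb)
      · exact Finset.mem_union_left _ hb
  have hroot := hup (rootArrow π.size) fun c hc _ _ _ =>
    below_of_mem_arrows (π.dissectingArrows_subset (hCA hc))
  have h₁ : ∀ a ∈ l₁, armSet (l₁.toFinset ∪ l₂.toFinset) a = armSet (C ∪ l₁.toFinset) a := by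
    intro a ha
    refine hup a fun c hc b hbc hba => ?_
    obtain ⟨h2, h3, h4⟩ := hin a ha c hc
    have h5 := le_bounds hbc
    have h6 := hba.2
    have h7 := lo_lt_hi b
    have h8 : ¬ (lo c ≤ lo a ∧ hi a ≤ hi c) := fun h => h4 ⟨h2, h⟩
    unfold Compatible Crosses at h3
    exact ⟨h2.symm, by omega, by omega⟩
  -- Arrows of `l₁` come earlier in a compatible list, so none of them is below an arrow of `l₂`.
  have h₂ : ∀ b ∈ l₂, armSet (l₁.toFinset ∪ l₂.toFinset) b = armSet l₂.toFinset b := by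
    intro b hb
    rw [Finset.union_comm]
    exact armSet_union_left fun a ha => (hlow a (List.mem_toFinset.1 ha) b hb).2.2
  have hs : sgn (l₁.toFinset ∪ l₂.toFinset) =
      sgn l₂.toFinset * ∏ a ∈ l₁.toFinset, armSign (C ∪ l₁.toFinset) a := by
    rw [sgn_eq_prod, Finset.prod_union hD, mul_comm, sgn_eq_prod]
    congr 1
    · exact Finset.prod_congr rfl fun a ha => armSign_congr (h₂ a (List.mem_toFinset.1 ha))
    · exact Finset.prod_congr rfl fun a ha => armSign_congr (h₁ a (List.mem_toFinset.1 ha))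
  have e1 : l₁.map (π.region (l₁.toFinset ∪ l₂.toFinset)) =
      l₁.map (π.region (C ∪ l₁.toFinset)) :=
    List.map_congr_left fun a ha => π.region_congr (h₁ a ha)
  have e2 : l₂.map (π.region (l₁.toFinset ∪ l₂.toFinset)) = l₂.map (π.region l₂.toFinset) :=
    List.map_congr_left fun a ha => π.region_congr (h₂ a ha)
  rw [hE, e1, e2, hs, π.rootRegion_congr hroot, regionWord, toBar,
    Finsupp.linearCombination_single, TensorProduct.tmul_smul, mul_smul,
    TensorProduct.smul_tmul']

/-! ## Two-step admissible dissections -/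

/-- The arrows which lie below one of the arrows of `C`. -/
def lowerArrows (A C : Finset Arrow) : Finset Arrow := A.filter fun b => ∃ c ∈ C, Below b c

theorem mem_lowerArrows {A C : Finset Arrow} {b : Arrow} :
    b ∈ lowerArrows A C ↔ b ∈ A ∧ ∃ c ∈ C, Below b c := by
  rw [lowerArrows, Finset.mem_filter]

theorem admissible_subset {A D : Finset Arrow} (hD : D ∈ admissible A) : D ⊆ A :=
  (mem_dissections.1 (mem_admissible.1 hD).1).1

theorem mem_admissible_iff {A D : Finset Arrow} : D ∈ admissible A ↔
    D ⊆ A ∧ ∀ a ∈ D, ∀ b ∈ D, a ≠ b → hi a ≤ lo b ∨ hi b ≤ lo a := by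
  refine ⟨fun h => ⟨admissible_subset h, fun a ha b hb => disjoint_of_mem_admissible h ha hb⟩,
    fun h => mem_admissible.2 ⟨mem_dissections.2 ⟨h.1, fun a ha b hb => ?_⟩, fun a ha b hb hab => ?_⟩⟩
  · by_cases hab : a = b
    · subst hab
      exact fun h => lt_irrefl _ h.1
    · exact (mayPrecede_of_disjoint (h.2 a ha b hb hab)).2.1.1
  · exact (mayPrecede_of_disjoint (h.2 a ha b hb hab.1)).2.2 hab

theorem empty_mem_admissible (A : Finset Arrow) : ∅ ∈ admissible A :=
  mem_admissible_iff.2 ⟨by simp, by simp⟩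

section

variable {T : Type*} [CommSemiring T] {A : Finset Arrow}

/-- Choosing an admissible dissection under each `α ∈ C` is the same as choosing one under all of
`C`, because the members of `C` are disjoint. The `α`-component is recovered as the part below `α`.
-/
theorem prod_sum_admissible (X : Arrow → T) (Y : Arrow → Finset Arrow → T) {C : Finset Arrow}
    (hC : C ∈ admissible A) :
    ∏ α ∈ C, ∑ E ∈ admissible (lowerArrows A {α}), Y α E * ∏ b ∈ E, X b =
      ∑ U ∈ admissible (lowerArrows A C),
        (∏ α ∈ C, Y α (U.filter fun b => Below b α)) * ∏ b ∈ U, X b := by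
  induction C using Finset.induction_on with
  | empty =>
    have e : admissible (lowerArrows A ∅) = {∅} := by
      ext U
      rw [Finset.mem_singleton, mem_admissible_iff]
      constructor
      · rintro ⟨h, _⟩
        rw [Finset.eq_empty_iff_forall_notMem]
        intro u hu
        obtain ⟨_, c, hc, _⟩ := mem_lowerArrows.1 (h hu)
        simp at hc
      · rintro rfl
        simp
    rw [e]
    simp
  | insert c C hc ih =>
    rw [Finset.prod_insert hc, ih (subset_mem_admissible hC (Finset.subset_insert _ _)),
      Finset.sum_mul_sum, ← Finset.sum_product']
    have hdisj : ∀ d ∈ C, hi c ≤ lo d ∨ hi d ≤ lo c := fun d hd =>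
      disjoint_of_mem_admissible hC (Finset.mem_insert_self _ _) (Finset.mem_insert_of_mem hd)
        (by rintro rfl; exact hc hd)
    have hlow : ∀ a b, Below a c → (∃ d ∈ C, Below b d) → hi a ≤ lo b ∨ hi b ≤ lo a := by
      rintro a b ha ⟨d, hd, hb⟩
      have := hdisj d hd
      have := ha.2
      have := hb.2
      omega
    have memE : ∀ {E}, E ∈ admissible (lowerArrows A {c}) → ∀ a ∈ E, a ∈ A ∧ Below a c := by
      intro E hE a ha
      obtain ⟨h1, d, hd, h2⟩ := mem_lowerArrows.1 (admissible_subset hE ha)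
      rw [Finset.mem_singleton] at hd
      exact ⟨h1, hd ▸ h2⟩
    have memU : ∀ {U}, U ∈ admissible (lowerArrows A C) → ∀ b ∈ U, b ∈ A ∧ ∃ d ∈ C, Below b d :=
      fun hU b hb => mem_lowerArrows.1 (admissible_subset hU hb)
    have excl : ∀ b, Below b c → ¬ ∃ d ∈ C, Below b d := by
      intro b h1 h2
      have := hlow b b h1 h2
      have := lo_lt_hi b
      omega
    have fE : ∀ {E U}, E ∈ admissible (lowerArrows A {c}) → U ∈ admissible (lowerArrows A C) →
        (E ∪ U).filter (fun b => Below b c) = E := by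
      intro E U hE hU
      ext b
      rw [Finset.mem_filter, Finset.mem_union]
      constructor
      · rintro ⟨hb | hb, hbc⟩
        · exact hb
        · exact absurd (memU hU b hb).2 (excl b hbc)
      · exact fun hb => ⟨Or.inl hb, (memE hE b hb).2⟩
    have fU : ∀ {E U}, E ∈ admissible (lowerArrows A {c}) → U ∈ admissible (lowerArrows A C) →
        (E ∪ U).filter (fun b => ∃ d ∈ C, Below b d) = U := by
      intro E U hE hU
      ext b
      rw [Finset.mem_filter, Finset.mem_union]
      constructor
      · rintro ⟨hb | hb, hbc⟩
        · exact absurd hbc (excl b (memE hE b hb).2)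
        · exact hb
      · exact fun hb => ⟨Or.inr hb, (memU hU b hb).2⟩
    refine Finset.sum_bij' (fun q _ => q.1 ∪ q.2)
      (fun U _ => (U.filter (fun b => Below b c), U.filter (fun b => ∃ d ∈ C, Below b d)))
      ?_ ?_ ?_ ?_ ?_
    · rintro ⟨E, U⟩ hq
      obtain ⟨hE, hU⟩ := Finset.mem_product.1 hq
      simp only at hE hU ⊢
      refine mem_admissible_iff.2 ⟨fun b hb => ?_, fun a ha b hb hab => ?_⟩
      · rcases Finset.mem_union.1 hb with hb | hb
        · exact mem_lowerArrows.2 ⟨(memE hE b hb).1, c, by simp, (memE hE b hb).2⟩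
        · obtain ⟨h1, d, hd, h2⟩ := memU hU b hb
          exact mem_lowerArrows.2 ⟨h1, d, by simp [hd], h2⟩
      · rcases Finset.mem_union.1 ha with ha | ha <;> rcases Finset.mem_union.1 hb with hb | hb
        · exact disjoint_of_mem_admissible hE ha hb hab
        · exact hlow a b (memE hE a ha).2 (memU hU b hb).2
        · exact (hlow b a (memE hE b hb).2 (memU hU a ha).2).symm
        · exact disjoint_of_mem_admissible hU ha hb hab
    · intro U hU
      have h1 := mem_admissible_iff.1 hU
      refine Finset.mem_product.2 ⟨mem_admissible_iff.2 ⟨fun b hb => ?_, fun a ha b hb hab => ?_⟩,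
        mem_admissible_iff.2 ⟨fun b hb => ?_, fun a ha b hb hab => ?_⟩⟩
      · obtain ⟨hb, hbc⟩ := Finset.mem_filter.1 hb
        exact mem_lowerArrows.2 ⟨(mem_lowerArrows.1 (h1.1 hb)).1, c, by simp, hbc⟩
      · exact h1.2 a (Finset.mem_filter.1 ha).1 b (Finset.mem_filter.1 hb).1 hab
      · obtain ⟨hb, hbc⟩ := Finset.mem_filter.1 hb
        exact mem_lowerArrows.2 ⟨(mem_lowerArrows.1 (h1.1 hb)).1, hbc⟩
      · exact h1.2 a (Finset.mem_filter.1 ha).1 b (Finset.mem_filter.1 hb).1 hab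
    · rintro ⟨E, U⟩ hq
      obtain ⟨hE, hU⟩ := Finset.mem_product.1 hq
      exact Prod.ext (fE hE hU) (fU hE hU)
    · intro U hU
      ext b
      simp only [Finset.mem_union, Finset.mem_filter]
      constructor
      · rintro (h | h) <;> exact h.1
      · intro hb
        obtain ⟨_, d, hd, h2⟩ := mem_lowerArrows.1 (admissible_subset hU hb)
        rcases Finset.mem_insert.1 hd with rfl | hd
        · exact Or.inl ⟨hb, h2⟩
        · exact Or.inr ⟨hb, d, hd, h2⟩
    · rintro ⟨E, U⟩ hq
      obtain ⟨hE, hU⟩ := Finset.mem_product.1 hq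
      simp only at hE hU ⊢
      have hd : Disjoint E U := by
        rw [Finset.disjoint_left]
        exact fun b hb hb' => excl b (memE hE b hb).2 (memU hU b hb').2
      rw [Finset.prod_insert hc, fE hE hU, Finset.prod_union hd]
      -- The part `E` lies under `c`, hence under no other member of the cut.
      have e : ∏ α ∈ C, Y α ((E ∪ U).filter fun b => Below b α) =
          ∏ α ∈ C, Y α (U.filter fun b => Below b α) := by
        refine Finset.prod_congr rfl fun α hα => ?_
        congr 1
        ext b
        simp only [Finset.mem_filter, Finset.mem_union]
        refine and_congr_left fun hbα => or_iff_right fun hb => ?_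
        exact excl b (memE hE b hb).2 ⟨α, hα, hbα⟩
      rw [e]
      ring

/-- This is the combinatorics of coassociativity, freed of tensors and signs. In the product over
`D` on the left, the summand `X α` passes the piece of `α` on whole, while the inner sum cuts it
along `E`. On the right, `C` collects the arrows whose pieces end up in the last factor, and `D`
consists of the arrows that were cut. -/
theorem sum_two_step {M : Type*} [AddCommMonoid M] {N : ℕ} (hA : A ⊆ arrows N) (X : Arrow → T)
    (Y : Arrow → Finset Arrow → T) (G : Finset Arrow → T →+ M) :
    ∑ D ∈ admissible A, G D (∏ α ∈ D,
        (∑ E ∈ admissible (lowerArrows A {α}), Y α E * ∏ b ∈ E, X b + X α)) =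
      ∑ C ∈ admissible A, ∑ D ∈ admissible (innerArrows A C (rootArrow N)),
        G (maxima (C ∪ D)) ((∏ α ∈ D, Y α (C.filter fun b => Below b α)) * ∏ c ∈ C, X c) := by
  have h1 : ∀ D ∈ admissible A, G D (∏ α ∈ D,
        (∑ E ∈ admissible (lowerArrows A {α}), Y α E * ∏ b ∈ E, X b + X α)) =
      ∑ q ∈ D.powerset.sigma fun C' => admissible (lowerArrows A C'),
        G D ((∏ α ∈ q.1, Y α (q.2.filter fun b => Below b α)) * (∏ b ∈ q.2, X b) *
          ∏ b ∈ D \ q.1, X b) := by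
    intro D hD
    -- Expanding the product chooses the subset `C'` of arrows whose pieces are cut.
    rw [Finset.prod_add, map_sum, Finset.sum_sigma]
    refine Finset.sum_congr rfl fun C' hC' => ?_
    rw [prod_sum_admissible X Y (subset_mem_admissible hD (Finset.mem_powerset.1 hC')),
      Finset.sum_mul, map_sum]
  rw [Finset.sum_congr rfl h1, Finset.sum_sigma', Finset.sum_sigma']
  have inner : ∀ {C D : Finset Arrow}, D ∈ admissible (innerArrows A C (rootArrow N)) →
      C ∈ admissible A → ∀ a ∈ D, a ∈ A ∧ ∀ c ∈ C, MayPrecede a c := by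
    intro C D hD hC a ha
    obtain ⟨h2, _, _, h3, h4⟩ := Finset.mem_filter.1 (admissible_subset hD ha)
    refine ⟨h2, fun c hc => ?_⟩
    have h5 := h4 c hc (below_of_mem_arrows (hA (admissible_subset hC hc)))
    exact ⟨h5.1, h3 c hc, h5.2⟩
  symm
  -- From `(C, D)`: the first cut is the set of maximal arrows of `C ∪ D`, its pieces under `D` are
  -- cut further, and the arrows used for this are those of `C` below `D`. Backwards, `C` consists
  -- of the arrows passed on whole and of the arrows of the second cut.
  refine Finset.sum_bij'
    (fun q _ => ⟨maxima (q.1 ∪ q.2), ⟨q.2, q.1.filter fun b => ∃ α ∈ q.2, Below b α⟩⟩)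
    (fun r _ => ⟨(r.1 \ r.2.1) ∪ r.2.2, r.2.1⟩) ?_ ?_ ?_ ?_ ?_
  · rintro ⟨C, D⟩ hq
    obtain ⟨hC, hD⟩ := Finset.mem_sigma.1 hq
    simp only at hC hD ⊢
    have hin := inner hD hC
    have hC' := mem_admissible.1 hC
    have hD' := mem_admissible.1 hD
    refine Finset.mem_sigma.2 ⟨maxima_mem_admissible (mem_dissections.2 ⟨Finset.union_subset
      (admissible_subset hC) fun a ha => (hin a ha).1, ?_⟩), Finset.mem_sigma.2
      ⟨Finset.mem_powerset.2 fun a ha => ?_, mem_admissible_iff.2 ⟨fun b hb => ?_, ?_⟩⟩⟩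
    · intro a ha b hb
      rcases Finset.mem_union.1 ha with ha | ha <;> rcases Finset.mem_union.1 hb with hb | hb
      · exact (mem_dissections.1 hC'.1).2 a ha b hb
      · exact ((hin b hb).2 a ha).2.1.2
      · exact ((hin a ha).2 b hb).2.1.1
      · exact (mem_dissections.1 hD'.1).2 a ha b hb
    · refine Finset.mem_filter.2 ⟨Finset.mem_union_right _ ha, fun b hb => ?_⟩
      rcases Finset.mem_union.1 hb with hb | hb
      · exact ((hin a ha).2 b hb).2.2
      · exact hD'.2 a ha b hb
    · obtain ⟨hb, hb'⟩ := Finset.mem_filter.1 hb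
      exact mem_lowerArrows.2 ⟨admissible_subset hC hb, hb'⟩
    · intro a ha b hb
      exact disjoint_of_mem_admissible hC (Finset.mem_filter.1 ha).1 (Finset.mem_filter.1 hb).1
  · rintro ⟨D, C', U⟩ hr
    obtain ⟨hD, hr⟩ := Finset.mem_sigma.1 hr
    obtain ⟨hC', hU⟩ := Finset.mem_sigma.1 hr
    simp only [Finset.mem_powerset] at hD hC' hU ⊢
    have hUl : ∀ u ∈ U, u ∈ A ∧ ∃ α ∈ C', Below u α := fun u hu =>
      mem_lowerArrows.1 (admissible_subset hU hu)
    have hDU : ∀ d ∈ D, ∀ u ∈ U, ¬ Below u d → hi d ≤ lo u ∨ hi u ≤ lo d := by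
      intro d hd u hu hdu
      obtain ⟨_, α, hα, huα⟩ := hUl u hu
      have := disjoint_of_mem_admissible hD hd (hC' hα) (by rintro rfl; exact hdu huα)
      have := huα.2
      omega
    have hCA : D \ C' ∪ U ∈ admissible A := by
      refine mem_admissible_iff.2 ⟨fun a ha => ?_, fun a ha b hb hab => ?_⟩
      · rcases Finset.mem_union.1 ha with ha | ha
        · exact admissible_subset hD (Finset.mem_sdiff.1 ha).1
        · exact (hUl a ha).1
      · have key : ∀ d ∈ D \ C', ∀ u ∈ U, hi d ≤ lo u ∨ hi u ≤ lo d := by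
          intro d hd u hu
          obtain ⟨hd1, hd2⟩ := Finset.mem_sdiff.1 hd
          refine hDU d hd1 u hu fun hud => ?_
          obtain ⟨_, α, hα, huα⟩ := hUl u hu
          have := disjoint_of_mem_admissible hD hd1 (hC' hα) (by rintro rfl; exact hd2 hα)
          have := huα.2
          have := hud.2
          have := lo_lt_hi u
          omega
        rcases Finset.mem_union.1 ha with ha | ha <;> rcases Finset.mem_union.1 hb with hb | hb
        · exact disjoint_of_mem_admissible hD (Finset.mem_sdiff.1 ha).1 (Finset.mem_sdiff.1 hb).1 hab
        · exact key a ha b hb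
        · exact (key b hb a ha).symm
        · exact disjoint_of_mem_admissible hU ha hb hab
    refine Finset.mem_sigma.2 ⟨hCA, mem_admissible_iff.2 ⟨fun a ha => ?_, fun a ha b hb =>
      disjoint_of_mem_admissible hD (hC' ha) (hC' hb)⟩⟩
    have haA := admissible_subset hD (hC' ha)
    have hmp : ∀ c ∈ D \ C' ∪ U, MayPrecede a c := by
      intro c hc
      rcases Finset.mem_union.1 hc with hc | hc
      · obtain ⟨hc1, hc2⟩ := Finset.mem_sdiff.1 hc
        exact mayPrecede_of_disjoint (disjoint_of_mem_admissible hD (hC' ha) hc1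
          (by rintro rfl; exact hc2 ha))
      · by_cases hca : Below c a
        · refine ⟨hca.1.symm, ?_, hca.asymm⟩
          have := hca.2
          unfold Compatible Crosses
          omega
        · exact mayPrecede_of_disjoint (hDU a (hC' ha) c hc hca)
    exact Finset.mem_filter.2 ⟨haA, (mem_arrows_iff.1 (hA haA)).2.1, below_of_mem_arrows (hA haA),
      fun c hc => (hmp c hc).2.1, fun c hc _ => ⟨(hmp c hc).1, (hmp c hc).2.2⟩⟩
  · rintro ⟨C, D⟩ hq
    obtain ⟨hC, hD⟩ := Finset.mem_sigma.1 hq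
    simp only at hC hD ⊢
    have hin := inner hD hC
    have e : maxima (C ∪ D) \ D ∪ C.filter (fun b => ∃ α ∈ D, Below b α) = C := by
      ext x
      simp only [Finset.mem_union, Finset.mem_sdiff, Finset.mem_filter, maxima]
      constructor
      · rintro (⟨⟨h2 | h2, _⟩, h3⟩ | h2)
        · exact h2
        · exact absurd h2 h3
        · exact h2.1
      · intro hx
        by_cases hxD : ∃ α ∈ D, Below x α
        · exact Or.inr ⟨hx, hxD⟩
        · refine Or.inl ⟨⟨Or.inl hx, ?_⟩, fun hx' => ((hin x hx').2 x hx).1 rfl⟩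
          rintro b (hb | hb) hxb
          · exact (mem_admissible.1 hC).2 x hx b hb hxb
          · exact hxD ⟨b, hb, hxb⟩
    rw [e]
  · rintro ⟨D, C', U⟩ hr
    obtain ⟨hD, hr⟩ := Finset.mem_sigma.1 hr
    obtain ⟨hC', hU⟩ := Finset.mem_sigma.1 hr
    simp only [Finset.mem_powerset] at hD hC' hU ⊢
    have hUl : ∀ u ∈ U, u ∈ A ∧ ∃ α ∈ C', Below u α := fun u hu =>
      mem_lowerArrows.1 (admissible_subset hU hu)
    have hDB := (mem_admissible.1 hD).2
    have e1 : maxima (D \ C' ∪ U ∪ C') = D := by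
      ext x
      simp only [Finset.mem_union, Finset.mem_sdiff, Finset.mem_filter, maxima]
      constructor
      · rintro ⟨(h2 | h2) | h2, h3⟩
        · exact h2.1
        · obtain ⟨_, α, hα, hxα⟩ := hUl x h2
          exact absurd hxα (h3 α (Or.inr hα))
        · exact hC' h2
      · intro hx
        refine ⟨?_, ?_⟩
        · by_cases hx' : x ∈ C'
          · exact Or.inr hx'
          · exact Or.inl (Or.inl ⟨hx, hx'⟩)
        · rintro b ((hb | hb) | hb) hxb
          · exact hDB x hx b hb.1 hxb
          · obtain ⟨_, α, hα, hbα⟩ := hUl b hb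
            exact hDB x hx α (hC' hα) (hxb.trans hbα)
          · exact hDB x hx b (hC' hb) hxb
    have e2 : (D \ C' ∪ U).filter (fun b => ∃ α ∈ C', Below b α) = U := by
      ext x
      simp only [Finset.mem_union, Finset.mem_sdiff, Finset.mem_filter]
      constructor
      · rintro ⟨h2 | h2, α, hα, hxα⟩
        · exact absurd hxα (hDB x h2.1 α (hC' hα))
        · exact h2
      · exact fun hx => ⟨Or.inr hx, (hUl x hx).2⟩
    rw [e1, e2]
  · rintro ⟨C, D⟩ hq
    obtain ⟨hC, hD⟩ := Finset.mem_sigma.1 hq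
    simp only at hC hD ⊢
    have hin := inner hD hC
    have e1 : ∀ α ∈ D, (C.filter fun b => ∃ α ∈ D, Below b α).filter (fun b => Below b α) =
        C.filter fun b => Below b α := by
      intro α hα
      ext b
      simp only [Finset.mem_filter]
      exact ⟨fun h => ⟨h.1.1, h.2⟩, fun h => ⟨⟨h.1, α, hα, h.2⟩, h.2⟩⟩
    have e2 : maxima (C ∪ D) \ D = C.filter fun b => ¬ ∃ α ∈ D, Below b α := by
      ext x
      simp only [Finset.mem_union, Finset.mem_sdiff, Finset.mem_filter, maxima]
      constructor
      · rintro ⟨⟨h2, h3⟩, h4⟩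
        exact ⟨h2.resolve_right h4, fun ⟨α, hα, hxα⟩ => h3 α (Or.inr hα) hxα⟩
      · rintro ⟨hx, hxD⟩
        refine ⟨⟨Or.inl hx, ?_⟩, fun hx' => ((hin x hx').2 x hx).1 rfl⟩
        rintro b (hb | hb) hxb
        · exact (mem_admissible.1 hC).2 x hx b hb hxb
        · exact hxD ⟨b, hb, hxb⟩
    have e3 : ∏ α ∈ D, Y α ((C.filter fun b => ∃ α ∈ D, Below b α).filter fun b => Below b α) =
        ∏ α ∈ D, Y α (C.filter fun b => Below b α) :=
      Finset.prod_congr rfl fun α hα => by rw [e1 α hα]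
    rw [e2, e3, mul_assoc, Finset.prod_filter_mul_prod_filter_not]

end

/-! ## The comodule over the symmetric algebra -/

theorem ckCoaction_single (π : EnhancedPolygon R S) : ckCoaction (Finsupp.single π 1) =
    ∑ D ∈ admissible π.dissectingArrows, sgn D • (Finsupp.single (π.rootRegion D) (1 : ℚ) ⊗ₜ[ℚ]
      ∏ α ∈ D, (MvPolynomial.X (π.region D α) : SymV R)) := by
  rw [ckCoaction, Finsupp.linearCombination_single, one_smul]

/-- The signed variable of a region. -/
def armVar (π : EnhancedPolygon R S) (D : Finset Arrow) (α : Arrow) : SymV R :=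
  armSign D α • MvPolynomial.X (π.region D α)

theorem armVar_congr (π : EnhancedPolygon R S) {D E : Finset Arrow} {α : Arrow}
    (h : armSet D α = armSet E α) : armVar π D α = armVar π E α := by
  rw [armVar, armVar, armSign_congr h, π.region_congr h]

theorem prod_armVar (π : EnhancedPolygon R S) (C D : Finset Arrow) :
    ∏ α ∈ C, armVar π D α =
      (∏ α ∈ C, armSign D α) • ∏ α ∈ C, (MvPolynomial.X (π.region D α) : SymV R) := by
  simp only [armVar]
  rw [Finset.prod_smul]

theorem armSet_of_not_below {D : Finset Arrow} {α : Arrow} (h : ∀ b ∈ D, ¬ Below b α) :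
    armSet D α = armSet ∅ α :=
  armSet_congr (fun b hb hbα => absurd hbα (h b hb)) (fun b hb => by simp at hb)

/-- In an admissible dissection no arrow is below another, so a cut-off region and its sign do not
depend on the remaining arrows. -/
theorem ckCoaction_single_eq (π : EnhancedPolygon R S) : ckCoaction (Finsupp.single π 1) =
    ∑ D ∈ admissible π.dissectingArrows, Finsupp.single (π.rootRegion D) (1 : ℚ) ⊗ₜ[ℚ]
      ∏ α ∈ D, armVar π ∅ α := by
  rw [ckCoaction_single]
  refine Finset.sum_congr rfl fun D hD => ?_
  rw [sgn_eq_prod, ← TensorProduct.tmul_smul, ← prod_armVar]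
  congr 1
  exact Finset.prod_congr rfl fun α hα =>
    armVar_congr π (armSet_of_not_below fun b hb => (mem_admissible.1 hD).2 b hb α hα)

theorem ckCoaction_rootRegion (π : EnhancedPolygon R S) {C : Finset Arrow}
    (hC : C ∈ dissections π.dissectingArrows) :
    ckCoaction (Finsupp.single (π.rootRegion C) 1) =
      ∑ D ∈ admissible (innerArrows π.dissectingArrows C (rootArrow π.size)),
        Finsupp.single (π.rootRegion (C ∪ D)) (1 : ℚ) ⊗ₜ[ℚ] ∏ α ∈ D, armVar π (C ∪ D) α := by
  obtain ⟨φ, hφ, h⟩ := exists_rootRegion_equiv π hC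
  rw [← hφ.sum_admissible, ckCoaction_single]
  refine Finset.sum_congr rfl fun D hD => ?_
  obtain ⟨h1, h2, h3⟩ := h D (mem_admissible.1 hD).1
  have hinj : ∀ a ∈ D, ∀ b ∈ D, φ a = φ b → a = b := fun a ha b hb =>
    hφ.inj a (admissible_subset hD ha) b (admissible_subset hD hb)
  have hp : ∏ α ∈ D, (MvPolynomial.X ((π.rootRegion C).region D α) : SymV R) =
      ∏ α ∈ D, MvPolynomial.X (π.region (C ∪ D.image φ) (φ α)) :=
    Finset.prod_congr rfl fun b hb => by rw [h2 b hb]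
  rw [h1, h3, prod_armVar, Finset.prod_image hinj, Finset.prod_image hinj,
    TensorProduct.tmul_smul, hp]

/-- The sign is built into the variable so that the coproduct acquires the shape of a factor in
`sum_two_step`; `exists_region_equiv` for `{c}` supplies the compatibility of signs. -/
theorem ckCoproduct_armVar (π : EnhancedPolygon R S) {c : Arrow} (hc : c ∈ π.dissectingArrows) :
    ckCoproduct (armVar π ∅ c) =
      ∑ E ∈ admissible (lowerArrows π.dissectingArrows {c}),
        (armVar π E c ⊗ₜ[ℚ] (1 : SymV R)) * ∏ b ∈ E, ((1 : SymV R) ⊗ₜ[ℚ] armVar π ∅ b) +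
      (1 : SymV R) ⊗ₜ[ℚ] armVar π ∅ c := by
  obtain ⟨φ, hφ, h⟩ := exists_region_equiv π (singleton_mem_dissections hc)
    (Finset.mem_singleton_self c)
  -- An arrow is not below itself, so adding `c` to the dissection does not change its own region.
  have hself : ∀ E : Finset Arrow, armSet ({c} ∪ E) c = armSet E c := fun E => by
    rw [Finset.union_comm]
    refine armSet_union_left fun b hb hbc => ?_
    rw [Finset.mem_singleton] at hb
    exact hbc.1 hb
  have e0 : armVar π ∅ c = armSign {c} c • MvPolynomial.X (π.region {c} c) := by
    have h0 := hself ∅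
    rw [Finset.union_empty] at h0
    rw [← armVar_congr π h0, armVar]
  have elow : lowerArrows π.dissectingArrows {c} = innerArrows π.dissectingArrows {c} c := by
    rw [innerArrows_singleton π.dissectingArrows_subset, lowerArrows]
    exact Finset.filter_congr fun b _ => by simp
  have hX : ckCoproduct (MvPolynomial.X (π.region {c} c)) =
      1 ⊗ₜ[ℚ] MvPolynomial.X (π.region {c} c) +
        ∑ D ∈ admissible (π.region {c} c).dissectingArrows,
          sgn D • (MvPolynomial.X ((π.region {c} c).rootRegion D) ⊗ₜ[ℚ]
            ∏ α ∈ D, (MvPolynomial.X ((π.region {c} c).region D α) : SymV R)) := by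
    rw [ckCoproduct, MvPolynomial.aeval_X]
  rw [elow, ← hφ.sum_admissible, e0, map_smul, hX, smul_add, add_comm, TensorProduct.tmul_smul,
    Finset.smul_sum]
  congr 1
  refine Finset.sum_congr rfl fun D hD => ?_
  have hDd := (mem_admissible.1 hD).1
  obtain ⟨h1, h2, h3⟩ := h D hDd
  have hinj : ∀ a ∈ D, ∀ b ∈ D, φ a = φ b → a = b := fun a ha b hb =>
    hφ.inj a (admissible_subset hD ha) b (admissible_subset hD hb)
  have hadm := (hφ.image_mem_admissible (admissible_subset hD)).2 hD
  have hvar : ∏ b ∈ D.image φ, armVar π ∅ b =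
      ∏ b ∈ D.image φ, armVar π ({c} ∪ D.image φ) b := by
    refine Finset.prod_congr rfl fun b hb => (armVar_congr π (armSet_of_not_below ?_)).symm
    intro a ha hab
    rcases Finset.mem_union.1 ha with ha | ha
    · rw [Finset.mem_singleton] at ha
      subst ha
      exact hab.asymm (Finset.mem_filter.1 (admissible_subset hadm hb)).2.2.1
    · exact (mem_admissible.1 hadm).2 a ha b hb hab
  have hprod : ∀ F : Finset Arrow, ∏ b ∈ F, ((1 : SymV R) ⊗ₜ[ℚ] armVar π ∅ b) =
      (1 : SymV R) ⊗ₜ[ℚ] ∏ b ∈ F, armVar π ∅ b := fun F =>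
    (map_prod (Algebra.TensorProduct.includeRight : SymV R →ₐ[ℚ] SymV R ⊗[ℚ] SymV R) _ _).symm
  have hp : ∏ α ∈ D, (MvPolynomial.X ((π.region {c} c).region D α) : SymV R) =
      ∏ α ∈ D, MvPolynomial.X (π.region ({c} ∪ D.image φ) (φ α)) :=
    Finset.prod_congr rfl fun b hb => by rw [h2 b hb]
  rw [smul_smul, h3, hprod, Algebra.TensorProduct.tmul_mul_tmul, mul_one, one_mul, hvar,
    prod_armVar, ← armVar_congr π (hself (D.image φ)), armVar, h1, Finset.prod_image hinj,
    Finset.prod_image hinj, hp, TensorProduct.tmul_smul, ← TensorProduct.smul_tmul', smul_smul, mul_comm]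

theorem armSet_maxima_root {D : Finset Arrow} {N : ℕ} (hD : D ⊆ arrows N) :
    armSet (maxima D) (rootArrow N) = armSet D (rootArrow N) := by
  apply armSet_congr
  · exact fun b hb hbr => ⟨b, (Finset.mem_filter.1 hb).1, hbr, le_rfl, le_rfl⟩
  · intro b hb _
    obtain ⟨c, hc, hbc⟩ := exists_le_maxima hb
    exact ⟨c, hc, below_of_mem_arrows (hD (Finset.mem_filter.1 hc).1), le_bounds hbc⟩

/-- Apply `sum_two_step` with `X` in the last tensor factor, `Y` in the middle one and `G` attaching
the root region. That region depends only on the maximal arrows of `C ∪ D`, by `armSet_maxima_root`.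
-/
theorem ckCoaction_coassoc_single (π : EnhancedPolygon R S) :
    TensorProduct.assoc ℚ _ _ _
        (LinearMap.rTensor (SymV R) ckCoaction (ckCoaction (Finsupp.single π 1))) =
      LinearMap.lTensor (VpgBar R S) ckCoproduct.toLinearMap (ckCoaction (Finsupp.single π 1)) := by
  have hA := π.dissectingArrows_subset
  have hr := sum_two_step hA (fun b => (1 : SymV R) ⊗ₜ[ℚ] armVar π ∅ b)
    (fun α E => armVar π E α ⊗ₜ[ℚ] (1 : SymV R))
    (fun D => (TensorProduct.mk ℚ (VpgBar R S) (SymV R ⊗[ℚ] SymV R)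
      (Finsupp.single (π.rootRegion D) 1)).toAddMonoidHom)
  simp only [LinearMap.toAddMonoidHom_coe, TensorProduct.mk_apply] at hr
  rw [ckCoaction_single_eq, map_sum, map_sum, map_sum]
  have h1 : ∀ D ∈ admissible π.dissectingArrows,
      LinearMap.lTensor (VpgBar R S) (ckCoproduct (R := R)).toLinearMap
        (Finsupp.single (π.rootRegion D) (1 : ℚ) ⊗ₜ[ℚ] ∏ α ∈ D, armVar π ∅ α) =
      Finsupp.single (π.rootRegion D) (1 : ℚ) ⊗ₜ[ℚ] ∏ α ∈ D,
        (∑ E ∈ admissible (lowerArrows π.dissectingArrows {α}),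
          (armVar π E α ⊗ₜ[ℚ] (1 : SymV R)) * ∏ b ∈ E, ((1 : SymV R) ⊗ₜ[ℚ] armVar π ∅ b) +
        (1 : SymV R) ⊗ₜ[ℚ] armVar π ∅ α) := by
    intro D hD
    rw [LinearMap.lTensor_tmul, AlgHom.toLinearMap_apply, map_prod]
    congr 1
    exact Finset.prod_congr rfl fun α hα => ckCoproduct_armVar π (admissible_subset hD hα)
  rw [Finset.sum_congr rfl h1, hr]
  refine Finset.sum_congr rfl fun C hC => ?_
  rw [LinearMap.rTensor_tmul, ckCoaction_rootRegion π (mem_admissible.1 hC).1,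
    TensorProduct.sum_tmul, map_sum]
  refine Finset.sum_congr rfl fun D hD => ?_
  have hin : ∀ a ∈ D, a ∈ π.dissectingArrows := fun a ha =>
    (Finset.mem_filter.1 (admissible_subset hD ha)).1
  rw [TensorProduct.assoc_tmul, π.rootRegion_congr (armSet_maxima_root
    (Finset.union_subset (admissible_subset hC) hin |>.trans hA))]
  congr 1
  have e1 : ∏ b ∈ C, ((1 : SymV R) ⊗ₜ[ℚ] armVar π ∅ b) =
      (1 : SymV R) ⊗ₜ[ℚ] ∏ b ∈ C, armVar π ∅ b :=
    (map_prod (Algebra.TensorProduct.includeRight : SymV R →ₐ[ℚ] SymV R ⊗[ℚ] SymV R) _ _).symm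
  have e2 : ∏ α ∈ D, (armVar π (C.filter fun b => Below b α) α ⊗ₜ[ℚ] (1 : SymV R)) =
      (∏ α ∈ D, armVar π (C.filter fun b => Below b α) α) ⊗ₜ[ℚ] (1 : SymV R) :=
    (map_prod (Algebra.TensorProduct.includeLeft : SymV R →ₐ[ℚ] SymV R ⊗[ℚ] SymV R) _ _).symm
  rw [e1, e2, Algebra.TensorProduct.tmul_mul_tmul, mul_one, one_mul]
  congr 1
  -- As `D` is admissible, only arrows of `C` can lie below a member of `D`.
  refine Finset.prod_congr rfl fun α hα => armVar_congr π (armSet_congr ?_ ?_)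
  · intro b hb hbα
    rcases Finset.mem_union.1 hb with hb | hb
    · exact ⟨b, Finset.mem_filter.2 ⟨hb, hbα⟩, hbα, le_rfl, le_rfl⟩
    · exact absurd hbα ((mem_admissible.1 hD).2 b hb α hα)
  · intro b hb hbα
    exact ⟨b, Finset.mem_union_left _ (Finset.mem_filter.1 hb).1, hbα, le_rfl, le_rfl⟩

theorem EnhancedPolygon.rootRegion_empty (π : EnhancedPolygon R S) : π.rootRegion ∅ = π := by
  have h : ((armList ∅ (rootArrow π.size)).filter (fun i => i ≠ 0)).map π.side = π.arms := by
    have hs := π.two_le_size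
    rw [armList_empty_rootArrow (by omega)]
    have e : π.size - 1 = π.arms.length + 1 := rfl
    rw [e, List.range_succ_eq_map, List.filter_cons_of_neg (by simp), List.filter_map,
      List.filter_eq_self.2 (by simp), List.map_map]
    refine List.ext_getElem (by simp) fun i h1 h2 => ?_
    simp [EnhancedPolygon.side, h2]
  cases π
  rw [EnhancedPolygon.rootRegion, h]

theorem ckCoaction_counit_single (π : EnhancedPolygon R S) :
    TensorProduct.rid ℚ _ (LinearMap.lTensor (VpgBar R S) ckCounit.toLinearMap
      (ckCoaction (Finsupp.single π 1))) = Finsupp.single π (1 : ℚ) := by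
  -- Every non-empty dissection has a polygon in its second factor, which the counit kills.
  rw [ckCoaction_single, map_sum, map_sum, Finset.sum_eq_single ∅]
  · simp [sgn, π.rootRegion_empty]
  · intro D _ hD
    obtain ⟨a, ha⟩ := Finset.nonempty_iff_ne_empty.2 hD
    have h : ckCounit (∏ α ∈ D, (MvPolynomial.X (π.region D α) : SymV R)) = 0 := by
      rw [map_prod]
      exact Finset.prod_eq_zero ha (by rw [ckCounit, MvPolynomial.aeval_X])
    rw [map_smul, LinearMap.lTensor_tmul, AlgHom.toLinearMap_apply, h]
    simp
  · intro h
    exact absurd (empty_mem_admissible _) h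

/-! ## The differential on words of polygons -/

/-- `[a | b | x] ↦ [a ∧ b | x]`. -/
def pairTerm : List (Polygon R) → BarP R
  | a :: b :: w => TensorAlgebra.ι ℚ (augMul (augGen a) (augGen b)) * barWord w
  | _ => 0

/-- `[a | x] ↦ [∂ a | x]`. -/
def diffTerm : List (Polygon R) → BarP R
  | a :: w => TensorAlgebra.ι ℚ (augDiff (augGen a)) * barWord w
  | [] => 0

/-- `[π̄ | a | x] ↦ [π̄ ∧ a | x]`. -/
def firstTerm (π : EnhancedPolygon R S) : List (Polygon R) → BarE R S
  | a :: w => (Finsupp.single π (1 : ℚ) ⊗ₜ[ℚ] gen a) ⊗ₜ[ℚ] barWord w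
  | [] => 0

/-! ### Recursion formulas for the bar differential -/

section Generic

variable {A M : Type*} [AddCommGroup A] [Module ℚ A] [AddCommGroup M] [Module ℚ M]

theorem mergeFirst_one (act : M →ₗ[ℚ] A →ₗ[ℚ] M) : mergeFirst act 1 = 0 := tensorRec_one _ _

theorem mergeFirst_ι_mul (act : M →ₗ[ℚ] A →ₗ[ℚ] M) (a : A) (x : TensorAlgebra ℚ A) (m : M) :
    mergeFirst act (TensorAlgebra.ι ℚ a * x) m = act m a ⊗ₜ[ℚ] x := by
  rw [mergeFirst, tensorRec_ι_mul]
  rfl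

theorem prepend_tmul (a : A) (x : TensorAlgebra ℚ A) :
    prepend (a ⊗ₜ[ℚ] x) = TensorAlgebra.ι ℚ a * x := rfl

theorem wedgeBars_one (μ : A →ₗ[ℚ] A →ₗ[ℚ] A) : wedgeBars μ 1 = 0 := tensorRec_one _ _

theorem wedgeBars_ι_mul (μ : A →ₗ[ℚ] A →ₗ[ℚ] A) (a : A) (x : TensorAlgebra ℚ A) :
    wedgeBars μ (TensorAlgebra.ι ℚ a * x) =
      -prepend (mergeFirst μ x a) - TensorAlgebra.ι ℚ a * wedgeBars μ x := by
  rw [wedgeBars, tensorRec_ι_mul]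
  rfl

theorem innerDiff_one (d σ : A →ₗ[ℚ] A) : innerDiff d σ 1 = 0 := tensorRec_one _ _

theorem innerDiff_ι_mul (d σ : A →ₗ[ℚ] A) (a : A) (x : TensorAlgebra ℚ A) :
    innerDiff d σ (TensorAlgebra.ι ℚ a * x) =
      TensorAlgebra.ι ℚ (d a) * x + TensorAlgebra.ι ℚ (σ a) * innerDiff d σ x := by
  rw [innerDiff, tensorRec_ι_mul]
  rfl

theorem moduleD₁_tmul (act : M →ₗ[ℚ] A →ₗ[ℚ] M) (μ : A →ₗ[ℚ] A →ₗ[ℚ] A) (σ : A →ₗ[ℚ] A)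
    (τ : M →ₗ[ℚ] M) (m : M) (x : TensorAlgebra ℚ A) : moduleD₁ act μ σ τ (m ⊗ₜ[ℚ] x) =
      -mergeFirst act (barSign σ x) (τ m) - τ m ⊗ₜ[ℚ] wedgeBars μ (barSign σ x) := by
  rw [moduleD₁, LinearMap.comp_apply, TensorProduct.map_tmul, wedgeBarsModule,
    LinearMap.sub_apply, LinearMap.neg_apply, TensorProduct.lift.tmul, LinearMap.flip_apply,
    LinearMap.lTensor_tmul]

theorem moduleD₂_tmul (d' : M →ₗ[ℚ] M) (d σ : A →ₗ[ℚ] A) (τ : M →ₗ[ℚ] M) (m : M)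
    (x : TensorAlgebra ℚ A) : moduleD₂ d' d σ τ (m ⊗ₜ[ℚ] x) =
      d' m ⊗ₜ[ℚ] x - τ m ⊗ₜ[ℚ] innerDiff d σ x := by
  rw [moduleD₂, LinearMap.sub_apply, LinearMap.rTensor_tmul, TensorProduct.map_tmul]

/-- `z ↦ [m | x | z | y]`. -/
def wordInsert (m : M) (x y : TensorAlgebra ℚ A) : A →ₗ[ℚ] M ⊗[ℚ] TensorAlgebra ℚ A :=
  TensorProduct.mk ℚ _ _ m ∘ₗ LinearMap.mulLeft ℚ x ∘ₗ LinearMap.mulRight ℚ y ∘ₗ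
    TensorAlgebra.ι ℚ

theorem wordInsert_apply (m : M) (x y : TensorAlgebra ℚ A) (z : A) :
    wordInsert m x y z = m ⊗ₜ[ℚ] (x * (TensorAlgebra.ι ℚ z * y)) := rfl

theorem smul_map_of_smul_eq_sum {ι : Type*} (f : A →ₗ[ℚ] M) (c k : ℚ) (z : A) (s : Finset ι)
    (q : ι → ℚ) (w : ι → A) (h : k • z = ∑ i ∈ s, q i • w i) :
    (c * k) • f z = ∑ i ∈ s, (c * q i) • f (w i) := by
  rw [mul_smul, ← map_smul, h, map_sum, Finset.smul_sum]
  exact Finset.sum_congr rfl fun i _ => by rw [map_smul, mul_smul]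

end Generic

/-- The four families of terms of the differential cancel in pairs only after summation over all
lists, not list by list. -/
theorem sum_sub_add_sub_eq_zero {ι E : Type*} [AddCommGroup E] (s : Finset ι) (a b c d : ι → E)
    (h₁ : ∑ i ∈ s, b i = ∑ i ∈ s, a i) (h₂ : ∑ i ∈ s, c i = ∑ i ∈ s, d i) :
    ∑ i ∈ s, ((a i - b i) + (c i - d i)) = 0 := by
  rw [Finset.sum_add_distrib, Finset.sum_sub_distrib, Finset.sum_sub_distrib, h₁, h₂, sub_self,
    sub_self, add_zero]

theorem barWord_nil : barWord ([] : List (Polygon R)) = 1 := rfl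

theorem barWord_cons (a : Polygon R) (w : List (Polygon R)) :
    barWord (a :: w) = TensorAlgebra.ι ℚ (augGen a) * barWord w := by
  simp [barWord]

theorem augSign_augGen (a : Polygon R) : augSign (augGen a) = -augGen a := by
  apply Subtype.ext
  exact CliffordAlgebra.involute_ι _

/-- Polygons have bar degree `0`: the sign in `barSign` compensates the sign of exterior degree `1`.
-/
theorem barSign_barWord (w : List (Polygon R)) : barSign augSign (barWord w) = barWord w := by
  induction w with
  | nil => exact map_one (TensorAlgebra.lift ℚ (-(TensorAlgebra.ι ℚ ∘ₗ augSign (R := R))))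
  | cons a w ih =>
    rw [barSign, AlgHom.toLinearMap_apply] at ih
    rw [barWord_cons, barSign, AlgHom.toLinearMap_apply, map_mul, ih, TensorAlgebra.lift_ι_apply,
      LinearMap.neg_apply, LinearMap.comp_apply, augSign_augGen, map_neg, neg_neg]

theorem prepend_mergeFirst (a : Polygon R) (w : List (Polygon R)) :
    prepend (mergeFirst augMul (barWord w) (augGen a)) = pairTerm (a :: w) := by
  cases w with
  | nil =>
    rw [barWord_nil, mergeFirst_one, LinearMap.zero_apply, map_zero]
    rfl
  | cons b w => rw [barWord_cons, mergeFirst_ι_mul, prepend_tmul, pairTerm]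

/-- The split after `i` letters stands for bar `i + 1`, with sign `(-1) ^ (i + 1)`. The sum runs
over all splittings because `pairTerm` vanishes on fewer than two letters; merging and
differentiation then have the same index set. -/
theorem wedgeBars_barWord (w : List (Polygon R)) : wedgeBars augMul (barWord w) =
    -∑ i ∈ Finset.range (w.length + 1),
      (-1 : ℚ) ^ i • (barWord (w.take i) * pairTerm (w.drop i)) := by
  induction w with
  | nil =>
    rw [barWord_nil, wedgeBars_one]
    simp [pairTerm]
  | cons a w ih =>
    rw [barWord_cons, wedgeBars_ι_mul, ih, prepend_mergeFirst, List.length_cons,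
      Finset.sum_range_succ' _ (w.length + 1), mul_neg, Finset.mul_sum, List.take_zero,
      List.drop_zero, barWord_nil, one_mul, pow_zero, one_smul, neg_add, sub_neg_eq_add, add_comm]
    congr 1
    rw [← Finset.sum_neg_distrib]
    refine Finset.sum_congr rfl fun i _ => ?_
    rw [List.take_succ_cons, List.drop_succ_cons, barWord_cons, pow_succ, mul_neg_one, neg_smul,
      neg_neg, mul_smul_comm, mul_assoc]

theorem innerDiff_barWord (w : List (Polygon R)) : innerDiff augDiff augSign (barWord w) =
    ∑ i ∈ Finset.range (w.length + 1),
      (-1 : ℚ) ^ i • (barWord (w.take i) * diffTerm (w.drop i)) := by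
  induction w with
  | nil =>
    rw [barWord_nil, innerDiff_one]
    simp [diffTerm]
  | cons a w ih =>
    rw [barWord_cons, innerDiff_ι_mul, ih, List.length_cons, Finset.sum_range_succ' _ (w.length + 1),
      Finset.mul_sum, List.take_zero, List.drop_zero, barWord_nil, one_mul, pow_zero, one_smul,
      add_comm, diffTerm]
    congr 1
    refine Finset.sum_congr rfl fun i _ => ?_
    rw [List.take_succ_cons, List.drop_succ_cons, barWord_cons, augSign_augGen, map_neg, pow_succ,
      mul_neg_one, neg_smul, mul_smul_comm, mul_assoc, neg_mul, smul_neg]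

theorem mergeFirst_augAct (π : EnhancedPolygon R S) (w : List (Polygon R)) :
    mergeFirst augAct (barWord w) (Finsupp.single π (1 : ℚ) ⊗ₜ[ℚ] (1 : PolyAlg R)) =
      firstTerm π w := by
  cases w with
  | nil =>
    rw [barWord_nil, mergeFirst_one]
    rfl
  | cons a w =>
    rw [barWord_cons, mergeFirst_ι_mul, firstTerm]
    congr 1
    change rightMul (Finsupp.single π (1 : ℚ) ⊗ₜ[ℚ] 1) (gen a) = _
    rw [rightMul_tmul, one_mul]

theorem diffBar_single (π : EnhancedPolygon R S) :
    diffBar (Finsupp.single π (1 : ℚ) ⊗ₜ[ℚ] (1 : PolyAlg R)) =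
      kappaBar (Finsupp.single π 1) := by
  have h1 : diff (1 : PolyAlg R) = 0 := by
    have := diff_algebraMap (R := R) 1
    rwa [map_one] at this
  have h2 : ∀ x : EnhAlg R S, rightMul x 1 = x := by
    intro x
    induction x using TensorProduct.induction_on with
    | zero => simp
    | tmul v x => rw [rightMul_tmul, mul_one]
    | add x y hx hy => rw [map_add, LinearMap.add_apply, hx, hy]
  rw [diffBar, TensorProduct.lift.tmul]
  change rightMul (kappaBar _) 1 - _ ⊗ₜ[ℚ] diff 1 = _
  rw [h1, h2, TensorProduct.tmul_zero, sub_zero]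

/-- The terms are grouped as they will cancel: `kappaBar` against the first bar, and the remaining
bars against the differentials of the remaining factors. -/
theorem barDiff_enhWord (π : EnhancedPolygon R S) (w : List (Polygon R)) :
    barDiff (enhWord π w) =
      (kappaBar (Finsupp.single π 1) ⊗ₜ[ℚ] barWord w - firstTerm π w) +
      (Finsupp.single π (1 : ℚ) ⊗ₜ[ℚ] (1 : PolyAlg R)) ⊗ₜ[ℚ]
        (∑ i ∈ Finset.range (w.length + 1),
          (-1 : ℚ) ^ i • (barWord (w.take i) * pairTerm (w.drop i)) -
        ∑ i ∈ Finset.range (w.length + 1),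
          (-1 : ℚ) ^ i • (barWord (w.take i) * diffTerm (w.drop i))) := by
  have hs : signBar (Finsupp.single π (1 : ℚ) ⊗ₜ[ℚ] (1 : PolyAlg R)) =
      Finsupp.single π (1 : ℚ) ⊗ₜ[ℚ] (1 : PolyAlg R) := by
    rw [signBar, LinearMap.lTensor_tmul, AlgHom.toLinearMap_apply, map_one]
  have h1 : moduleD₁ augAct augMul augSign signBar (enhWord π w) =
      -firstTerm π w - (Finsupp.single π (1 : ℚ) ⊗ₜ[ℚ] (1 : PolyAlg R)) ⊗ₜ[ℚ]
        wedgeBars augMul (barWord w) := by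
    rw [enhWord, moduleD₁_tmul, hs, barSign_barWord, mergeFirst_augAct]
  have h3 : moduleD₂ diffBar augDiff augSign signBar (enhWord π w) =
      kappaBar (Finsupp.single π 1) ⊗ₜ[ℚ] barWord w -
        (Finsupp.single π (1 : ℚ) ⊗ₜ[ℚ] (1 : PolyAlg R)) ⊗ₜ[ℚ]
          innerDiff augDiff augSign (barWord w) := by
    rw [enhWord, moduleD₂_tmul, hs, diffBar_single]
  rw [barDiff, LinearMap.add_apply, h1, h3, wedgeBars_barWord, innerDiff_barWord,
    TensorProduct.tmul_neg, TensorProduct.tmul_sub]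
  abel

theorem augMul_augGen_swap (a b : Polygon R) :
    augMul (augGen a) (augGen b) = -augMul (augGen b) (augGen a) := by
  apply Subtype.ext
  exact eq_neg_of_add_eq_zero_left (ExteriorAlgebra.ι_add_mul_swap _ _)

theorem augDiff_augGen (π : Polygon R) : augDiff (augGen π) =
    ∑ a ∈ π.dissectingArrows,
      sgn {a} • augMul (augGen (π.rootRegion {a})) (augGen (π.region {a} a)) := by
  apply Subtype.ext
  have h := diff_ι_mul (Finsupp.single π (1 : ℚ)) 1
  have h1 : diff (1 : PolyAlg R) = 0 := by
    have := diff_algebraMap (R := R) 1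
    rwa [map_one] at this
  rw [mul_one, mul_one, h1, mul_zero, sub_zero, kappa, Finsupp.linearCombination_single, one_smul,
    kappaPolygon] at h
  rw [AddSubmonoidClass.coe_finsetSum]
  exact h

/-! ## Adding an arrow to a dissection -/

/-- An arrow directly under `a` changes no other region: any region above it lies above `a` as well,
where `a` already hides everything below. -/
theorem innerArrows_armSet {A C : Finset Arrow} (hC : C ∈ dissections A) {a b c : Arrow}
    (ha : a ∈ C) (hb : b ∈ innerArrows A C a) (hca : c ≠ a)
    (hc : c ∈ C ∨ ∃ N, A ⊆ arrows N ∧ c = rootArrow N) :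
    armSet (C ∪ {b}) c = armSet C c := by
  obtain ⟨_, _, hba, h1, h2⟩ := Finset.mem_filter.1 hb
  apply armSet_congr
  · intro d hd hdc
    rcases Finset.mem_union.1 hd with hd | hd
    · exact ⟨d, hd, hdc, le_rfl, le_rfl⟩
    · rw [Finset.mem_singleton] at hd
      subst hd
      refine ⟨a, ha, ?_, hba.2⟩
      rcases hc with hc | ⟨N, hA, rfl⟩
      · by_contra hac
        have h3 : ¬ Below c a := fun h => (h2 c hc h).2 hdc
        have h4 := disjoint_of_incomparable hca.symm (compatible_of_mem_dissections hC ha hc) hac h3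
        have := hba.2
        have := hdc.2
        have := lo_lt_hi d
        omega
      · exact below_of_mem_arrows (hA ((mem_dissections.1 hC).1 ha))
  · exact fun d hd hdc => ⟨d, Finset.mem_union_left _ hd, hdc, le_rfl, le_rfl⟩

/-- The differential of a region, with the sign of its upper arrow, is the sum over all ways to add
one arrow directly under it. -/
theorem armSign_smul_augDiff (π : EnhancedPolygon R S) {C : Finset Arrow} {a : Arrow}
    (hC : C ∈ dissections π.dissectingArrows) (ha : a ∈ C) :
    armSign C a • augDiff (augGen (π.region C a)) =
      ∑ b ∈ innerArrows π.dissectingArrows C a, (armSign (C ∪ {b}) a * armSign (C ∪ {b}) b) •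
        augMul (augGen (π.region (C ∪ {b}) a)) (augGen (π.region (C ∪ {b}) b)) := by
  obtain ⟨φ, hφ, h⟩ := exists_region_equiv π hC ha
  rw [augDiff_augGen, ← hφ.sum_arrows, Finset.smul_sum]
  refine Finset.sum_congr rfl fun x hx => ?_
  obtain ⟨h1, h2, h3⟩ := h {x} (singleton_mem_dissections hx)
  have h2 := h2 x (Finset.mem_singleton_self x)
  rw [Finset.image_singleton] at h1 h2 h3
  rw [Finset.prod_singleton] at h3
  rw [smul_smul, h1, h2, h3]

theorem kappaBar_rootRegion (π : EnhancedPolygon R S) {C : Finset Arrow}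
    (hC : C ∈ dissections π.dissectingArrows) :
    kappaBar (Finsupp.single (π.rootRegion C) 1) =
      ∑ b ∈ innerArrows π.dissectingArrows C (rootArrow π.size), armSign (C ∪ {b}) b •
        (Finsupp.single (π.rootRegion (C ∪ {b})) (1 : ℚ) ⊗ₜ[ℚ] gen (π.region (C ∪ {b}) b)) := by
  obtain ⟨φ, hφ, h⟩ := exists_rootRegion_equiv π hC
  rw [kappaBar, Finsupp.linearCombination_single, one_smul, ← hφ.sum_arrows]
  refine Finset.sum_congr rfl fun x hx => ?_
  obtain ⟨h1, h2, h3⟩ := h {x} (singleton_mem_dissections hx)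
  have h2 := h2 x (Finset.mem_singleton_self x)
  rw [Finset.image_singleton] at h1 h2 h3
  rw [Finset.prod_singleton] at h3
  rw [h1, h2, h3]

/-! ## The first bar -/

/-- To be first is to be allowed before every other arrow, which is the condition to dissect the
root region. -/
theorem cons_mem_ordLists_iff {A : Finset Arrow} {N : ℕ} (hA : A ⊆ arrows N) (b : Arrow)
    (l : List Arrow) : b :: l ∈ ordLists A ↔
      l ∈ ordLists A ∧ b ∈ innerArrows A l.toFinset (rootArrow N) := by
  rw [mem_ordLists, mem_ordLists, List.pairwise_cons, innerArrows, Finset.mem_filter, Dissects]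
  constructor
  · rintro ⟨h1, h2, h3⟩
    have hb := h1 b (by simp)
    exact ⟨⟨fun a ha => h1 a (by simp [ha]), h3⟩, hb, (mem_arrows_iff.1 (hA hb)).2.1,
      below_of_mem_arrows (hA hb), fun c hc => (h2 c (List.mem_toFinset.1 hc)).2.1,
      fun c hc _ => ⟨(h2 c (List.mem_toFinset.1 hc)).1, (h2 c (List.mem_toFinset.1 hc)).2.2⟩⟩
  · rintro ⟨⟨h1, h2⟩, hb, _, _, h3, h4⟩
    refine ⟨fun a ha => ?_, fun a ha => ?_, h2⟩
    · rcases List.mem_cons.1 ha with rfl | ha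
      · exact hb
      · exact h1 a ha
    · have h5 := h4 a (List.mem_toFinset.2 ha) (below_of_mem_arrows (hA (h1 a ha)))
      exact ⟨h5.1, h3 a (List.mem_toFinset.2 ha), h5.2⟩

theorem sum_ordLists_cons {E : Type*} [AddCommMonoid E] {A : Finset Arrow} {N : ℕ}
    (hA : A ⊆ arrows N) (F : List Arrow → E) (h0 : F [] = 0) :
    ∑ l ∈ ordLists A, F l =
      ∑ l ∈ ordLists A, ∑ b ∈ innerArrows A l.toFinset (rootArrow N), F (b :: l) := by
  rw [Finset.sum_sigma']
  symm
  rw [← Finset.sum_filter_of_ne (s := ordLists A) (p := fun l => l ≠ [])]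
  · refine Finset.sum_bij (fun q _ => q.2 :: q.1) ?_ ?_ ?_ (fun _ _ => rfl)
    · rintro ⟨l, b⟩ hq
      rw [Finset.mem_sigma] at hq
      exact Finset.mem_filter.2 ⟨(cons_mem_ordLists_iff hA b l).2 hq, List.cons_ne_nil _ _⟩
    · rintro ⟨l, b⟩ _ ⟨l', b'⟩ _ e
      simp only [List.cons.injEq] at e
      obtain ⟨rfl, rfl⟩ := e
      rfl
    · intro l hl
      obtain ⟨hl, hne⟩ := Finset.mem_filter.1 hl
      cases l with
      | nil => exact absurd rfl hne
      | cons b l => exact ⟨⟨l, b⟩, Finset.mem_sigma.2 ((cons_mem_ordLists_iff hA b l).1 hl), rfl⟩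
  · rintro l _ h rfl
    exact h h0

/-- A non-empty list is its tail together with an arrow on the boundary of the root region, and
these arrows index `kappaBar` of the root region of the tail. The empty list contributes `0`. -/
theorem sum_firstTerm (π : EnhancedPolygon R S) :
    ∑ l ∈ ordLists π.dissectingArrows, sgn l.toFinset •
        firstTerm (π.rootRegion l.toFinset) (l.map (π.region l.toFinset)) =
      ∑ l ∈ ordLists π.dissectingArrows, sgn l.toFinset •
        (kappaBar (Finsupp.single (π.rootRegion l.toFinset) 1) ⊗ₜ[ℚ]
          barWord (l.map (π.region l.toFinset))) := by
  have hA := π.dissectingArrows_subset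
  rw [sum_ordLists_cons hA (fun l => sgn l.toFinset •
    firstTerm (π.rootRegion l.toFinset) (l.map (π.region l.toFinset)))
    (by simp [firstTerm])]
  refine Finset.sum_congr rfl fun l hl => ?_
  have hC := toFinset_mem_dissections hl
  rw [kappaBar_rootRegion π hC, TensorProduct.sum_tmul, Finset.smul_sum]
  refine Finset.sum_congr rfl fun b hb => ?_
  obtain ⟨hbA, _, _, h1, h2⟩ := Finset.mem_filter.1 hb
  have h3 : ∀ c ∈ l.toFinset, b ≠ c ∧ ¬ Below b c := fun c hc =>
    h2 c hc (below_of_mem_arrows (hA ((mem_dissections.1 hC).1 hc)))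
  have hset : ∀ c ∈ l, armSet (l.toFinset ∪ {b}) c = armSet l.toFinset c := fun c hc =>
    armSet_union_left fun d hd => by
      rw [Finset.mem_singleton] at hd
      subst hd
      exact (h3 c (List.mem_toFinset.2 hc)).2
  have hmap : l.map (π.region (l.toFinset ∪ {b})) = l.map (π.region l.toFinset) :=
    List.map_congr_left fun c hc => π.region_congr (hset c hc)
  have hsgn : sgn (l.toFinset ∪ {b}) = sgn l.toFinset * armSign (l.toFinset ∪ {b}) b := by
    rw [sgn_eq_prod, Finset.prod_union, Finset.prod_singleton, sgn_eq_prod]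
    · congr 1
      exact Finset.prod_congr rfl fun c hc => armSign_congr (hset c (List.mem_toFinset.1 hc))
    · rw [Finset.disjoint_singleton_right]
      exact fun hb => (h3 b hb).1 rfl
  have e : (b :: l).toFinset = l.toFinset ∪ {b} := by
    rw [List.toFinset_cons, Finset.union_comm]
    rfl
  rw [e, List.map_cons, firstTerm, hmap, hsgn, mul_smul, TensorProduct.smul_tmul']

/-! ## The other bars -/

/-- The second arrow of the list is right under the first one. -/
def HeadBelow : List Arrow → Prop
  | a :: b :: _ => Below b a
  | _ => False

instance : DecidablePred HeadBelow
  | a :: b :: _ => inferInstanceAs (Decidable (Below b a))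
  | [] => inferInstanceAs (Decidable False)
  | [_] => inferInstanceAs (Decidable False)

def swapHead : List Arrow → List Arrow
  | a :: b :: l => b :: a :: l
  | l => l

/-- The value on the empty list is immaterial, since `headInner` offers no arrow to insert there. -/
def insertSecond (b : Arrow) : List Arrow → List Arrow
  | a :: l => a :: b :: l
  | [] => []

/-- The arrows which may be added right under the first arrow of the second list. -/
def headInner (A : Finset Arrow) (p : List Arrow × List Arrow) : Finset Arrow :=
  match p.2 with
  | a :: _ => innerArrows A (p.1 ++ p.2).toFinset a
  | [] => ∅

/-- Placed immediately after `a`, an arrow below `a` is compatible with the order exactly when no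
other arrow of the list separates it from `a`, that is, when it dissects the region of `a`. -/
theorem insert_mem_ordLists_iff {A : Finset Arrow} {N : ℕ} (hA : A ⊆ arrows N) (a b : Arrow)
    (l₁ l₂ : List Arrow) : (l₁ ++ a :: b :: l₂ ∈ ordLists A ∧ Below b a) ↔
      l₁ ++ a :: l₂ ∈ ordLists A ∧ b ∈ innerArrows A (l₁ ++ a :: l₂).toFinset a := by
  rw [mem_ordLists, mem_ordLists, innerArrows, Finset.mem_filter, Dissects]
  simp only [List.pairwise_append, List.pairwise_cons, List.mem_append, List.mem_cons,
    List.mem_toFinset]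
  constructor
  · rintro ⟨⟨h1, h2, ⟨h3, h4, h5⟩, h6⟩, hba⟩
    have hbA := h1 b (by simp)
    refine ⟨⟨fun x hx => h1 x (by tauto), h2, ⟨fun x hx => h3 x (Or.inr hx), h5⟩,
      fun x hx y hy => h6 x hx y (by tauto)⟩, hbA, (mem_arrows_iff.1 (hA hbA)).2.1, hba, ?_, ?_⟩
    · rintro c (hc | rfl | hc)
      · exact (h6 c hc b (by simp)).2.1.symm
      · exact (h3 b (by simp)).2.1.symm
      · exact (h4 c hc).2.1
    · rintro c (hc | rfl | hc) hca
      · exact absurd hca (h6 c hc a (by simp)).2.2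
      · exact absurd rfl hca.1
      · exact ⟨(h4 c hc).1, (h4 c hc).2.2⟩
  · rintro ⟨⟨h1, h2, ⟨h3, h4⟩, h5⟩, hbA, _, hba, h6, h7⟩
    refine ⟨⟨?_, h2, ⟨?_, ?_, h4⟩, ?_⟩, hba⟩
    · rintro x (hx | rfl | rfl | hx)
      · exact h1 x (by tauto)
      · exact h1 x (by tauto)
      · exact hbA
      · exact h1 x (by tauto)
    · rintro x (rfl | hx)
      · exact ⟨hba.1.symm, (h6 a (by simp)).symm, hba.asymm⟩
      · exact h3 x hx
    · intro c hc
      have h8 := h3 c hc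
      by_cases hca : Below c a
      · exact ⟨(h7 c (by tauto) hca).1, h6 c (by tauto), (h7 c (by tauto) hca).2⟩
      -- An arrow `c` after `a` and not below `a` is disjoint from `a`, hence cannot contain `b`.
      · refine ⟨by rintro rfl; exact hca hba, h6 c (by tauto), fun hbc => ?_⟩
        have h9 := disjoint_of_incomparable h8.1 h8.2.1 h8.2.2 hca
        have := hba.2
        have := hbc.2
        have := lo_lt_hi b
        omega
    · rintro x hx y (rfl | rfl | hy)
      · exact h5 x hx y (by tauto)
      · have h8 := h5 x hx a (by tauto)
        exact ⟨by rintro rfl; exact h8.2.2 hba, (h6 x (by tauto)).symm,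
          fun h => h8.2.2 (h.trans hba)⟩
      · exact h5 x hx y (by tauto)

/-- Deleting the second of two nested neighbours is a bijection onto pairs of a split list and an
arrow to be inserted, by `insert_mem_ordLists_iff`. -/
theorem sum_headBelow {E : Type*} [AddCommMonoid E] {A : Finset Arrow} {N : ℕ}
    (hA : A ⊆ arrows N) (F : List Arrow → List Arrow → E) :
    ∑ p ∈ (splits (ordLists A)).filter (fun p => HeadBelow p.2), F p.1 p.2 =
      ∑ p ∈ splits (ordLists A), ∑ b ∈ headInner A p, F p.1 (insertSecond b p.2) := by
  rw [Finset.sum_sigma']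
  symm
  refine Finset.sum_bij (fun q _ => (q.1.1, insertSecond q.2 q.1.2)) ?_ ?_ ?_ (fun _ _ => rfl)
  · rintro ⟨⟨l₁, l₂⟩, b⟩ hq
    obtain ⟨hp, hb⟩ := Finset.mem_sigma.1 hq
    rw [mem_splits] at hp
    cases l₂ with
    | nil => simp [headInner] at hb
    | cons a l₂ =>
      have h := (insert_mem_ordLists_iff hA a b l₁ l₂).2 ⟨hp, hb⟩
      exact Finset.mem_filter.2 ⟨mem_splits.2 h.1, h.2⟩
  · rintro ⟨⟨l₁, l₂⟩, b⟩ hq ⟨⟨m₁, m₂⟩, c⟩ hr e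
    cases l₂ with
    | nil => simp [headInner] at hq
    | cons a l₂ =>
      cases m₂ with
      | nil => simp [headInner] at hr
      | cons a' m₂ =>
        simp only [insertSecond, Prod.mk.injEq, List.cons.injEq] at e
        obtain ⟨rfl, rfl, rfl, rfl⟩ := e
        rfl
  · rintro ⟨l₁, l₂⟩ hp
    obtain ⟨hp, hh⟩ := Finset.mem_filter.1 hp
    rw [mem_splits] at hp
    match l₂, hp, hh with
    | a :: b :: l₂, hp, hh =>
      have h := (insert_mem_ordLists_iff hA a b l₁ l₂).1 ⟨hp, hh⟩
      exact ⟨⟨(l₁, a :: l₂), b⟩, Finset.mem_sigma.2 ⟨mem_splits.2 h.1, h.2⟩, rfl⟩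

theorem swap_mem_ordLists {A : Finset Arrow} {a b : Arrow} {l₁ l₂ : List Arrow}
    (h : l₁ ++ a :: b :: l₂ ∈ ordLists A) (hab : ¬ Below b a) :
    l₁ ++ b :: a :: l₂ ∈ ordLists A := by
  rw [mem_ordLists] at h ⊢
  simp only [List.pairwise_append, List.pairwise_cons, List.mem_append, List.mem_cons] at h ⊢
  obtain ⟨h1, h2, ⟨h3, h4, h5⟩, h6⟩ := h
  refine ⟨fun x hx => h1 x (by tauto), h2, ⟨?_, fun x hx => h3 x (Or.inr hx), h5⟩,
    fun x hx y hy => h6 x hx y (by tauto)⟩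
  rintro x (rfl | hx)
  · have h7 := h3 b (by tauto)
    exact ⟨h7.1.symm, h7.2.1.symm, hab⟩
  · exact h4 x hx

/-- The term of the differential of `B(π̄)` in which two neighbours are multiplied. -/
def mergeTerm (π : EnhancedPolygon R S) (l₁ l₂ : List Arrow) : BarE R S :=
  ((-1) ^ l₁.length * sgn (l₁ ++ l₂).toFinset) •
    ((Finsupp.single (π.rootRegion (l₁ ++ l₂).toFinset) (1 : ℚ) ⊗ₜ[ℚ] (1 : PolyAlg R)) ⊗ₜ[ℚ]
      (barWord (l₁.map (π.region (l₁ ++ l₂).toFinset)) *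
        pairTerm (l₂.map (π.region (l₁ ++ l₂).toFinset))))

/-- The term of the differential of `B(π̄)` in which a factor is replaced by its differential. -/
def innerTerm (π : EnhancedPolygon R S) (l₁ l₂ : List Arrow) : BarE R S :=
  ((-1) ^ l₁.length * sgn (l₁ ++ l₂).toFinset) •
    ((Finsupp.single (π.rootRegion (l₁ ++ l₂).toFinset) (1 : ℚ) ⊗ₜ[ℚ] (1 : PolyAlg R)) ⊗ₜ[ℚ]
      (barWord (l₁.map (π.region (l₁ ++ l₂).toFinset)) *
        diffTerm (l₂.map (π.region (l₁ ++ l₂).toFinset))))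

/-- Both lists give the same dissection, hence the same sign and regions; only the order of the two
anticommuting factors differs. -/
theorem mergeTerm_swap (π : EnhancedPolygon R S) (a b : Arrow) (l₁ l₂ : List Arrow) :
    mergeTerm π l₁ (a :: b :: l₂) + mergeTerm π l₁ (b :: a :: l₂) = 0 := by
  have e : (l₁ ++ b :: a :: l₂).toFinset = (l₁ ++ a :: b :: l₂).toFinset := by
    ext x
    simp only [List.mem_toFinset, List.mem_append, List.mem_cons]
    tauto
  rw [mergeTerm, mergeTerm, e, ← smul_add, ← TensorProduct.tmul_add, ← mul_add]
  simp only [List.map_cons, pairTerm]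
  rw [← add_mul, ← map_add, augMul_augGen_swap (π.region _ a), neg_add_cancel, map_zero, zero_mul,
    mul_zero, TensorProduct.tmul_zero, smul_zero]

/-- Exchanging the two neighbours is a sign-reversing involution on these splittings. It fixes only
lists with fewer than two arrows after the cut, where the term vanishes. -/
theorem sum_mergeTerm_not_headBelow (π : EnhancedPolygon R S) :
    ∑ p ∈ (splits (ordLists π.dissectingArrows)).filter (fun p => ¬ HeadBelow p.2),
      mergeTerm π p.1 p.2 = 0 := by
  have hnil : ∀ l₁, mergeTerm π l₁ [] = 0 := fun l₁ => by simp [mergeTerm, pairTerm]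
  have hone : ∀ l₁ a, mergeTerm π l₁ [a] = 0 := fun l₁ a => by simp [mergeTerm, pairTerm]
  refine Finset.sum_involution (fun p _ => (p.1, swapHead p.2)) ?_ ?_ ?_ ?_
  · rintro ⟨l₁, l₂⟩ _
    match l₂ with
    | [] => simp [swapHead, hnil]
    | [a] => simp [swapHead, hone]
    | a :: b :: l₂ => exact mergeTerm_swap π a b l₁ l₂
  · rintro ⟨l₁, l₂⟩ hp hne e
    obtain ⟨hp, _⟩ := Finset.mem_filter.1 hp
    match l₂, hp, hne, e with
    | [], _, hne, _ => exact hne (hnil l₁)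
    | [a], _, hne, _ => exact hne (hone l₁ a)
    | a :: b :: l₂, hp, _, e =>
      simp only [swapHead, Prod.mk.injEq, List.cons.injEq] at e
      have h := nodup_of_mem_ordLists (mem_splits.1 hp)
      rw [e.2.1] at h
      exact (List.nodup_cons.1 (List.nodup_append.1 h).2.1).1 (by simp)
  · rintro ⟨l₁, l₂⟩ hp
    obtain ⟨hp, hh⟩ := Finset.mem_filter.1 hp
    match l₂, hp, hh with
    | [], hp, hh => exact Finset.mem_filter.2 ⟨hp, hh⟩
    | [a], hp, hh => exact Finset.mem_filter.2 ⟨hp, hh⟩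
    | a :: b :: l₂, hp, hh =>
      have h := mem_splits.1 hp
      refine Finset.mem_filter.2 ⟨mem_splits.2 (swap_mem_ordLists h hh), ?_⟩
      -- After the exchange the neighbours are again not nested in list order, because `a` preceded
      -- `b` in a compatible list.
      have h1 := (List.pairwise_append.1 (mem_ordLists.1 h).2).2.1
      exact ((List.pairwise_cons.1 h1).1 b (by simp)).2.2
  · rintro ⟨l₁, l₂⟩ _
    match l₂ with
    | [] => rfl
    | [a] => rfl
    | a :: b :: l₂ => rfl

theorem toFinset_insert (a b : Arrow) (l₁ l₂ : List Arrow) :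
    (l₁ ++ a :: b :: l₂).toFinset = (l₁ ++ a :: l₂).toFinset ∪ {b} := by
  ext x
  simp only [List.mem_toFinset, List.mem_append, List.mem_cons, Finset.mem_union,
    Finset.mem_singleton]
  tauto

/-- Only the region of `a` changes and the region of `b` is new, so all other factors split off;
they are the common scalar in `innerTerm_eq`. -/
theorem sgn_union_singleton {C : Finset Arrow} {a b : Arrow} (ha : a ∈ C) (hb : b ∉ C)
    (h : ∀ c ∈ C, c ≠ a → armSet (C ∪ {b}) c = armSet C c) :
    sgn (C ∪ {b}) = (∏ c ∈ C.erase a, armSign C c) *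
      (armSign (C ∪ {b}) a * armSign (C ∪ {b}) b) := by
  have h1 : ∏ c ∈ C.erase a, armSign (C ∪ {b}) c = ∏ c ∈ C.erase a, armSign C c :=
    Finset.prod_congr rfl fun c hc => armSign_congr
      (h c (Finset.mem_of_mem_erase hc) (Finset.ne_of_mem_erase hc))
  rw [sgn_eq_prod, Finset.prod_union (Finset.disjoint_singleton_right.2 hb),
    Finset.prod_singleton, ← Finset.mul_prod_erase _ _ ha, h1]
  ring

/-- Differentiating the factor of `a` splits its region along one more arrow `b`. The result is the
merged term of the list with `b` right after `a`; the scalar `(-1) ^ l₁.length` is the same since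
the cut stays in front of `a`. -/
theorem innerTerm_eq (π : EnhancedPolygon R S) {p : List Arrow × List Arrow}
    (hp : p.1 ++ p.2 ∈ ordLists π.dissectingArrows) : innerTerm π p.1 p.2 =
      ∑ b ∈ headInner π.dissectingArrows p, mergeTerm π p.1 (insertSecond b p.2) := by
  obtain ⟨l₁, l₂⟩ := p
  cases l₂ with
  | nil => simp [innerTerm, headInner, diffTerm]
  | cons a l₂ =>
    have hA := π.dissectingArrows_subset
    simp only at hp ⊢
    have hC := toFinset_mem_dissections hp
    set C := (l₁ ++ a :: l₂).toFinset with hCdef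
    have haC : a ∈ C := by simp [hCdef]
    have hnd := nodup_of_mem_ordLists hp
    have key := armSign_smul_augDiff π hC haC
    have hsC : sgn C = armSign C a * ∏ c ∈ C.erase a, armSign C c := by
      rw [sgn_eq_prod, Finset.mul_prod_erase _ _ haC]
    have hl₁ : ∀ c ∈ l₁, c ∈ C ∧ c ≠ a := by
      intro c hc
      refine ⟨by simp [hCdef, hc], ?_⟩
      rintro rfl
      exact (List.nodup_append.1 hnd).2.2 c hc c (by simp) rfl
    have hl₂ : ∀ c ∈ l₂, c ∈ C ∧ c ≠ a := by
      intro c hc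
      refine ⟨by simp [hCdef, hc], ?_⟩
      rintro rfl
      exact (List.nodup_cons.1 (List.nodup_append.1 hnd).2.1).1 hc
    have hL : innerTerm π l₁ (a :: l₂) =
        (((-1) ^ l₁.length * ∏ c ∈ C.erase a, armSign C c) * armSign C a) •
          wordInsert (Finsupp.single (π.rootRegion C) (1 : ℚ) ⊗ₜ[ℚ] (1 : PolyAlg R))
            (barWord (l₁.map (π.region C))) (barWord (l₂.map (π.region C)))
            (augDiff (augGen (π.region C a))) := by
      rw [innerTerm, ← hCdef, hsC, List.map_cons, diffTerm, wordInsert_apply,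
        mul_comm (armSign C a), mul_assoc]
    refine hL.trans ((smul_map_of_smul_eq_sum (A := AugIdeal R) (M := BarE R S)
      (wordInsert _ _ _) _ (armSign C a) _ _ _ _ key).trans ?_)
    refine Finset.sum_congr rfl fun b hb => ?_
    have hbC : b ∉ C := by
      intro h
      obtain ⟨_, _, hba, _, h4⟩ := Finset.mem_filter.1 hb
      exact (h4 b h hba).1 rfl
    have hset : ∀ c ∈ C, c ≠ a → armSet (C ∪ {b}) c = armSet C c := fun c hc hca =>
      innerArrows_armSet hC haC hb hca (Or.inl hc)
    have hrootne : rootArrow π.size ≠ a := by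
      rintro rfl
      exact (mem_arrows_iff.1 (hA ((mem_dissections.1 hC).1 haC))).2.2 rfl
    have hroot : π.rootRegion (C ∪ {b}) = π.rootRegion C := π.rootRegion_congr
      (innerArrows_armSet hC haC hb hrootne (Or.inr ⟨_, hA, rfl⟩))
    have h₁ : l₁.map (π.region (C ∪ {b})) = l₁.map (π.region C) :=
      List.map_congr_left fun c hc => π.region_congr (hset c (hl₁ c hc).1 (hl₁ c hc).2)
    have h₂ : l₂.map (π.region (C ∪ {b})) = l₂.map (π.region C) :=
      List.map_congr_left fun c hc => π.region_congr (hset c (hl₂ c hc).1 (hl₂ c hc).2)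
    have e : (l₁ ++ a :: b :: l₂).toFinset = C ∪ {b} :=
      toFinset_insert a b l₁ l₂
    have hs := sgn_union_singleton haC hbC hset
    simp only [insertSecond]
    rw [mergeTerm, e, List.map_cons, List.map_cons, pairTerm, hroot, h₁, h₂, hs, wordInsert_apply,
      mul_assoc]

/-- Two cancellations: `sum_firstTerm` for the first bar, and `hT` for the others. -/
theorem barDiff_enhancedB (π : EnhancedPolygon R S) : barDiff (enhancedB π) = 0 := by
  have hA := π.dissectingArrows_subset
  have hT : ∑ p ∈ splits (ordLists π.dissectingArrows), mergeTerm π p.1 p.2 =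
      ∑ p ∈ splits (ordLists π.dissectingArrows), innerTerm π p.1 p.2 := by
    -- Non-nested neighbours cancel by anticommutativity; the nested ones account for the
    -- differentials.
    rw [← Finset.sum_filter_add_sum_filter_not _ (fun p => HeadBelow p.2),
      sum_mergeTerm_not_headBelow, add_zero, sum_headBelow hA (mergeTerm π)]
    exact Finset.sum_congr rfl fun p hp => (innerTerm_eq π (mem_splits.1 hp)).symm
  rw [sum_splits _ (mergeTerm π), sum_splits _ (innerTerm π)] at hT
  have h : ∀ l ∈ ordLists π.dissectingArrows, barDiff (sgn l.toFinset •
      enhWord (π.rootRegion l.toFinset) (l.map (π.region l.toFinset))) =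
      (sgn l.toFinset • (kappaBar (Finsupp.single (π.rootRegion l.toFinset) 1) ⊗ₜ[ℚ]
          barWord (l.map (π.region l.toFinset))) -
        sgn l.toFinset • firstTerm (π.rootRegion l.toFinset) (l.map (π.region l.toFinset))) +
      (∑ i ∈ Finset.range (l.length + 1), mergeTerm π (l.take i) (l.drop i) -
        ∑ i ∈ Finset.range (l.length + 1), innerTerm π (l.take i) (l.drop i)) := by
    intro l _
    rw [map_smul, barDiff_enhWord, smul_add, smul_sub, TensorProduct.tmul_sub, smul_sub,
      List.length_map, TensorProduct.tmul_sum, TensorProduct.tmul_sum, Finset.smul_sum,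
      Finset.smul_sum]
    congr 2
    · refine Finset.sum_congr rfl fun i hi => ?_
      have hlen : (l.take i).length = i := by
        rw [List.length_take]
        have := Finset.mem_range.1 hi
        omega
      rw [mergeTerm, List.take_append_drop, hlen, List.map_take, List.map_drop,
        TensorProduct.tmul_smul, smul_smul, mul_comm]
    · refine Finset.sum_congr rfl fun i hi => ?_
      have hlen : (l.take i).length = i := by
        rw [List.length_take]
        have := Finset.mem_range.1 hi
        omega
      rw [innerTerm, List.take_append_drop, hlen, List.map_take, List.map_drop,
        TensorProduct.tmul_smul, smul_smul, mul_comm]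
  rw [enhancedB_eq, map_sum, Finset.sum_congr rfl h]
  exact sum_sub_add_sub_eq_zero _ _ _ _ _ (sum_firstTerm π) hT

theorem enhancedB_mem_H0 (π : EnhancedPolygon R S) : enhancedB π ∈ H0 R S :=
  ⟨Submodule.sum_mem _ fun _ _ => Submodule.sum_mem _ fun _ _ => Submodule.smul_mem _ _
    (Submodule.subset_span ⟨_, _, rfl⟩), barDiff_enhancedB π⟩

end PolygonBar
end

theorem mainTheorem10 {Λ : Type*} (R S : Set Λ) [PartialOrder S] :
    (∀ π : PolygonBar.EnhancedPolygon R S,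
      PolygonBar.enhancedB π ∈ PolygonBar.H0 R S ∧
      PolygonBar.comoduleMap (PolygonBar.enhancedB π) =
        ∑ D ∈ PolygonBar.admissible π.dissectingArrows,
          PolygonBar.sgn D • (PolygonBar.enhancedB (π.rootRegion D) ⊗ₜ[ℚ]
            PolygonBar.toBar
              (PolygonBar.shuffleProd D fun α => PolygonBar.polygonB (π.region D α)))) ∧
    (∀ v : PolygonBar.VpgBar R S,
      TensorProduct.assoc ℚ _ _ _
          (LinearMap.rTensor (PolygonBar.SymV R) PolygonBar.ckCoaction
            (PolygonBar.ckCoaction v)) =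
        LinearMap.lTensor (PolygonBar.VpgBar R S) PolygonBar.ckCoproduct.toLinearMap
          (PolygonBar.ckCoaction v)) ∧
    (∀ v : PolygonBar.VpgBar R S,
      TensorProduct.rid ℚ _
        (LinearMap.lTensor (PolygonBar.VpgBar R S) PolygonBar.ckCounit.toLinearMap
          (PolygonBar.ckCoaction v)) = v) := by
  refine ⟨fun π => ⟨PolygonBar.enhancedB_mem_H0 π, PolygonBar.comoduleMap_enhancedB π⟩,
    fun v => ?_, fun v => ?_⟩
  · induction v using Finsupp.induction_linear with
    | zero => simp only [map_zero]
    | add x y hx hy => simp only [map_add, hx, hy]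
    | single π c =>
      rw [← mul_one c, ← smul_eq_mul, ← Finsupp.smul_single]
      simp only [map_smul, PolygonBar.ckCoaction_coassoc_single]
  · induction v using Finsupp.induction_linear with
    | zero => simp only [map_zero]
    | add x y hx hy => simp only [map_add, hx, hy]
    | single π c =>
      rw [← mul_one c, ← smul_eq_mul, ← Finsupp.smul_single]
      simp only [map_smul, PolygonBar.ckCoaction_counit_single]
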